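/- **Semimetric spaces.** A pseudo-semimetric on a set $X$ is a map $d\colon X\times X\to[0,\infty]$ (not necessarily symmetric) with $d(x,x)=0$ and $d(x,y)\le d(x,z)+d(z,y)$; it is a semimetric if moreover $d(x,y)=0$ only for $x=y$. Put $d^{\leftrightarrow}(x,y)=\min\{d(x,y),d(y,x)\}$, $\mathcal B^+_r(x)=\{y: d(x,y)\le r\}$, $\mathcal B^-_r(x)=\{y: d(y,x)\le r\}$, and for $A\subseteq X$ let $\mathcal B^\pm_r(A)=\bigcup_{x\in A}\mathcal B^\pm_r(x)$ and $d^{\leftrightarrow}(s,A)=\inf_{p\in A}d^{\leftrightarrow}(s,p)$. The forward (backward) topology is generated by the open out-balls $\{y: d(x,y)<r\}$ (open in-balls $\{y:d(y,x)<r\}$). Real intervals carry the semimetric that is $t-s$ from $s$ to $t$ if $s\le t$ and $\infty$ otherwise. A directed path is a map $P\colon[a,b]\to X$, $a<b$, that is continuous for the forward topologies and for the backward topologies; its length is $\ell(P)=\lim_{N\to\infty}\sum_{i=1}^N d(P(t_{i-1}),P(t_i))$ with $t_i=a+i(b-a)/N$. An $x$-$y$ geodesic is a directed path from $x$ to $y$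 of length $d(x,y)$, and $X$ is geodesic if one exists whenever $d(x,y)<\infty$. For $\delta\ge0$, $X$ is $\delta$-hyperbolic if for any three points $x,y,z$, any $x$-$y$ geodesic $P$, any geodesic $Q$ between $x$ and $z$ and any geodesic $R$ between $y$ and $z$ (each in either direction), $P\subseteq\mathcal B^+_\delta(Q)\cup\mathcal B^-_\delta(R)$. For $f\colon\mathbb R\to\mathbb R$, $X$ satisfies (B1) for $f$ if for all $x\in X$, $r\ge0$ and $y,z\in\mathcal B^+_r(x)$ the distance $d(y,z)$ is either $\infty$ or at most $f(r)$, and (B2) for $f$ if the same holds with $\mathcal B^-_r(x)$. A base is a set $S\subseteq X$ such that every $x\in X$ has $d^{\leftrightarrow}(x,s)<\infty$ for some $s\in S$. **Boundary.** A quasi-geodesic ray (anti-ray) is a map $R\colon[0,\infty)\to X$ ($R\colon(-\infty,0]\to X$), continuous for the forward and for the backward topologies, that eventually (towards $\infty$, respectively $-\infty$) leaves every ball $\mathcal B^+_r(x)$ (respectively $\mathcal B^-_r(x)$), and for which there are $\gamma\ge1$, $c\ge0$ with $\ell(R|_{[u,v]})\le\gamma d(R(u),R(v))+c$ for all $u<v$.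 For an anti-ray and $i>0$, $R(i)$ means $R(-i)$. Write $R_1\le R_2$ if there is $M\ge0$ such that for all $r\ge0$, $x\in X$ there is a directed path of length at most $M$ from a point of $R_1$ to a point of $R_2$ outside of $\mathcal B^+_r(x)\cup\mathcal B^-_r(x)$. The boundary $\partial X$ is the set of equivalence classes of quasi-geodesic rays and anti-rays under $R_1\le R_2\wedge R_2\le R_1$. **The chain distance.** Let $S$ be a finite base and $\varepsilon>0$. For $s\in S$ and $\eta,\mu\in X\cup\partial X$ consider all $R\in\eta$ and $Q\in\mu$, where for a point $x\in X$ the only choice is the constant map with value $x$, and let $$L_s(R,Q)=\liminf\{d^{\leftrightarrow}(s,P): i,j\to\infty,\ P\text{ an }R(i)\text{-}Q(j)\text{ geodesic}\},$$ with $L_s(R,Q)=-\infty$ if for some $n$ there is no such geodesic with $i,j\ge n$. Put $\rho_s(\eta,\mu)=\sup_{R,Q}L_s(R,Q)$, $\rho_S=\min_{s\in S}\rho_s$, $\rho_s^\varepsilon(\eta,\mu)=\inf_{R,Q}e^{-\varepsilon L_s(R,Q)}$ and $\rho_S^\varepsilon=\max_{s\in S}\rho_s^\varepsilon$ (with $e^{-\infty}=0$,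 $e^{\infty}=\infty$), and $$d_{S,\varepsilon}(\eta,\mu)=\inf\Big\{\sum_{i=0}^{n-1}\rho_S^\varepsilon(\eta_i,\eta_{i+1}) : n\ge0,\ \eta=\eta_0,\eta_1,\dots,\eta_n=\mu\in X\cup\partial X\Big\}.$$ **Theorem.** Let $\delta\ge0$ and let $X$ be a $\delta$-hyperbolic geodesic semimetric space with a finite base $S$ that satisfies (B1) and (B2) for a function $f\colon\mathbb R\to\mathbb R$. Let $\varepsilon>0$ be such that $\varepsilon':=e^{2\varepsilon(6\delta+2\delta f(\delta+1))}<\sqrt2$. Then $d_{S,\varepsilon}$ is a pseudo-semimetric on $X\cup\partial X$, and it is visual with parameter $a=e^{\varepsilon}>1$: there is $C>0$ such that $$\tfrac1C a^{-\rho_S(\eta,\mu)}\le d_{S,\varepsilon}(\eta,\mu)\le C a^{-\rho_S(\eta,\mu)}.$$ Moreover $$(3-2\varepsilon')\,\rho_S^\varepsilon(\eta,\mu)\le d_{S,\varepsilon}(\eta,\mu)\le\rho_S^\varepsilon(\eta,\mu).$$ In both displays the upper bound holds for all $\eta,\mu\in X\cup\partial X$, and the lower bound for all $\eta,\mu\in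 X\cup\partial X$ except when $\eta=\mu$ is a point of $X$. -/

import Mathlib

open scoped ENNReal Topology

noncomputable section

namespace SemiMet

/-- Pseudo-semimetric: zero on the diagonal, triangle inequality, values in `[0,∞]`, no symmetry. -/
structure IsPseudoSemimetric {X : Type*} (d : X → X → ℝ≥0∞) : Prop where
  refl : ∀ x, d x x = 0
  triangle : ∀ x y z, d x y ≤ d x z + d z y

/-- Semimetric: a pseudo-semimetric whose zero set is the diagonal. -/
structure IsSemimetric {X : Type*} (d : X → X → ℝ≥0∞) : Prop extends IsPseudoSemimetric d where
  eq_zero_iff : ∀ x y, d x y = 0 ↔ x = y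

/-- `d↔(x,y) = min {d(x,y), d(y,x)}`. -/
def dSym {X : Type*} (d : X → X → ℝ≥0∞) (x y : X) : ℝ≥0∞ := min (d x y) (d y x)

/-- Out-ball of radius `r` around a point. -/
def outBall {X : Type*} (d : X → X → ℝ≥0∞) (r : ℝ) (x : X) : Set X :=
  {y | d x y ≤ ENNReal.ofReal r}

/-- In-ball of radius `r` around a point. -/
def inBall {X : Type*} (d : X → X → ℝ≥0∞) (r : ℝ) (x : X) : Set X :=
  {y | d y x ≤ ENNReal.ofReal r}

/-- Out-ball of radius `r` around a set. -/
def outBallSet {X : Type*} (d : X → X → ℝ≥0∞) (r : ℝ) (A : Set X) : Set X :=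
  ⋃ x ∈ A, outBall d r x

/-- In-ball of radius `r` around a set. -/
def inBallSet {X : Type*} (d : X → X → ℝ≥0∞) (r : ℝ) (A : Set X) : Set X :=
  ⋃ x ∈ A, inBall d r x

/-- The forward topology, generated by the open out-balls. -/
def forwardTopology {X : Type*} (d : X → X → ℝ≥0∞) : TopologicalSpace X :=
  TopologicalSpace.generateFrom
    {U | ∃ (x : X) (r : ℝ), 0 ≤ r ∧ U = {y | d x y < ENNReal.ofReal r}}

/-- The backward topology, generated by the open in-balls. -/
def backwardTopology {X : Type*} (d : X → X → ℝ≥0∞) : TopologicalSpace X :=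
  TopologicalSpace.generateFrom
    {U | ∃ (x : X) (r : ℝ), 0 ≤ r ∧ U = {y | d y x < ENNReal.ofReal r}}

/-- The real line as a directed line: `d(s,t) = t - s` if `s ≤ t`, and `∞` otherwise. -/
def dirDist (s t : ℝ) : ℝ≥0∞ := if s ≤ t then ENNReal.ofReal (t - s) else ⊤

/-- `P` is, on the interval `I` of the directed line, continuous with respect to the forward
topologies and with respect to the backward topologies. -/
def BiContOn {X : Type*} (d : X → X → ℝ≥0∞) (P : ℝ → X) (I : Set ℝ) : Prop :=
  @ContinuousOn ℝ X (forwardTopology dirDist) (forwardTopology d) P I ∧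
    @ContinuousOn ℝ X (backwardTopology dirDist) (backwardTopology d) P I

/-- `P`, restricted to `[a,b]`, is a directed path. Only the values on `[a,b]` matter. -/
def IsDirectedPath {X : Type*} (d : X → X → ℝ≥0∞) (P : ℝ → X) (a b : ℝ) : Prop :=
  a < b ∧ BiContOn d P (Set.Icc a b)

/-- The length of `P` on `[a,b]` is `L`: the sums along the equidistant subdivisions into `N`
parts converge to `L`. -/
def HasLength {X : Type*} (d : X → X → ℝ≥0∞) (P : ℝ → X) (a b : ℝ) (L : ℝ≥0∞) : Prop :=
  Filter.Tendsto
    (fun N : ℕ => ∑ i ∈ Finset.range N,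
      d (P (a + (i : ℝ) * (b - a) / (N : ℝ))) (P (a + ((i : ℝ) + 1) * (b - a) / (N : ℝ))))
    Filter.atTop (𝓝 L)

/-- `P`, restricted to `[a,b]`, is an `x`-`y` geodesic. -/
structure IsGeodesic {X : Type*} (d : X → X → ℝ≥0∞) (P : ℝ → X) (a b : ℝ) (x y : X) : Prop where
  path : IsDirectedPath d P a b
  start : P a = x
  finish : P b = y
  length : HasLength d P a b (d x y)

/-- Geodesic space: points at finite distance are joined by a geodesic. -/
def IsGeodesicSpace {X : Type*} (d : X → X → ℝ≥0∞) : Prop :=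
  ∀ x y, d x y < ⊤ → ∃ (P : ℝ → X) (a b : ℝ), IsGeodesic d P a b x y

/-- `P` on `[a,b]` is a geodesic from `x` to `y` or from `y` to `x`. -/
def IsGeodesicBetween {X : Type*} (d : X → X → ℝ≥0∞) (P : ℝ → X) (a b : ℝ) (x y : X) : Prop :=
  IsGeodesic d P a b x y ∨ IsGeodesic d P a b y x

/-- All geodesic triangles are `δ`-thin: if `P` is a side from `x` to `y`, `Q` is the side between
`x` and `z`, and `R` is the side between `y` and `z` (in whatever direction), then `P` lies in the
union of the `δ`-out-ball around `Q` and the `δ`-in-ball around `R`. -/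
def IsHyperbolic {X : Type*} (d : X → X → ℝ≥0∞) (δ : ℝ) : Prop :=
  ∀ (x y z : X) (P Q R : ℝ → X) (a b a' b' a'' b'' : ℝ),
    IsGeodesic d P a b x y → IsGeodesicBetween d Q a' b' x z →
    IsGeodesicBetween d R a'' b'' y z →
    P '' Set.Icc a b ⊆
      outBallSet d δ (Q '' Set.Icc a' b') ∪ inBallSet d δ (R '' Set.Icc a'' b'')

/-- Condition (B1) for the function `f`. -/
def BoundedOut {X : Type*} (d : X → X → ℝ≥0∞) (f : ℝ → ℝ) : Prop :=
  ∀ (x : X) (r : ℝ), 0 ≤ r → ∀ y ∈ outBall d r x, ∀ z ∈ outBall d r x,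
    d y z = ⊤ ∨ (d y z).toReal ≤ f r

/-- Condition (B2) for the function `f`. -/
def BoundedIn {X : Type*} (d : X → X → ℝ≥0∞) (f : ℝ → ℝ) : Prop :=
  ∀ (x : X) (r : ℝ), 0 ≤ r → ∀ y ∈ inBall d r x, ∀ z ∈ inBall d r x,
    d y z = ⊤ ∨ (d y z).toReal ≤ f r

/-- `S` is a base: every point has finite `d↔`-distance to some point of `S`. -/
def IsBase {X : Type*} (d : X → X → ℝ≥0∞) (S : Set X) : Prop :=
  ∀ x, ∃ s ∈ S, dSym d x s < ⊤

/-- Along the interval `I`, `R` is `(γ,c)`-quasi-geodesic for some `γ ≥ 1` and `c ≥ 0`: the length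
of every subpath is at most `γ` times the distance of its ends plus `c`. -/
def IsQuasiGeodesicOn {X : Type*} (d : X → X → ℝ≥0∞) (R : ℝ → X) (I : Set ℝ) : Prop :=
  ∃ γ c : ℝ, 1 ≤ γ ∧ 0 ≤ c ∧ ∀ u ∈ I, ∀ v ∈ I, u < v →
    ∃ L, HasLength d R u v L ∧ L ≤ ENNReal.ofReal γ * d (R u) (R v) + ENNReal.ofReal c

/-- Quasi-geodesic ray, on `[0,∞)`: it eventually leaves every out-ball. -/
structure IsQGRay {X : Type*} (d : X → X → ℝ≥0∞) (R : ℝ → X) : Prop where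
  cont : BiContOn d R (Set.Ici 0)
  leaves : ∀ (x : X) (r : ℝ), 0 ≤ r → ∃ p : ℝ, 0 ≤ p ∧ ∀ t, p ≤ t → R t ∉ outBall d r x
  quasi : IsQuasiGeodesicOn d R (Set.Ici 0)

/-- Quasi-geodesic anti-ray, on `(-∞,0]`: towards `-∞` it eventually leaves every in-ball. -/
structure IsQGAntiRay {X : Type*} (d : X → X → ℝ≥0∞) (R : ℝ → X) : Prop where
  cont : BiContOn d R (Set.Iic 0)
  leaves : ∀ (x : X) (r : ℝ), 0 ≤ r → ∃ p : ℝ, p ≤ 0 ∧ ∀ t, t ≤ p → R t ∉ inBall d r x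
  quasi : IsQuasiGeodesicOn d R (Set.Iic 0)

/-- The quasi-geodesic rays (left) and quasi-geodesic anti-rays (right). -/
def QGLine {X : Type*} (d : X → X → ℝ≥0∞) : Type _ :=
  {R : ℝ → X // IsQGRay d R} ⊕ {R : ℝ → X // IsQGAntiRay d R}

/-- The point `R(i)` for `i ≥ 0`, where `R(i)` means `R(-i)` if `R` is an anti-ray. -/
def QGLine.pt {X : Type*} {d : X → X → ℝ≥0∞} : QGLine d → ℝ → X
  | Sum.inl R => fun i => R.1 i
  | Sum.inr R => fun i => R.1 (-i)

/-- The set of points on a ray or anti-ray. -/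
def QGLine.carrier {X : Type*} {d : X → X → ℝ≥0∞} (R : QGLine d) : Set X :=
  R.pt '' Set.Ici 0

/-- `R₁ ≤ R₂`: for some `M ≥ 0`, outside of every union of an out-ball and an in-ball of finite
radius around a point there is a directed `R₁`-`R₂` path of length at most `M`. -/
def QGLine.le {X : Type*} {d : X → X → ℝ≥0∞} (R₁ R₂ : QGLine d) : Prop :=
  ∃ M : ℝ, 0 ≤ M ∧ ∀ (r : ℝ), 0 ≤ r → ∀ x : X,
    ∃ (P : ℝ → X) (a b : ℝ) (L : ℝ≥0∞), IsDirectedPath d P a b ∧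
      P a ∈ R₁.carrier ∧ P b ∈ R₂.carrier ∧ HasLength d P a b L ∧ L ≤ ENNReal.ofReal M ∧
      ∀ t ∈ Set.Icc a b, P t ∉ outBall d r x ∪ inBall d r x

/-- The quasi-geodesic boundary `∂X`: classes of quasi-geodesic rays and anti-rays under
`R₁ ≤ R₂ ∧ R₂ ≤ R₁`. -/
def Boundary {X : Type*} (d : X → X → ℝ≥0∞) : Type _ :=
  Quot (fun R₁ R₂ : QGLine d => R₁.le R₂ ∧ R₂.le R₁)

/-- `X ∪ ∂X`. -/
abbrev Completion {X : Type*} (d : X → X → ℝ≥0∞) : Type _ := X ⊕ Boundary d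

/-- The maps `i ↦ R(i)` along which an element of `X ∪ ∂X` is approached: for a boundary point
these are given by the rays and anti-rays in it, for a point of `X` it is the constant map. -/
def reps {X : Type*} {d : X → X → ℝ≥0∞} : Completion d → Set (ℝ → X)
  | Sum.inl x => {fun _ => x}
  | Sum.inr η => {α | ∃ R : QGLine d, Quot.mk _ R = η ∧ α = R.pt}

/-- `d↔(s,A)` for a set `A`. -/
def dSymSet {X : Type*} (d : X → X → ℝ≥0∞) (s : X) (A : Set X) : ℝ≥0∞ := ⨅ p ∈ A, dSym d s p

/-- The values `d↔(s,P)` for the `α(i)`-`β(j)` geodesics `P` with `i, j ≥ n`. -/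
def geodVals {X : Type*} (d : X → X → ℝ≥0∞) (s : X) (α β : ℝ → X) (n : ℕ) : Set ℝ≥0∞ :=
  {v | ∃ i j : ℝ, (n : ℝ) ≤ i ∧ (n : ℝ) ≤ j ∧ ∃ (P : ℝ → X) (a b : ℝ),
    IsGeodesic d P a b (α i) (β j) ∧ v = dSymSet d s (P '' Set.Icc a b)}

open Classical in
/-- `liminf {d↔(s,P) | i, j → ∞, P is an α(i)-β(j) geodesic}`. If for large `i, j` there are no
such geodesics at all, then it is `-∞`. For constant `α` and `β` it is the infimum of `d↔(s,P)`
over all geodesics `P` between the two points. -/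
def geodLiminf {X : Type*} (d : X → X → ℝ≥0∞) (s : X) (α β : ℝ → X) : EReal :=
  if ∀ n : ℕ, (geodVals d s α β n).Nonempty then
    ((⨆ n : ℕ, sInf (geodVals d s α β n) : ℝ≥0∞) : EReal)
  else ⊥

/-- `ρ_s(η,μ)`. -/
def rhoAt {X : Type*} {d : X → X → ℝ≥0∞} (s : X) (η μ : Completion d) : EReal :=
  ⨆ α ∈ reps η, ⨆ β ∈ reps μ, geodLiminf d s α β

/-- `ρ_S(η,μ)`, the minimum of the `ρ_s(η,μ)`. -/
def rho {X : Type*} {d : X → X → ℝ≥0∞} (S : Finset X) (η μ : Completion d) : EReal :=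
  ⨅ s ∈ S, rhoAt s η μ

/-- `ρ_s^ε(η,μ)`; here `e^{-∞} = 0` and `e^{∞} = ∞`. -/
def rhoExpAt {X : Type*} {d : X → X → ℝ≥0∞} (ε : ℝ) (s : X) (η μ : Completion d) : ℝ≥0∞ :=
  ⨅ α ∈ reps η, ⨅ β ∈ reps μ, EReal.exp (-((ε : EReal) * geodLiminf d s α β))

/-- `ρ_S^ε(η,μ)`, the maximum of the `ρ_s^ε(η,μ)`. -/
def rhoExp {X : Type*} {d : X → X → ℝ≥0∞} (S : Finset X) (ε : ℝ) (η μ : Completion d) : ℝ≥0∞ :=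
  ⨆ s ∈ S, rhoExpAt ε s η μ

/-- `d_{S,ε}(η,μ)`, the infimum of the sums of `ρ_S^ε` along the finite chains
`η = η₀, …, ηₙ = μ` (with `n = 0` allowed if `η = μ`). -/
def chainDist {X : Type*} {d : X → X → ℝ≥0∞} (S : Finset X) (ε : ℝ) (η μ : Completion d) : ℝ≥0∞ :=
  ⨅ (n : ℕ) (c : ℕ → Completion d) (_ : c 0 = η) (_ : c n = μ),
    ∑ i ∈ Finset.range n, rhoExp S ε (c i) (c (i + 1))

/-- `η` and `μ` are one and the same point of `X`. -/
def SamePoint {X : Type*} {d : X → X → ℝ≥0∞} (η μ : Completion d) : Prop :=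
  ∃ x : X, η = Sum.inl x ∧ μ = Sum.inl x

/-- `D` is a visual pseudo-semimetric with parameter `a > 1` on `X ∪ ∂X`. The lower bound is not
asked for `η = μ ∈ X`, where `D` vanishes although `a^{-ρ_S}` is positive. -/
structure IsVisualPseudoSemimetric {X : Type*} {d : X → X → ℝ≥0∞} (S : Finset X) (a : ℝ)
    (D : Completion d → Completion d → ℝ≥0∞) : Prop where
  pseudo : IsPseudoSemimetric D
  one_lt : 1 < a
  bounds : ∃ C : ℝ, 0 < C ∧ ∀ η μ : Completion d,
    (¬ SamePoint η μ →
      ENNReal.ofReal (1 / C) * EReal.exp (-((Real.log a : EReal) * rho S η μ)) ≤ D η μ) ∧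
    D η μ ≤ ENNReal.ofReal C * EReal.exp (-((Real.log a : EReal) * rho S η μ))

end SemiMet

end

/-! The upper bounds come from chains with one link. The map `x ↦ e^{-εx}` turns the suprema and
minima in `ρ_S` into infima and maxima, so `ρ_S^ε = e^{-ερ_S}`, and the visual bounds are the second
display with `3 - 2ε' > 0` absorbed in `C`. The lower bound rests on the quasi-ultrametric
inequality `ρ_S^ε(η,ν) ≤ ε' max {ρ_S^ε(η,μ), ρ_S^ε(μ,ν)}` (`rhoExp_le_mul_max`). Frink's chain
argument `mul_le_chain_sum` applies to it because `ε'^2 ≤ 2` and `(3 - 2ε')ε'^2 ≤ 1`.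

The inequality is a statement about geodesics, `Freq.split`. Let late geodesics from `α` to `γ` pass
within `m` of `s`, and let `β`, `β'` represent `μ`. Then late geodesics from `α` to `β`, or from
`β'` to `γ`, pass within `m + 2(6δ + 2δf(δ+1))` of `s`, up to `τ`. Indeed, a quadrilateral through
`α`, `β`, `β'`, `γ` is cut into two triangles at a cost of `4δ` each, and its side from `β` to `β'`
is degenerate or far from `s`. Since distances may be infinite, this quadrilateral need not exist
for the given ends of the geodesic. The start may have to move along a backward `α` and the end
along a forward `γ`, each at a cost of at most `2δ + 2δf(δ+1)` (`IsEnd.shift_start`,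
`IsEnd.shift_end`).

Thin triangles bound distances in one direction only. `parallel_start` and `parallel_end` turn such
a bound around for geodesics with a common end, and `reverse_end` uses (B2) to bound a distance
through two distances to a common target.

Both the far side and the shifts need that geodesics between late points of one ray leave every ball
(`CoarseRay.far`). This follows from a Morse lemma, `HypSpace.stability`: a geodesic is
logarithmically close to every path with the same ends, and for a quasi-geodesic this allows any
large bound to be lowered by `1`. The equivalence of rays enters only through `Hop`. -/

namespace SemiMet

/-- `d(x,y) ≤ r` for a real `r`. -/
def Wi {X : Type*} (d : X → X → ℝ≥0∞) (r : ℝ) (x y : X) : Prop := d x y ≤ ENNReal.ofReal r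

/-- `d↔(s,p) ≤ r` for a real `r`. -/
def Near {X : Type*} (d : X → X → ℝ≥0∞) (r : ℝ) (s p : X) : Prop := Wi d r s p ∨ Wi d r p s

/-- The opposite distance. -/
def op {X : Type*} (d : X → X → ℝ≥0∞) : X → X → ℝ≥0∞ := fun x y => d y x

/-- One-sided continuity in both directions, in terms of `ε` and `η`. -/
structure OneSided {X : Type*} (d : X → X → ℝ≥0∞) (P : ℝ → X) (I : Set ℝ) : Prop where
  right : ∀ t ∈ I, ∀ ε : ℝ, 0 < ε → ∃ η : ℝ, 0 < η ∧ ∀ t' ∈ I, t ≤ t' → t' < t + η → Wi d ε (P t) (P t')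
  left : ∀ t ∈ I, ∀ ε : ℝ, 0 < ε → ∃ η : ℝ, 0 < η ∧ ∀ t' ∈ I, t - η < t' → t' ≤ t → Wi d ε (P t') (P t)

/-! ### Forward and backward continuity as one-sided continuity -/

section Topo

/-- The open out-balls of the directed line are the half-open intervals `[x, x + r)`. So forward
continuity is continuity from the right, and dually backward continuity is continuity from the left.
-/
lemma forward_nhds {U : Set ℝ} (hU : (forwardTopology dirDist).IsOpen U) :
    ∀ t ∈ U, ∃ η : ℝ, 0 < η ∧ ∀ t', t ≤ t' → t' < t + η → t' ∈ U := by
  induction hU with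
  | basic s hs =>
    obtain ⟨x, r, hr, rfl⟩ := hs
    intro t ht
    simp only [Set.mem_ofPred_eq, dirDist] at ht ⊢
    split_ifs at ht with h
    · rw [ENNReal.ofReal_lt_ofReal_iff_of_nonneg (by linarith)] at ht
      refine ⟨r - (t - x), by linarith, fun t' h1 h2 => ?_⟩
      rw [if_pos (h.trans h1), ENNReal.ofReal_lt_ofReal_iff_of_nonneg (by linarith)]
      linarith
    · simp at ht
  | univ => exact fun t _ => ⟨1, one_pos, fun _ _ _ => trivial⟩
  | inter s u _ _ h1 h2 =>
    intro t ht
    obtain ⟨a, ha, ha'⟩ := h1 t ht.1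
    obtain ⟨b, hb, hb'⟩ := h2 t ht.2
    refine ⟨min a b, lt_min ha hb, fun t' h h' => ⟨ha' t' h ?_, hb' t' h ?_⟩⟩
    · linarith [min_le_left a b]
    · linarith [min_le_right a b]
  | sUnion S _ ih =>
    rintro t ⟨s, hs, ht⟩
    obtain ⟨a, ha, ha'⟩ := ih s hs t ht
    exact ⟨a, ha, fun t' h h' => ⟨s, hs, ha' t' h h'⟩⟩

lemma backward_nhds {U : Set ℝ} (hU : (backwardTopology dirDist).IsOpen U) :
    ∀ t ∈ U, ∃ η : ℝ, 0 < η ∧ ∀ t', t - η < t' → t' ≤ t → t' ∈ U := by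
  induction hU with
  | basic s hs =>
    obtain ⟨x, r, hr, rfl⟩ := hs
    intro t ht
    simp only [Set.mem_ofPred_eq, dirDist] at ht ⊢
    split_ifs at ht with h
    · rw [ENNReal.ofReal_lt_ofReal_iff_of_nonneg (by linarith)] at ht
      refine ⟨r - (x - t), by linarith, fun t' h1 h2 => ?_⟩
      rw [if_pos (h2.trans h), ENNReal.ofReal_lt_ofReal_iff_of_nonneg (by linarith)]
      linarith
    · simp at ht
  | univ => exact fun t _ => ⟨1, one_pos, fun _ _ _ => trivial⟩
  | inter s u _ _ h1 h2 =>
    intro t ht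
    obtain ⟨a, ha, ha'⟩ := h1 t ht.1
    obtain ⟨b, hb, hb'⟩ := h2 t ht.2
    refine ⟨min a b, lt_min ha hb, fun t' h h' => ⟨ha' t' ?_ h', hb' t' ?_ h'⟩⟩
    · linarith [min_le_left a b]
    · linarith [min_le_right a b]
  | sUnion S _ ih =>
    rintro t ⟨s, hs, ht⟩
    obtain ⟨a, ha, ha'⟩ := ih s hs t ht
    exact ⟨a, ha, fun t' h h' => ⟨s, hs, ha' t' h h'⟩⟩

variable {X : Type*} {d : X → X → ℝ≥0∞}

lemma BiContOn.oneSided (hd : IsPseudoSemimetric d) {P : ℝ → X} {I : Set ℝ} (h : BiContOn d P I) :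
    OneSided d P I := by
  refine ⟨fun t ht ε hε => ?_, fun t ht ε hε => ?_⟩
  · have h1 := (@continuousOn_to_generateFrom_iff ℝ (forwardTopology dirDist) I X _ P).1 h.1 t ht
      {y | d (P t) y < ENNReal.ofReal ε} ⟨P t, ε, hε.le, rfl⟩ (by simpa [hd.refl] using hε)
    obtain ⟨U, hU, htU, hs⟩ := (@mem_nhdsWithin ℝ (forwardTopology dirDist) _ _ _).1 h1
    obtain ⟨η, hη, h2⟩ := forward_nhds hU t htU
    exact ⟨η, hη, fun t' ht' h3 h4 => le_of_lt (hs ⟨h2 t' h3 h4, ht'⟩)⟩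
  · have h1 := (@continuousOn_to_generateFrom_iff ℝ (backwardTopology dirDist) I X _ P).1 h.2 t ht
      {y | d y (P t) < ENNReal.ofReal ε} ⟨P t, ε, hε.le, rfl⟩ (by simpa [hd.refl] using hε)
    obtain ⟨U, hU, htU, hs⟩ := (@mem_nhdsWithin ℝ (backwardTopology dirDist) _ _ _).1 h1
    obtain ⟨η, hη, h2⟩ := backward_nhds hU t htU
    exact ⟨η, hη, fun t' ht' h3 h4 => le_of_lt (hs ⟨h2 t' h3 h4, ht'⟩)⟩

lemma OneSided.biContOn (hd : IsPseudoSemimetric d) {P : ℝ → X} {I : Set ℝ} (h : OneSided d P I) :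
    BiContOn d P I := by
  have key : ∀ a b : ℝ≥0∞, a < b → ∃ ε : ℝ, 0 < ε ∧ a + ENNReal.ofReal ε < b := by
    intro a b hab
    obtain ⟨e, he, hlt⟩ := ENNReal.lt_iff_exists_add_pos_lt.1 hab
    exact ⟨e, he, by simpa using hlt⟩
  refine ⟨?_, ?_⟩
  · refine (@continuousOn_to_generateFrom_iff ℝ (forwardTopology dirDist) I X _ P).2 ?_
    rintro t ht _ ⟨z, r, hr, rfl⟩ hz
    obtain ⟨ε, hε, hlt⟩ := key _ _ hz
    obtain ⟨η, hη, h2⟩ := h.right t ht ε hε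
    refine (@mem_nhdsWithin ℝ (forwardTopology dirDist) _ _ _).2
      ⟨{y | dirDist t y < ENNReal.ofReal η}, TopologicalSpace.GenerateOpen.basic _ ⟨t, η, hη.le, rfl⟩,
        by simpa [dirDist] using hη, ?_⟩
    rintro t' ⟨h3, h4⟩
    simp only [Set.mem_ofPred_eq, dirDist] at h3
    split_ifs at h3 with h5
    · rw [ENNReal.ofReal_lt_ofReal_iff hη] at h3
      exact lt_of_le_of_lt ((hd.triangle _ _ (P t)).trans
        (add_le_add le_rfl (h2 t' h4 h5 (by linarith)))) hlt
    · simp at h3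
  · refine (@continuousOn_to_generateFrom_iff ℝ (backwardTopology dirDist) I X _ P).2 ?_
    rintro t ht _ ⟨z, r, hr, rfl⟩ hz
    obtain ⟨ε, hε, hlt⟩ := key _ _ hz
    obtain ⟨η, hη, h2⟩ := h.left t ht ε hε
    refine (@mem_nhdsWithin ℝ (backwardTopology dirDist) _ _ _).2
      ⟨{y | dirDist y t < ENNReal.ofReal η}, TopologicalSpace.GenerateOpen.basic _ ⟨t, η, hη.le, rfl⟩,
        by simpa [dirDist] using hη, ?_⟩
    rintro t' ⟨h3, h4⟩
    simp only [Set.mem_ofPred_eq, dirDist] at h3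
    split_ifs at h3 with h5
    · rw [ENNReal.ofReal_lt_ofReal_iff hη] at h3
      refine lt_of_le_of_lt ((hd.triangle _ _ (P t)).trans ?_) hlt
      rw [add_comm]
      exact add_le_add le_rfl (h2 t' h4 (by linarith) h5)
    · simp at h3

lemma OneSided.mono {P : ℝ → X} {I J : Set ℝ} (h : OneSided d P I) (hJ : J ⊆ I) :
    OneSided d P J := by
  refine ⟨fun t ht ε hε => ?_, fun t ht ε hε => ?_⟩
  · obtain ⟨η, hη, h1⟩ := h.right t (hJ ht) ε hε
    exact ⟨η, hη, fun t' ht' => h1 t' (hJ ht')⟩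
  · obtain ⟨η, hη, h1⟩ := h.left t (hJ ht) ε hε
    exact ⟨η, hη, fun t' ht' => h1 t' (hJ ht')⟩

end Topo

/-! ### Finite distances, reversal and real induction -/

section Wi

variable {X : Type*} {d : X → X → ℝ≥0∞}

lemma Wi.mono {r s : ℝ} {x y : X} (h : Wi d r x y) (hrs : r ≤ s) : Wi d s x y :=
  h.trans (ENNReal.ofReal_le_ofReal hrs)

lemma Wi.ne_top {r : ℝ} {x y : X} (h : Wi d r x y) : d x y ≠ ⊤ :=
  (lt_of_le_of_lt h ENNReal.ofReal_lt_top).ne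

lemma Wi.trans (hd : IsPseudoSemimetric d) {r s : ℝ} {x y z : X} (hr : 0 ≤ r) (hs : 0 ≤ s)
    (h : Wi d r x y) (h' : Wi d s y z) : Wi d (r + s) x z := by
  unfold Wi at *
  rw [ENNReal.ofReal_add hr hs]
  exact (hd.triangle x z y).trans (add_le_add h h')

lemma wi_of_ne_top {x y : X} (h : d x y ≠ ⊤) : Wi d (d x y).toReal x y := by
  unfold Wi
  rw [ENNReal.ofReal_toReal h]

lemma ne_top_trans (hd : IsPseudoSemimetric d) {x y z : X} (h : d x y ≠ ⊤) (h' : d y z ≠ ⊤) :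
    d x z ≠ ⊤ :=
  (lt_of_le_of_lt (hd.triangle x z y) (ENNReal.add_lt_top.2 ⟨h.lt_top, h'.lt_top⟩)).ne

lemma Near.mono {r s : ℝ} {x y : X} (h : Near d r x y) (hrs : r ≤ s) : Near d s x y :=
  h.imp (·.mono hrs) (·.mono hrs)

lemma near_op {r : ℝ} {x y : X} : Near (op d) r x y ↔ Near d r x y := or_comm

lemma IsPseudoSemimetric.op (hd : IsPseudoSemimetric d) : IsPseudoSemimetric (op d) :=
  ⟨fun x => hd.refl x, fun x y z => (hd.triangle y x z).trans (by rw [add_comm]; rfl)⟩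

/-- Induction along a real interval. -/
lemma Icc_induction {a b : ℝ} (hab : a ≤ b) (p : ℝ → Prop)
    (h1 : ∀ t, a ≤ t → t ≤ b → (∀ t', a ≤ t' → t' < t → p t') → p t)
    (h2 : ∀ t, a ≤ t → t ≤ b → (∀ t', a ≤ t' → t' ≤ t → p t') →
      ∃ η : ℝ, 0 < η ∧ ∀ t', t ≤ t' → t' < t + η → t' ≤ b → p t') : p b := by
  let A : Set ℝ := {t | a ≤ t ∧ t ≤ b ∧ ∀ t', a ≤ t' → t' ≤ t → p t'}
  have haA : a ∈ A := ⟨le_rfl, hab, fun t' h h' => by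
    obtain rfl : t' = a := le_antisymm h' h
    exact h1 _ le_rfl hab fun t'' h h' => absurd h (not_le.2 h')⟩
  have hbdd : BddAbove A := ⟨b, fun t ht => ht.2.1⟩
  set c := sSup A with hc
  have hac : a ≤ c := le_csSup hbdd haA
  have hcb : c ≤ b := csSup_le ⟨a, haA⟩ fun t ht => ht.2.1
  have hlt : ∀ t', a ≤ t' → t' < c → p t' := by
    intro t' h h'
    obtain ⟨t, ht, h3⟩ := exists_lt_of_lt_csSup ⟨a, haA⟩ h'
    exact ht.2.2 t' h h3.le
  have hle : ∀ t', a ≤ t' → t' ≤ c → p t' := by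
    intro t' h h'
    rcases h'.lt_or_eq with h' | rfl
    · exact hlt t' h h'
    · exact h1 _ h hcb hlt
  obtain ⟨η, hη, h3⟩ := h2 c hac hcb hle
  by_contra hb
  have hcb' : c < b := lt_of_le_of_ne hcb fun h => hb (h ▸ hle c hac le_rfl)
  have : min b (c + η / 2) ∈ A := by
    refine ⟨le_min hab (by linarith), min_le_left _ _, fun t' h h' => ?_⟩
    rcases le_total t' c with h4 | h4
    · exact hle t' h h4
    · exact h3 t' h4 (by linarith [h'.trans (min_le_right _ _)]) (h'.trans (min_le_left _ _))
  have h5 := le_csSup hbdd this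
  have : c < min b (c + η / 2) := lt_min hcb' (by linarith)
  linarith

/-- Real induction: left continuity carries finiteness to a limit time, right continuity carries it
beyond. -/
lemma OneSided.ne_top (hd : IsPseudoSemimetric d) {P : ℝ → X} {a b : ℝ} (hab : a ≤ b)
    (h : OneSided d P (Set.Icc a b)) : d (P a) (P b) ≠ ⊤ := by
  refine Icc_induction hab (fun t => d (P a) (P t) ≠ ⊤) ?_ ?_
  · intro t h1 h2 h3
    rcases h1.eq_or_lt with rfl | h1'
    · simp [hd.refl]
    · obtain ⟨η, hη, h4⟩ := h.left t ⟨h1, h2⟩ 1 one_pos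
      have h5 : max a (t - η / 2) < t := max_lt h1' (by linarith)
      exact ne_top_trans hd (h3 _ (le_max_left _ _) h5) (h4 _ ⟨le_max_left _ _, by linarith⟩
        (by linarith [le_max_right a (t - η / 2)]) h5.le).ne_top
  · intro t h1 h2 h3
    obtain ⟨η, hη, h4⟩ := h.right t ⟨h1, h2⟩ 1 one_pos
    exact ⟨η, hη, fun t' h5 h6 h7 => ne_top_trans hd (h3 t h1 le_rfl)
      (h4 t' ⟨h1.trans h5, h7⟩ h5 h6).ne_top⟩

end Wi

/-! ### Length and variation -/

section Length

variable {X : Type*} {d : X → X → ℝ≥0∞}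

/-- Along each monotone sequence in `[a,b]` the distances add up to at most `L`. -/
def VarLe (d : X → X → ℝ≥0∞) (P : ℝ → X) (a b : ℝ) (L : ℝ≥0∞) : Prop :=
  ∀ (n : ℕ) (t : ℕ → ℝ), Monotone t → (∀ i, t i ∈ Set.Icc a b) →
    ∑ i ∈ Finset.range n, d (P (t i)) (P (t (i + 1))) ≤ L

lemma dist_le_sum_Ico (hd : IsPseudoSemimetric d) (x : ℕ → X) {m n : ℕ} (h : m ≤ n) :
    d (x m) (x n) ≤ ∑ i ∈ Finset.Ico m n, d (x i) (x (i + 1)) := by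
  induction n, h using Nat.le_induction with
  | base => simp [hd.refl]
  | succ n hn ih =>
    rw [Finset.sum_Ico_succ_top hn]
    exact (hd.triangle _ _ (x n)).trans (add_le_add ih le_rfl)

lemma HasLength.dist_le (hd : IsPseudoSemimetric d) {P : ℝ → X} {a b : ℝ} {L : ℝ≥0∞}
    (h : HasLength d P a b L) : d (P a) (P b) ≤ L := by
  refine ge_of_tendsto h (Filter.eventually_atTop.2 ⟨1, fun N hN => ?_⟩)
  have hN' : (N : ℝ) ≠ 0 := by positivity
  have := dist_le_sum_Ico hd (fun i : ℕ => P (a + (i : ℝ) * (b - a) / N)) (Nat.zero_le N)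
  simp only [Nat.cast_zero, zero_mul, zero_div, add_zero, mul_div_assoc, Nat.cast_add,
    Nat.cast_one, Finset.range_eq_Ico] at this ⊢
  rwa [mul_div_cancel₀ _ hN', add_sub_cancel] at this

/-- The length sees only equidistant subdivisions, which may miss the times `t i`. For a fine grid,
`P (t i)` reaches the next grid point within `ε` by right continuity, and the last grid point before
`t (i + 1)` reaches `P (t (i + 1))` within `ε` by left continuity. The grid sums in between belong
to disjoint blocks of one grid. -/
lemma HasLength.varLe (hd : IsPseudoSemimetric d) {P : ℝ → X} {a b : ℝ} {L : ℝ≥0∞} (hab : a < b)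
    (hP : OneSided d P (Set.Icc a b)) (h : HasLength d P a b L) : VarLe d P a b L := by
  intro n t hmono ht
  have hba : 0 < b - a := by linarith
  have main : ∀ ε : ℝ, 0 < ε → ∑ i ∈ Finset.range n, d (P (t i)) (P (t (i + 1))) ≤
      n * ENNReal.ofReal (2 * ε) + L := by
    intro ε hε
    choose η hη hr using fun i => hP.right (t i) (ht i) ε hε
    choose η' hη' hl using fun i => hP.left (t i) (ht i) ε hε
    have ev : ∀ᶠ N : ℕ in Filter.atTop, 1 ≤ N ∧ ∀ i ∈ Finset.range (n + 1),
        (b - a) / N < η i ∧ (b - a) / N < η' i ∧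
          (t i < t (i + 1) → 2 * ((b - a) / N) < t (i + 1) - t i) := by
      have h0 : Filter.Tendsto (fun N : ℕ => (b - a) / N) Filter.atTop (𝓝 0) :=
        tendsto_const_div_atTop_nhds_zero_nat _
      refine (Filter.eventually_ge_atTop 1).and ((Finset.eventually_all _).2 fun i _ => ?_)
      refine (h0.eventually_lt_const (hη i)).and ((h0.eventually_lt_const (hη' i)).and ?_)
      by_cases hi : t i < t (i + 1)
      · filter_upwards [h0.eventually_lt_const (show (0 : ℝ) < (t (i + 1) - t i) / 2 by linarith)]
          with N hN _
        linarith
      · exact Filter.Eventually.of_forall fun N h => absurd h hi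
    refine ge_of_tendsto (h.const_add (n * ENNReal.ofReal (2 * ε))) (ev.mono ?_)
    rintro N ⟨hN1, hN⟩
    have hN0 : (0 : ℝ) < N := by positivity
    set w := (b - a) / N with hw
    have hw0 : 0 < w := div_pos hba hN0
    have hNw : N * w = b - a := by rw [hw]; field_simp
    let g : ℕ → ℝ := fun k => a + k * w
    let S : ℕ → ℝ≥0∞ := fun k => ∑ j ∈ Finset.range k, d (P (g j)) (P (g (j + 1)))
    have hSN : ∑ i ∈ Finset.range N, d (P (a + (i : ℝ) * (b - a) / (N : ℝ)))
        (P (a + ((i : ℝ) + 1) * (b - a) / (N : ℝ))) = S N := by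
      refine Finset.sum_congr rfl fun i _ => ?_
      simp only [g, hw, mul_div_assoc, Nat.cast_add, Nat.cast_one]
    rw [hSN]
    let l : ℕ → ℕ := fun i => ⌊(t i - a) / w⌋₊
    let k : ℕ → ℕ := fun i => ⌈(t i - a) / w⌉₊
    have hq : ∀ i, 0 ≤ (t i - a) / w := fun i => div_nonneg (by linarith [(ht i).1]) hw0.le
    have hgl : ∀ i, g (l i) ≤ t i := fun i => by
      have := Nat.floor_le (hq i)
      rw [le_div_iff₀ hw0] at this
      simp only [g, l]; linarith
    have hgl' : ∀ i, t i - w < g (l i) := fun i => by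
      have := Nat.lt_floor_add_one ((t i - a) / w)
      rw [div_lt_iff₀ hw0] at this
      simp only [g, l]; linarith
    have hgk : ∀ i, t i ≤ g (k i) := fun i => by
      have := Nat.le_ceil ((t i - a) / w)
      rw [div_le_iff₀ hw0] at this
      simp only [g, k]; linarith
    have hgk' : ∀ i, g (k i) < t i + w := fun i => by
      have := Nat.ceil_lt_add_one (hq i)
      rw [← sub_lt_iff_lt_add, lt_div_iff₀ hw0] at this
      simp only [g, k]; linarith
    have hlN : ∀ i, l i ≤ N := fun i => by
      refine Nat.floor_le_of_le ?_
      rw [div_le_iff₀ hw0, hNw]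
      linarith [(ht i).2]
    have hkN : ∀ i, k i ≤ N := fun i => by
      refine Nat.ceil_le.2 ?_
      rw [div_le_iff₀ hw0, hNw]
      linarith [(ht i).2]
    have hgI : ∀ j ≤ N, g j ∈ Set.Icc a b := fun j hj => by
      have h1 : (j : ℝ) * w ≤ N * w := by gcongr
      have h2 : 0 ≤ (j : ℝ) * w := by positivity
      constructor <;> simp only [g] <;> linarith
    have hSmono : Monotone S := fun i j hij =>
      Finset.sum_le_sum_of_subset (Finset.range_mono hij)
    have ind : ∀ m ≤ n, ∑ i ∈ Finset.range m, d (P (t i)) (P (t (i + 1))) ≤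
        m * ENNReal.ofReal (2 * ε) + S (l m) := by
      intro m
      induction m with
      | zero => simp
      | succ m ih =>
        intro hm
        rw [Finset.sum_range_succ]
        refine (add_le_add (ih (by omega)) le_rfl).trans ?_
        obtain ⟨h1, -, h3⟩ := hN m (Finset.mem_range.2 (by omega))
        obtain ⟨-, h2, -⟩ := hN (m + 1) (Finset.mem_range.2 (by omega))
        have hstep : S (l m) + d (P (t m)) (P (t (m + 1))) ≤
            ENNReal.ofReal (2 * ε) + S (l (m + 1)) := by
          rcases (hmono (Nat.le_succ m)).lt_or_eq with hlt | heq
          · have h4 := h3 hlt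
            have hkl : k m ≤ l (m + 1) := by
              have h5 : g (k m) < g (l (m + 1)) := by
                have := hgk' m; have := hgl' (m + 1); simp only [Nat.succ_eq_add_one] at *; linarith
              have h6 : (k m : ℝ) * w < l (m + 1) * w := by simpa [g] using h5
              exact_mod_cast (lt_of_mul_lt_mul_right h6 hw0.le).le
            have hlk : l m ≤ k m := Nat.floor_le_ceil _
            have e1 : d (P (t m)) (P (g (k m))) ≤ ENNReal.ofReal ε :=
              hr m _ (hgI _ (hkN m)) (hgk m) (by linarith [hgk' m])
            have e2 : d (P (g (l (m + 1)))) (P (t (m + 1))) ≤ ENNReal.ofReal ε :=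
              hl (m + 1) _ (hgI _ (hlN _)) (by linarith [hgl' (m + 1)]) (hgl _)
            have e3 := dist_le_sum_Ico hd (fun j => P (g j)) hkl
            have e4 : S (k m) + ∑ i ∈ Finset.Ico (k m) (l (m + 1)), d (P (g i)) (P (g (i + 1))) =
                S (l (m + 1)) := Finset.sum_range_add_sum_Ico _ hkl
            rw [← e4, two_mul, ENNReal.ofReal_add hε.le hε.le]
            calc S (l m) + d (P (t m)) (P (t (m + 1)))
                ≤ S (k m) + (d (P (t m)) (P (g (k m))) + (d (P (g (k m))) (P (g (l (m + 1)))) +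
                    d (P (g (l (m + 1)))) (P (t (m + 1))))) :=
                  add_le_add (hSmono hlk) ((hd.triangle _ _ (P (g (k m)))).trans
                    (add_le_add le_rfl (hd.triangle _ _ _)))
              _ ≤ S (k m) + (ENNReal.ofReal ε + (∑ i ∈ Finset.Ico (k m) (l (m + 1)),
                    d (P (g i)) (P (g (i + 1))) + ENNReal.ofReal ε)) := by gcongr
              _ = _ := by ring
          · have h7 : l m = l (m + 1) := by simp only [l]; rw [← heq]
            rw [← heq, hd.refl, add_zero, h7]
            exact le_add_self
        calc _ = (m : ℝ≥0∞) * ENNReal.ofReal (2 * ε) + (S (l m) + d (P (t m)) (P (t (m + 1)))) := by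
              rw [add_assoc]
          _ ≤ m * ENNReal.ofReal (2 * ε) + (ENNReal.ofReal (2 * ε) + S (l (m + 1))) := by gcongr
          _ = _ := by push_cast; ring
    exact (ind n le_rfl).trans (add_le_add le_rfl (hSmono (hlN n)))
  refine ENNReal.le_of_forall_pos_le_add fun e he _ => ?_
  refine (main ((e : ℝ) / (2 * (n + 1))) (by positivity)).trans ?_
  rw [add_comm]
  gcongr
  have : (n : ℝ≥0∞) = ENNReal.ofReal n := by simp
  rw [this, ← ENNReal.ofReal_mul (by positivity), ← ENNReal.ofReal_coe_nnreal]
  apply ENNReal.ofReal_le_ofReal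
  have he' : (0 : ℝ) < e := he
  rw [show (n : ℝ) * (2 * ((e : ℝ) / (2 * (n + 1)))) = e * (n / (n + 1)) by field_simp]
  exact mul_le_of_le_one_right he'.le ((div_le_one (by positivity)).2 (by linarith))

lemma VarLe.op {P : ℝ → X} {a b : ℝ} {L : ℝ≥0∞} (h : VarLe d P a b L) :
    VarLe (op d) (fun t => P (-t)) (-b) (-a) L := by
  intro n t hmono ht
  have := h n (fun i => - t (n - i)) (fun i j hij => neg_le_neg (hmono (by omega)))
    (fun i => ⟨by linarith [(ht (n - i)).2], by linarith [(ht (n - i)).1]⟩)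
  rw [← Finset.sum_range_reflect] at this
  refine le_trans (le_of_eq (Finset.sum_congr rfl fun i hi => ?_)) this
  have hi := Finset.mem_range.1 hi
  simp only [SemiMet.op]
  rw [show n - (n - 1 - i) = i + 1 by omega, show n - (n - 1 - i + 1) = i by omega]

end Length


/-! ### Unit speed geodesics -/

/-- `γ` is a unit speed geodesic from `x` to `y` of length `ℓ`. -/
structure Seg {X : Type*} (d : X → X → ℝ≥0∞) (γ : ℝ → X) (ℓ : ℝ) (x y : X) : Prop where
  nonneg : 0 ≤ ℓ
  start : γ 0 = x
  finish : γ ℓ = y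
  unit : ∀ s t, 0 ≤ s → s ≤ t → t ≤ ℓ → d (γ s) (γ t) = ENNReal.ofReal (t - s)

/-- A unit speed geodesic between `x` and `y` in one of the two directions. -/
def SegB {X : Type*} (d : X → X → ℝ≥0∞) (γ : ℝ → X) (ℓ : ℝ) (x y : X) : Prop :=
  Seg d γ ℓ x y ∨ Seg d γ ℓ y x

section Seg

variable {X : Type*} {d : X → X → ℝ≥0∞} {γ : ℝ → X} {ℓ : ℝ} {x y : X}

lemma Seg.wi (h : Seg d γ ℓ x y) {s t : ℝ} (hs : 0 ≤ s) (hst : s ≤ t) (ht : t ≤ ℓ) :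
    Wi d (t - s) (γ s) (γ t) := (h.unit s t hs hst ht).le

lemma Seg.wi_left (h : Seg d γ ℓ x y) {t : ℝ} (h0 : 0 ≤ t) (ht : t ≤ ℓ) : Wi d t x (γ t) := by
  simpa [h.start] using h.wi le_rfl h0 ht

lemma Seg.wi_right (h : Seg d γ ℓ x y) {t : ℝ} (h0 : 0 ≤ t) (ht : t ≤ ℓ) :
    Wi d (ℓ - t) (γ t) y := by
  simpa [h.finish] using h.wi h0 ht le_rfl

lemma Seg.le_of_wi (h : Seg d γ ℓ x y) {s t r : ℝ} (hs : 0 ≤ s) (hst : s ≤ t) (ht : t ≤ ℓ)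
    (hr : 0 ≤ r) (hw : Wi d r (γ s) (γ t)) : t - s ≤ r := by
  unfold Wi at hw
  rw [h.unit s t hs hst ht] at hw
  exact (ENNReal.ofReal_le_ofReal_iff hr).1 hw

lemma Seg.le_of_wi_left (h : Seg d γ ℓ x y) {t r : ℝ} (h0 : 0 ≤ t) (ht : t ≤ ℓ) (hr : 0 ≤ r)
    (hw : Wi d r x (γ t)) : t ≤ r := by
  have := h.le_of_wi le_rfl h0 ht hr (by rwa [h.start])
  linarith

lemma Seg.le_of_wi_right (h : Seg d γ ℓ x y) {t r : ℝ} (h0 : 0 ≤ t) (ht : t ≤ ℓ) (hr : 0 ≤ r)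
    (hw : Wi d r (γ t) y) : ℓ - t ≤ r :=
  h.le_of_wi h0 ht le_rfl hr (by rwa [h.finish])

lemma Seg.length_le (h : Seg d γ ℓ x y) {r : ℝ} (hr : 0 ≤ r) (hw : Wi d r x y) : ℓ ≤ r :=
  h.le_of_wi_left h.nonneg le_rfl hr (by rwa [h.finish])

lemma Seg.sub (h : Seg d γ ℓ x y) {u v : ℝ} (hu : 0 ≤ u) (huv : u ≤ v) (hv : v ≤ ℓ) :
    Seg d (fun w => γ (u + w)) (v - u) (γ u) (γ v) :=
  ⟨by linarith, by simp, by simp, fun s t hs hst ht => by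
    rw [h.unit _ _ (by linarith) (by linarith) (by linarith)]; congr 1; ring⟩

lemma Seg.init (h : Seg d γ ℓ x y) {v : ℝ} (h0 : 0 ≤ v) (hv : v ≤ ℓ) : Seg d γ v x (γ v) :=
  ⟨h0, h.start, rfl, fun s t hs hst ht => h.unit s t hs hst (ht.trans hv)⟩

lemma Seg.tail (h : Seg d γ ℓ x y) {u : ℝ} (h0 : 0 ≤ u) (hu : u ≤ ℓ) :
    Seg d (fun w => γ (u + w)) (ℓ - u) (γ u) y := by
  simpa [h.finish] using h.sub h0 hu le_rfl

lemma Seg.op (h : Seg d γ ℓ x y) : Seg (op d) (fun t => γ (ℓ - t)) ℓ y x :=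
  ⟨h.nonneg, by simp [h.finish], by simp [h.start], fun s t hs hst ht => by
    simp only [SemiMet.op]
    rw [h.unit _ _ (by linarith) (by linarith) (by linarith)]; congr 1; ring⟩

lemma SegB.op (h : SegB d γ ℓ x y) : SegB (op d) (fun t => γ (ℓ - t)) ℓ y x := h.imp Seg.op Seg.op

lemma SegB.symm (h : SegB d γ ℓ x y) : SegB d γ ℓ y x := Or.symm h

lemma Seg.const (hd : IsPseudoSemimetric d) (x : X) : Seg d (fun _ => x) 0 x x :=
  ⟨le_rfl, rfl, rfl, fun s t hs hst ht => by
    rw [hd.refl, show t - s = 0 by linarith, ENNReal.ofReal_zero]⟩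

lemma Seg.dist_eq (h : Seg d γ ℓ x y) : d x y = ENNReal.ofReal ℓ := by
  have := h.unit 0 ℓ le_rfl h.nonneg le_rfl
  rwa [h.start, h.finish, sub_zero] at this

lemma Seg.ne_top (h : Seg d γ ℓ x y) : d x y ≠ ⊤ := by simp [h.dist_eq]

/-- Arc length `d(x, P t)` is additive because no subdivision sum exceeds `d(x,y)`, and it is
continuous, so it takes all values up to `d(x,y)`; a section of it is the unit speed
parametrization. Points with equal arc length have distance `0`, hence coincide in a semimetric
space, and the image is unchanged. -/
lemma IsGeodesic.exists_seg (hd : IsSemimetric d) {P : ℝ → X} {a b : ℝ}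
    (h : IsGeodesic d P a b x y) :
    ∃ γ ℓ, Seg d γ ℓ x y ∧ γ '' Set.Icc 0 ℓ = P '' Set.Icc a b := by
  obtain ⟨⟨hab, hbi⟩, hx, hy, hlen⟩ := h
  have hm := hd.toIsPseudoSemimetric
  have hP := hbi.oneSided hm
  have hfin : d x y ≠ ⊤ := by simpa [hx, hy] using hP.ne_top hm hab.le
  have hvar := hlen.varLe hm hab hP
  -- The subdivision `a ≤ t ≤ t' ≤ b`, continued constantly.
  have h3 : ∀ t t', a ≤ t → t ≤ t' → t' ≤ b →
      d x (P t) + d (P t) (P t') + d (P t') y ≤ d x y := by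
    intro t t' h1 h2 h3
    have := hvar 3 (fun i => match i with | 0 => a | 1 => t | 2 => t' | _ => b)
      (monotone_nat_of_le_succ fun n => by
        match n with
        | 0 => exact h1
        | 1 => exact h2
        | 2 => exact h3
        | n + 3 => exact le_rfl)
      (fun i => by
        match i with
        | 0 => exact ⟨le_rfl, hab.le⟩
        | 1 => exact ⟨h1, h2.trans h3⟩
        | 2 => exact ⟨h1.trans h2, h3⟩
        | n + 3 => exact ⟨hab.le, le_rfl⟩)
    simpa [Finset.sum_range_succ, hx, hy] using this
  have hfr : ∀ t, a ≤ t → t ≤ b → d (P t) y ≠ ⊤ := fun t h1 h2 =>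
    (lt_of_le_of_lt (le_add_self.trans (h3 t t h1 le_rfl h2)) hfin.lt_top).ne
  have hfl : ∀ t, a ≤ t → t ≤ b → d x (P t) ≠ ⊤ := fun t h1 h2 =>
    (lt_of_le_of_lt ((le_self_add.trans le_self_add).trans (h3 t t h1 le_rfl h2)) hfin.lt_top).ne
  have hadd : ∀ t t', a ≤ t → t ≤ t' → t' ≤ b → d x (P t') = d x (P t) + d (P t) (P t') := by
    intro t t' h1 h2 h4
    refine le_antisymm (hm.triangle _ _ _) ?_
    have := (h3 t t' h1 h2 h4).trans (hm.triangle x y (P t'))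
    exact (ENNReal.add_le_add_iff_right (hfr t' (h1.trans h2) h4)).1 this
  have hfm : ∀ t t', a ≤ t → t ≤ t' → t' ≤ b → d (P t) (P t') ≠ ⊤ := fun t t' h1 h2 h4 =>
    (lt_of_le_of_lt (le_add_self.trans (hadd t t' h1 h2 h4).ge)
      (hfl t' (h1.trans h2) h4).lt_top).ne
  let lam : ℝ → ℝ := fun t => (d x (P t)).toReal
  have hlam : ∀ t t', a ≤ t → t ≤ t' → t' ≤ b → lam t' = lam t + (d (P t) (P t')).toReal := by
    intro t t' h1 h2 h4
    simp only [lam]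
    rw [hadd t t' h1 h2 h4, ENNReal.toReal_add (hfl t h1 (h2.trans h4)) (hfm t t' h1 h2 h4)]
  have hdist : ∀ t t', a ≤ t → t ≤ t' → t' ≤ b →
      d (P t) (P t') = ENNReal.ofReal (lam t' - lam t) := by
    intro t t' h1 h2 h4
    rw [hlam t t' h1 h2 h4, add_sub_cancel_left, ENNReal.ofReal_toReal (hfm t t' h1 h2 h4)]
  have hmono : ∀ t t', a ≤ t → t ≤ t' → t' ≤ b → lam t ≤ lam t' := by
    intro t t' h1 h2 h4
    rw [hlam t t' h1 h2 h4]
    linarith [ENNReal.toReal_nonneg (a := d (P t) (P t'))]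
  have heq : ∀ t ∈ Set.Icc a b, ∀ t' ∈ Set.Icc a b, lam t = lam t' → P t = P t' := by
    intro t ht t' ht' h
    rcases le_total t t' with h1 | h1
    · exact (hd.eq_zero_iff _ _).1 (by rw [hdist t t' ht.1 h1 ht'.2, h]; simp)
    · exact ((hd.eq_zero_iff _ _).1 (by rw [hdist t' t ht'.1 h1 ht.2, h]; simp)).symm
  have hcont : ContinuousOn lam (Set.Icc a b) := by
    refine Metric.continuousOn_iff.2 fun t ht ε hε => ?_
    obtain ⟨η, hη, h1⟩ := hP.right t ht (ε / 2) (by linarith)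
    obtain ⟨η', hη', h2⟩ := hP.left t ht (ε / 2) (by linarith)
    refine ⟨min η η', lt_min hη hη', fun t' ht' h4 => ?_⟩
    rw [Real.dist_eq] at h4 ⊢
    have h5 := (abs_lt.1 h4)
    have h6 := min_le_left η η'
    have h7 := min_le_right η η'
    rcases le_total t t' with h | h
    · have h8 := h1 t' ht' h (by linarith)
      unfold Wi at h8
      rw [hdist t t' ht.1 h ht'.2, ENNReal.ofReal_le_ofReal_iff (by linarith)] at h8
      rw [abs_of_nonneg (by linarith [hmono t t' ht.1 h ht'.2])]
      linarith
    · have h8 := h2 t' ht' (by linarith) h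
      unfold Wi at h8
      rw [hdist t' t ht'.1 h ht.2, ENNReal.ofReal_le_ofReal_iff (by linarith)] at h8
      rw [abs_of_nonpos (by linarith [hmono t' t ht'.1 h ht.2])]
      linarith
  have hl0 : lam a = 0 := by simp [lam, hx, hm.refl]
  have hiv := intermediate_value_Icc hab.le hcont
  rw [hl0] at hiv
  have hiv' : ∀ u ∈ Set.Icc 0 (lam b), ∃ t, t ∈ Set.Icc a b ∧ lam t = u := fun u hu => hiv hu
  choose! τ hτ hτ' using hiv'
  have hlb : 0 ≤ lam b := ENNReal.toReal_nonneg
  have ha : a ∈ Set.Icc a b := ⟨le_rfl, hab.le⟩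
  have hb : b ∈ Set.Icc a b := ⟨hab.le, le_rfl⟩
  refine ⟨fun u => P (τ u), lam b, ⟨hlb, ?_, ?_, ?_⟩, ?_⟩
  · rw [← hx]
    exact heq _ (hτ 0 ⟨le_rfl, hlb⟩) _ ha ((hτ' 0 ⟨le_rfl, hlb⟩).trans hl0.symm)
  · rw [← hy]
    exact heq _ (hτ _ ⟨hlb, le_rfl⟩) _ hb (hτ' _ ⟨hlb, le_rfl⟩)
  · intro s t hs hst ht
    have h1 : s ∈ Set.Icc 0 (lam b) := ⟨hs, hst.trans ht⟩
    have h2 : t ∈ Set.Icc 0 (lam b) := ⟨hs.trans hst, ht⟩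
    rcases le_total (τ s) (τ t) with h | h
    · rw [hdist _ _ (hτ s h1).1 h (hτ t h2).2, hτ' s h1, hτ' t h2]
    · have h5 := hmono _ _ (hτ t h2).1 h (hτ s h1).2
      rw [hτ' s h1, hτ' t h2] at h5
      obtain rfl : s = t := le_antisymm hst h5
      simp [hm.refl]
  · ext p
    constructor
    · rintro ⟨u, hu, rfl⟩
      exact ⟨τ u, hτ u hu, rfl⟩
    · rintro ⟨t, ht, rfl⟩
      have h1 : lam t ∈ Set.Icc 0 (lam b) := ⟨ENNReal.toReal_nonneg, hmono t b ht.1 ht.2 le_rfl⟩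
      exact ⟨lam t, h1, heq _ (hτ _ h1) _ ht (hτ' _ h1)⟩

/-- Needed to apply the hyperbolicity hypothesis. The rescaling to `[0,1]` covers `ℓ = 0`, since the
interval of a directed path must be nondegenerate. -/
lemma Seg.isGeodesic (hd : IsPseudoSemimetric d) (h : Seg d γ ℓ x y) :
    IsGeodesic d (fun t => γ (ℓ * t)) 0 1 x y ∧
      (fun t => γ (ℓ * t)) '' Set.Icc 0 1 = γ '' Set.Icc 0 ℓ := by
  have hl := h.nonneg
  have hm : ∀ t ∈ Set.Icc (0 : ℝ) 1, 0 ≤ ℓ * t ∧ ℓ * t ≤ ℓ := fun t ht =>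
    ⟨mul_nonneg hl ht.1, mul_le_of_le_one_right hl ht.2⟩
  have hη : ∀ ε : ℝ, 0 < ε → ∀ s t : ℝ, s < t + ε / (ℓ + 1) → t ≤ s → ℓ * s - ℓ * t ≤ ε := by
    intro ε hε s t h1 h2
    have h3 : s - t ≤ ε / (ℓ + 1) := by linarith
    rw [le_div_iff₀ (by linarith)] at h3
    nlinarith
  refine ⟨⟨⟨one_pos, OneSided.biContOn hd ⟨?_, ?_⟩⟩, by simp [h.start], by simp [h.finish], ?_⟩, ?_⟩
  · intro t ht ε hε
    refine ⟨ε / (ℓ + 1), by positivity, fun t' ht' h1 h2 => ?_⟩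
    exact (h.wi (hm t ht).1 (mul_le_mul_of_nonneg_left h1 hl) (hm t' ht').2).mono
      (hη ε hε _ _ h2 h1)
  · intro t ht ε hε
    refine ⟨ε / (ℓ + 1), by positivity, fun t' ht' h1 h2 => ?_⟩
    exact (h.wi (hm t' ht').1 (mul_le_mul_of_nonneg_left h2 hl) (hm t ht).2).mono
      (hη ε hε _ _ (by linarith) h2)
  · rw [h.dist_eq]
    refine tendsto_const_nhds.congr' (Filter.eventually_atTop.2 ⟨1, fun N hN => ?_⟩)
    have hN : (0 : ℝ) < N := by positivity
    have : ∀ i ∈ Finset.range N, d (γ (ℓ * (0 + (i : ℝ) * (1 - 0) / (N : ℝ))))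
        (γ (ℓ * (0 + ((i : ℝ) + 1) * (1 - 0) / (N : ℝ)))) = ENNReal.ofReal (ℓ / N) := by
      intro i hi
      have hi' : (i : ℝ) + 1 ≤ N := by exact_mod_cast Finset.mem_range.1 hi
      rw [h.unit _ _ (by positivity)]
      · congr 1; field_simp; ring
      · gcongr; linarith
      · refine mul_le_of_le_one_right hl ?_
        rw [zero_add, sub_zero, mul_one]
        exact (div_le_one hN).2 hi'
    refine Eq.trans ?_ (Finset.sum_congr rfl this).symm
    rw [Finset.sum_const, Finset.card_range, nsmul_eq_mul,
      ← ENNReal.ofReal_natCast, ← ENNReal.ofReal_mul hN.le]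
    congr 1; field_simp
  · ext p
    constructor
    · rintro ⟨t, ht, rfl⟩
      exact ⟨ℓ * t, hm t ht, rfl⟩
    · rintro ⟨u, hu, rfl⟩
      rcases hl.eq_or_lt with h0 | h0
      · exact ⟨0, by simp, by simp [show u = 0 by linarith [hu.1, hu.2]]⟩
      · exact ⟨u / ℓ, ⟨div_nonneg hu.1 hl, (div_le_one h0).2 hu.2⟩, by
          simp only; congr 1; field_simp⟩

end Seg

/-! ### Hyperbolic spaces in terms of unit speed geodesics -/

/-- A `δ`-hyperbolic geodesic semimetric space with (B1) and (B2) for `f`, in terms of unit speed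
geodesics. -/
structure HypSpace {X : Type*} (d : X → X → ℝ≥0∞) (δ : ℝ) (f : ℝ → ℝ) : Prop where
  nonneg : 0 ≤ δ
  f_nonneg : ∀ (_ : X) (r : ℝ), 0 ≤ r → 0 ≤ f r
  met : IsPseudoSemimetric d
  geod : ∀ x y, d x y ≠ ⊤ → ∃ γ ℓ, Seg d γ ℓ x y
  thin : ∀ (x y z : X) (γ₁ γ₂ γ₃ : ℝ → X) (ℓ₁ ℓ₂ ℓ₃ : ℝ), Seg d γ₁ ℓ₁ x y → SegB d γ₂ ℓ₂ x z →
    SegB d γ₃ ℓ₃ y z → ∀ u, 0 ≤ u → u ≤ ℓ₁ →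
      (∃ v, 0 ≤ v ∧ v ≤ ℓ₂ ∧ Wi d δ (γ₂ v) (γ₁ u)) ∨ ∃ v, 0 ≤ v ∧ v ≤ ℓ₃ ∧ Wi d δ (γ₁ u) (γ₃ v)
  b1 : ∀ (x y z : X) (r : ℝ), 0 ≤ r → Wi d r x y → Wi d r x z → d y z ≠ ⊤ → Wi d (f r) y z
  b2 : ∀ (x y z : X) (r : ℝ), 0 ≤ r → Wi d r y x → Wi d r z x → d y z ≠ ⊤ → Wi d (f r) y z

section HypSpace

variable {X : Type*} {d : X → X → ℝ≥0∞} {δ : ℝ} {f : ℝ → ℝ}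

lemma HypSpace.of_isHyperbolic (hd : IsSemimetric d) (hgeod : IsGeodesicSpace d) (hδ : 0 ≤ δ)
    (hhyp : IsHyperbolic d δ) (hB1 : BoundedOut d f) (hB2 : BoundedIn d f) : HypSpace d δ f where
  nonneg := hδ
  f_nonneg x r hr := by
    have h : x ∈ outBall d r x := by
      change d x x ≤ _
      rw [hd.refl]; exact zero_le
    rcases hB1 x r hr x h x h with h' | h'
    · simp [hd.refl] at h'
    · simpa [hd.refl] using h'
  met := hd.toIsPseudoSemimetric
  geod x y h := by
    obtain ⟨P, a, b, hP⟩ := hgeod x y h.lt_top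
    obtain ⟨γ, ℓ, h, -⟩ := hP.exists_seg hd
    exact ⟨γ, ℓ, h⟩
  thin x y z γ₁ γ₂ γ₃ ℓ₁ ℓ₂ ℓ₃ h1 h2 h3 u hu hu' := by
    have hm := hd.toIsPseudoSemimetric
    have hB : ∀ {γ : ℝ → X} {ℓ : ℝ} {x y : X}, SegB d γ ℓ x y →
        IsGeodesicBetween d (fun t => γ (ℓ * t)) 0 1 x y ∧
        (fun t => γ (ℓ * t)) '' Set.Icc 0 1 = γ '' Set.Icc 0 ℓ := by
      rintro γ ℓ x y (h | h)
      · exact ⟨Or.inl (h.isGeodesic hm).1, (h.isGeodesic hm).2⟩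
      · exact ⟨Or.inr (h.isGeodesic hm).1, (h.isGeodesic hm).2⟩
    have := hhyp x y z _ _ _ _ _ _ _ _ _ (h1.isGeodesic hm).1 (hB h2).1 (hB h3).1
    rw [(h1.isGeodesic hm).2, (hB h2).2, (hB h3).2] at this
    rcases this ⟨u, ⟨hu, hu'⟩, rfl⟩ with h | h
    · simp only [outBallSet, Set.mem_iUnion] at h
      obtain ⟨_, ⟨v, hv, rfl⟩, h⟩ := h
      exact Or.inl ⟨v, hv.1, hv.2, h⟩
    · simp only [inBallSet, Set.mem_iUnion] at h
      obtain ⟨_, ⟨v, hv, rfl⟩, h⟩ := h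
      exact Or.inr ⟨v, hv.1, hv.2, h⟩
  b1 x y z r hr hy hz h := by
    have := (hB1 x r hr y hy z hz).resolve_left h
    exact (wi_of_ne_top h).mono this
  b2 x y z r hr hy hz h := by
    have := (hB2 x r hr y hy z hz).resolve_left h
    exact (wi_of_ne_top h).mono this

/-- Reversal exchanges the out-ball around one side with the in-ball around the other, and (B1) with
(B2). Every result about starting points thereby yields one about end points. -/
lemma HypSpace.op (H : HypSpace d δ f) : HypSpace (op d) δ f where
  nonneg := H.nonneg
  f_nonneg := H.f_nonneg
  met := H.met.op
  geod x y h := by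
    obtain ⟨γ, ℓ, hγ⟩ := H.geod y x h
    exact ⟨_, _, hγ.op⟩
  thin x y z γ₁ γ₂ γ₃ ℓ₁ ℓ₂ ℓ₃ h1 h2 h3 u hu hu' := by
    have := H.thin y x z _ _ _ ℓ₁ ℓ₃ ℓ₂ h1.op h3.op.symm h2.op.symm (ℓ₁ - u) (by linarith)
      (by linarith)
    rw [sub_sub_cancel] at this
    rcases this with ⟨v, h0, hv, h⟩ | ⟨v, h0, hv, h⟩
    · exact Or.inr ⟨ℓ₃ - v, by linarith, by linarith, h⟩
    · exact Or.inl ⟨ℓ₂ - v, by linarith, by linarith, h⟩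
  b1 x y z r hr hy hz h := H.b2 x z y r hr hz hy h
  b2 x y z r hr hy hz h := H.b1 x z y r hr hz hy h

end HypSpace

/-! ### Consequences of thin triangles -/

section Hyperbolic

variable {X : Type*} {d : X → X → ℝ≥0∞} {δ : ℝ} {f : ℝ → ℝ}

/-- If two geodesics have the same start and the second one comes close to the first one late, then
the earlier points of the first one can reach the second one quickly. -/
lemma HypSpace.parallel_start (H : HypSpace d δ f) {γ γ' : ℝ → X} {ℓ ℓ' : ℝ} {x y y' : X}
    (h : Seg d γ ℓ x y) (h' : Seg d γ' ℓ' x y') {u u₁ v₁ τ : ℝ} (hu : 0 ≤ u)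
    (hu₁ : u + 3 * δ < u₁) (hl : u₁ ≤ ℓ) (hv : 0 ≤ v₁) (hv' : v₁ ≤ ℓ')
    (hw : Wi d δ (γ' v₁) (γ u₁)) (hτ : 0 < τ) :
    ∃ v, 0 ≤ v ∧ v ≤ ℓ' ∧ Wi d (4 * δ + τ) (γ u) (γ' v) := by
  have hδ := H.nonneg
  obtain ⟨e, le, hE⟩ := H.geod _ _ hw.ne_top
  have hle := hE.length_le hδ hw
  have h1 : u₁ ≤ v₁ + δ := h.le_of_wi_left (by linarith) hl (by linarith)
    ((h'.wi_left hv hv').trans H.met hv hδ hw)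
  have hvu : 0 ≤ u + δ := by linarith
  -- If `γ' (u + δ)` were close to the short side `e`, then `γ u₁` could be reached from `x` within
  -- `u + 3δ < u₁`.
  rcases H.thin _ _ _ _ _ _ _ _ _ (h'.init hv hv') (Or.inl (h.init (by linarith) hl)) (Or.inl hE)
    (u + δ) hvu (by linarith) with ⟨p, hp, hp', hpw⟩ | ⟨w, hw0, hwl, hw'⟩
  · have hup : u + δ ≤ p + δ := h'.le_of_wi_left hvu (by linarith) (by linarith)
      ((h.wi_left hp (by linarith)).trans H.met hp hδ hpw)
    by_cases hc : p ≤ u + 2 * δ + τ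
    · exact ⟨u + δ, hvu, by linarith, ((h.wi hu (by linarith) (by linarith)).trans H.met
        (by linarith) hδ hpw).mono (by linarith)⟩
    · push Not at hc
      obtain ⟨e₂, le₂, hE₂⟩ := H.geod _ _ hpw.ne_top
      have hle₂ := hE₂.length_le hδ hpw
      -- The point at time `u + 2δ + τ` is too far from `x` to be `δ`-reached from `γ'` up to time
      -- `u + δ`. So it reaches the short side `e₂`, which ends at `γ' (u + δ)`.
      rcases H.thin _ _ _ _ _ _ _ _ _ (h.init hp (by linarith))
        (Or.inl (h'.init hvu (by linarith))) (Or.inl hE₂) (u + 2 * δ + τ) (by linarith)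
        (by linarith) with ⟨w, hw0, hwl, hw'⟩ | ⟨w, hw0, hwl, hw'⟩
      · have := h.le_of_wi_left (by linarith) (by linarith) (by linarith)
          ((h'.wi_left hw0 (by linarith)).trans H.met hw0 hδ hw')
        linarith
      · refine ⟨u + δ, hvu, by linarith, ?_⟩
        have h2 := h.wi hu (show u ≤ u + 2 * δ + τ by linarith) (by linarith)
        exact ((h2.trans H.met (by linarith) hδ hw').trans H.met (by linarith) (by linarith)
          (hE₂.wi_right hw0 hwl)).mono (by linarith)
  · have := h.le_of_wi_left (by linarith) hl (by linarith)
      (((h'.wi_left hvu (by linarith)).trans H.met hvu hδ hw').trans H.met (by linarith)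
        (by linarith) (hE.wi_right hw0 hwl))
    linarith

lemma HypSpace.parallel_end (H : HypSpace d δ f) {γ γ' : ℝ → X} {ℓ ℓ' : ℝ} {x x' y : X}
    (h : Seg d γ ℓ x y) (h' : Seg d γ' ℓ' x' y) {u u₁ v₁ τ : ℝ} (hu : u ≤ ℓ)
    (hu₁ : u₁ < u - 3 * δ) (hl : 0 ≤ u₁) (hv : 0 ≤ v₁) (hv' : v₁ ≤ ℓ')
    (hw : Wi d δ (γ u₁) (γ' v₁)) (hτ : 0 < τ) :
    ∃ v, 0 ≤ v ∧ v ≤ ℓ' ∧ Wi d (4 * δ + τ) (γ' v) (γ u) := by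
  obtain ⟨v, h0, h1, h2⟩ := H.op.parallel_start h.op h'.op (u := ℓ - u) (u₁ := ℓ - u₁)
    (v₁ := ℓ' - v₁) (by linarith) (by linarith) (by linarith) (by linarith) (by linarith)
    (by simpa [Wi, SemiMet.op] using hw) hτ
  refine ⟨ℓ' - v, by linarith, by linarith, ?_⟩
  simpa [Wi, SemiMet.op] using h2

/-- Thinness gives a distance from `γ` to the second side, as wanted, but from the first side to
`γ`. Applied `3δ + τ` further along `γ`, it leaves the room in which `parallel_start` reverses the
latter; near the end of `γ` the vertex `z` itself serves. -/
lemma HypSpace.triangle_out (H : HypSpace d δ f) {γ γ₁ γ₂ : ℝ → X} {ℓ ℓ₁ ℓ₂ : ℝ} {x y z : X}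
    (h : Seg d γ ℓ x z) (h₁ : Seg d γ₁ ℓ₁ x y) (h₂ : Seg d γ₂ ℓ₂ y z) {u τ : ℝ} (hu : 0 ≤ u)
    (hu' : u ≤ ℓ) (hτ : 0 < τ) :
    (∃ v, 0 ≤ v ∧ v ≤ ℓ₁ ∧ Wi d (4 * δ + τ) (γ u) (γ₁ v)) ∨
      ∃ v, 0 ≤ v ∧ v ≤ ℓ₂ ∧ Wi d (4 * δ + τ) (γ u) (γ₂ v) := by
  have hδ := H.nonneg
  by_cases hc : ℓ < u + 3 * δ + τ
  · right
    refine ⟨ℓ₂, h₂.nonneg, le_rfl, ?_⟩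
    rw [h₂.finish]
    exact (h.wi_right hu hu').mono (by linarith)
  · push Not at hc
    rcases H.thin _ _ _ _ _ _ _ _ _ h (Or.inl h₁) (Or.inr h₂) (u + 3 * δ + τ) (by linarith) hc with
      ⟨v, h0, h1, h2⟩ | ⟨v, h0, h1, h2⟩
    · exact Or.inl (H.parallel_start h h₁ hu (by linarith) hc h0 h1 h2 hτ)
    · exact Or.inr ⟨v, h0, h1, ((h.wi hu (by linarith) hc).trans H.met (by linarith) hδ h2).mono
        (by linarith)⟩

lemma HypSpace.triangle_in (H : HypSpace d δ f) {γ γ₁ γ₂ : ℝ → X} {ℓ ℓ₁ ℓ₂ : ℝ} {x y z : X}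
    (h : Seg d γ ℓ x z) (h₁ : Seg d γ₁ ℓ₁ x y) (h₂ : Seg d γ₂ ℓ₂ y z) {u τ : ℝ} (hu : 0 ≤ u)
    (hu' : u ≤ ℓ) (hτ : 0 < τ) :
    (∃ v, 0 ≤ v ∧ v ≤ ℓ₁ ∧ Wi d (4 * δ + τ) (γ₁ v) (γ u)) ∨
      ∃ v, 0 ≤ v ∧ v ≤ ℓ₂ ∧ Wi d (4 * δ + τ) (γ₂ v) (γ u) := by
  rcases H.op.triangle_out h.op h₂.op h₁.op (u := ℓ - u) (by linarith) (by linarith) hτ with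
    ⟨v, h0, h1, h2⟩ | ⟨v, h0, h1, h2⟩
  · exact Or.inr ⟨ℓ₂ - v, by linarith, by linarith, by simpa [Wi, SemiMet.op] using h2⟩
  · exact Or.inl ⟨ℓ₁ - v, by linarith, by linarith, by simpa [Wi, SemiMet.op] using h2⟩

lemma HypSpace.triangle_near (H : HypSpace d δ f) {γ γ₁ γ₂ : ℝ → X} {ℓ ℓ₁ ℓ₂ : ℝ} {x y z : X}
    (h : Seg d γ ℓ x z) (h₁ : Seg d γ₁ ℓ₁ x y) (h₂ : Seg d γ₂ ℓ₂ y z) {u τ m : ℝ} {s : X}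
    (hu : 0 ≤ u) (hu' : u ≤ ℓ) (hτ : 0 < τ) (hm : 0 ≤ m) (hs : Near d m s (γ u)) :
    (∃ v, 0 ≤ v ∧ v ≤ ℓ₁ ∧ Near d (m + 4 * δ + τ) s (γ₁ v)) ∨
      ∃ v, 0 ≤ v ∧ v ≤ ℓ₂ ∧ Near d (m + 4 * δ + τ) s (γ₂ v) := by
  have hδ := H.nonneg
  rcases hs with hs | hs
  · refine (H.triangle_out h h₁ h₂ hu hu' hτ).imp ?_ ?_ <;>
    · rintro ⟨v, h0, h1, h2⟩
      exact ⟨v, h0, h1, Or.inl ((hs.trans H.met hm (by linarith) h2).mono (by linarith))⟩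
  · refine (H.triangle_in h h₁ h₂ hu hu' hτ).imp ?_ ?_ <;>
    · rintro ⟨v, h0, h1, h2⟩
      exact ⟨v, h0, h1, Or.inr ((h2.trans H.met (by linarith) hm hs).mono (by linarith))⟩

/-- The distance from `A` to `B` is bounded linearly in `d(A,C)` and `d(B,C)`, if it is finite. -/
lemma HypSpace.reverse_end (H : HypSpace d δ f) {A B C : X} {a e : ℝ} (ha : 0 ≤ a) (he : 0 ≤ e)
    (hAB : d A B ≠ ⊤) (hAC : Wi d a A C) (hBC : Wi d e B C) :
    Wi d (a + δ + (e + 2) * (f (δ + 1) + 1)) A B := by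
  have hδ := H.nonneg
  have hF := H.f_nonneg A (δ + 1) (by linarith)
  obtain ⟨η, ℓ, hη⟩ := H.geod _ _ hAB
  obtain ⟨ζ, lz, hζ⟩ := H.geod _ _ hAC.ne_top
  obtain ⟨ε, le, hε⟩ := H.geod _ _ hBC.ne_top
  have hlz := hζ.length_le ha hAC
  have hle := hε.length_le he hBC
  set F := f (δ + 1) with hFdef
  suffices hs : ℓ ≤ a + δ + (e + 2) * (F + 1) by
    have := hη.wi le_rfl hη.nonneg le_rfl
    rw [hη.start, hη.finish] at this
    exact this.mono (by linarith)
  by_contra hlt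
  push Not at hlt
  -- Pigeonhole: `m + 1` points of `η` beyond `a + δ`, spaced by `F + 1`, are too late to be
  -- `δ`-reached from `ζ`. So each `δ`-reaches `ε`, whose length is at most `e` and which is covered
  -- by `m` unit intervals.
  set m := ⌊e⌋₊ + 1 with hm
  have hme : (m : ℝ) ≤ e + 1 := by
    rw [hm]; push_cast; linarith [Nat.floor_le he]
  let p : ℕ → ℝ := fun i => a + δ + (i + 1) * (F + 1)
  have hp0 : ∀ i, a + δ < p i := fun i => by
    have : 0 < ((i : ℝ) + 1) * (F + 1) := by positivity
    simp only [p]; linarith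
  have hpl : ∀ i ∈ Finset.range (m + 1), p i ≤ ℓ := fun i hi => by
    have h1 : (i : ℝ) ≤ m := by exact_mod_cast Nat.lt_succ_iff.1 (Finset.mem_range.1 hi)
    have : ((i : ℝ) + 1) * (F + 1) ≤ (e + 2) * (F + 1) :=
      mul_le_mul_of_nonneg_right (by linarith) (by linarith)
    simp only [p]; linarith
  have hex : ∀ i ∈ Finset.range (m + 1), ∃ w, 0 ≤ w ∧ w ≤ le ∧ Wi d δ (η (p i)) (ε w) := by
    intro i hi
    rcases H.thin _ _ _ _ _ _ _ _ _ hη (Or.inl hζ) (Or.inl hε) (p i) (by linarith [hp0 i])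
      (hpl i hi) with ⟨v, h0, h1, h2⟩ | h
    · have := hη.le_of_wi_left (by linarith [hp0 i]) (hpl i hi) (by linarith)
        ((hζ.wi_left h0 h1).trans H.met h0 hδ h2)
      linarith [hp0 i]
    · exact h
  choose! w hw0 hwl hw using hex
  obtain ⟨i, hi, j, hj, hij, hfl⟩ := Finset.exists_ne_map_eq_of_card_lt_of_maps_to
    (s := Finset.range (m + 1)) (t := Finset.range m) (by simp) (f := fun i => ⌊w i⌋₊) (by
      intro i hi
      simp only [Finset.coe_range, Set.mem_Iio, hm]
      exact Nat.lt_succ_iff.2 (Nat.floor_le_floor ((hwl i hi).trans hle)))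
  wlog hlt' : i < j generalizing i j
  · exact this j hj i hi hij.symm hfl.symm (by omega)
  have hpij : p i + (F + 1) ≤ p j := by
    have h1 : (i : ℝ) + 1 ≤ j := by exact_mod_cast hlt'
    have : ((i : ℝ) + 1 + 1) * (F + 1) ≤ (j + 1) * (F + 1) := by gcongr
    simp only [p]; linarith
  have e1 := Nat.floor_le (hw0 i hi)
  have e2 := Nat.lt_floor_add_one (w i)
  have e3 := Nat.floor_le (hw0 j hj)
  have e4 := Nat.lt_floor_add_one (w j)
  rw [hfl] at e1 e2
  -- Both points reach the later one of their two targets on `ε` within `δ + 1`, so (B2) bounds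
  -- their distance by `F`, less than their spacing.
  have hW : ∀ k ∈ Finset.range (m + 1), w k ≤ max (w i) (w j) → max (w i) (w j) ≤ w k + 1 →
      Wi d (δ + 1) (η (p k)) (ε (max (w i) (w j))) := by
    intro k hk h1 h2
    exact ((hw k hk).trans H.met hδ (by linarith)
      (hε.wi (hw0 k hk) h1 (max_le (hwl i hi) (hwl j hj)))).mono (by linarith)
  have hwi := hη.wi (by linarith [hp0 i]) (show p i ≤ p j by linarith) (hpl j hj)
  have hfin := H.b2 _ _ _ (δ + 1) (by linarith)
    (hW i hi (le_max_left _ _) (max_le (by linarith) (by linarith)))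
    (hW j hj (le_max_right _ _) (max_le (by linarith) (by linarith))) hwi.ne_top
  have := hη.le_of_wi (by linarith [hp0 i]) (show p i ≤ p j by linarith) (hpl j hj) hF hfin
  linarith

lemma HypSpace.reverse_start (H : HypSpace d δ f) {A B C : X} {a e : ℝ} (ha : 0 ≤ a) (he : 0 ≤ e)
    (hBA : d B A ≠ ⊤) (hCA : Wi d a C A) (hCB : Wi d e C B) :
    Wi d (a + δ + (e + 2) * (f (δ + 1) + 1)) B A :=
  H.op.reverse_end (A := A) (B := B) (C := C) ha he hBA hCA hCB

/-- There are `n` steps of length at most `1` along `R` from time `u` to time `v`. -/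
def Steps (d : X → X → ℝ≥0∞) (R : ℝ → X) : ℕ → ℝ → ℝ → Prop
  | 0, u, v => u = v
  | n + 1, u, v => ∃ m, u ≤ m ∧ m ≤ v ∧ Wi d 1 (R u) (R m) ∧ Steps d R n m v

lemma Steps.le {R : ℝ → X} {n : ℕ} {u v : ℝ} (h : Steps d R n u v) : u ≤ v := by
  cases n with
  | zero => exact le_of_eq h
  | succ n => obtain ⟨m, h1, h2, -⟩ := h; exact h1.trans h2

lemma Steps.split {R : ℝ → X} {a b : ℕ} {u v : ℝ} (h : Steps d R (a + b) u v) :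
    ∃ m, Steps d R a u m ∧ Steps d R b m v := by
  induction a generalizing u with
  | zero => exact ⟨u, rfl, by simpa using h⟩
  | succ a ih =>
    rw [Nat.add_right_comm] at h
    obtain ⟨m, h1, h2, h3, h4⟩ := h
    obtain ⟨m', h5, h6⟩ := ih h4
    exact ⟨m', ⟨m, h1, h5.le, h3, h5⟩, h6⟩

/-- A geodesic is logarithmically close to each path with the same ends. -/
lemma HypSpace.log_close (H : HypSpace d δ f) {R : ℝ → X}
    (hR : ∀ u v, 0 ≤ u → u ≤ v → d (R u) (R v) ≠ ⊤) (k : ℕ) :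
    ∀ (n : ℕ) (u v : ℝ), 0 ≤ u → Steps d R n u v → n ≤ 2 ^ k → ∀ σ ℓ, Seg d σ ℓ (R u) (R v) →
      ∀ p, 0 ≤ p → p ≤ ℓ → ∃ w, u ≤ w ∧ w ≤ v ∧ Wi d ((4 * δ + 1) * k + 1) (R w) (σ p) := by
  have hδ := H.nonneg
  induction k with
  | zero =>
    intro n u v hu hn hnk σ ℓ hσ p hp hpl
    refine ⟨u, le_rfl, hn.le, ?_⟩
    have hw : Wi d 1 (R u) (R v) := by
      rcases n with _ | _ | n
      · have : u = v := hn
        simp [Wi, this, H.met.refl]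
      · obtain ⟨m, h1, h2, h3, h4⟩ := hn
        have : m = v := h4
        rwa [← this]
      · simp at hnk
    have := hσ.length_le zero_le_one hw
    exact (hσ.wi_left hp hpl).mono (by simp; linarith)
  | succ k ih =>
    intro n u v hu hn hnk σ ℓ hσ p hp hpl
    -- Halving the path costs `4δ + 1` per level, by `triangle_in` with `τ = 1`.
    obtain ⟨a, b, ha, hb, rfl⟩ : ∃ a b : ℕ, a ≤ 2 ^ k ∧ b ≤ 2 ^ k ∧ n = a + b := by
      rw [pow_succ] at hnk
      exact ⟨min n (2 ^ k), n - min n (2 ^ k), by omega, by omega, by omega⟩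
    obtain ⟨m, h1, h2⟩ := hn.split
    have hum := h1.le
    have hmv := h2.le
    obtain ⟨σ₁, ℓ₁, hσ₁⟩ := H.geod _ _ (hR u m hu hum)
    obtain ⟨σ₂, ℓ₂, hσ₂⟩ := H.geod _ _ (hR m v (hu.trans hum) hmv)
    have hk : (0 : ℝ) ≤ (4 * δ + 1) * k + 1 := by positivity
    rcases H.triangle_in hσ hσ₁ hσ₂ hp hpl one_pos with ⟨q, hq, hq', hw⟩ | ⟨q, hq, hq', hw⟩
    · obtain ⟨w, hw1, hw2, hw3⟩ := ih a u m hu h1 ha _ _ hσ₁ q hq hq'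
      exact ⟨w, hw1, hw2.trans hmv, (hw3.trans H.met hk (by linarith) hw).mono
        (by push_cast; linarith)⟩
    · obtain ⟨w, hw1, hw2, hw3⟩ := ih b m v (hu.trans hum) h2 hb _ _ hσ₂ q hq hq'
      exact ⟨w, hum.trans hw1, hw2, (hw3.trans H.met hk (by linarith) hw).mono
        (by push_cast; linarith)⟩

end Hyperbolic

/-! ### Stability of quasi-geodesics -/

section Stability

variable {X : Type*} {d : X → X → ℝ≥0∞} {δ : ℝ} {f : ℝ → ℝ} {R : ℝ → X}

/-- For all `i ≤ t ≤ t' ≤ j`, each point of a geodesic from `R(t)` to `R(t')` is `E`-near to a point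
of `R` between the times `t` and `t'`. -/
def Follows (d : X → X → ℝ≥0∞) (R : ℝ → X) (i j E : ℝ) : Prop :=
  ∀ t t', i ≤ t → t ≤ t' → t' ≤ j → ∀ σ ℓ, Seg d σ ℓ (R t) (R t') → ∀ u, 0 ≤ u → u ≤ ℓ →
    ∃ w, t ≤ w ∧ w ≤ t' ∧ Near d E (σ u) (R w)

/-- Localisation at the end: the new geodesic ends at a distance linear in `E` after the point
considered. Its end `R tz` is near the point `2E` further along `σ`, which is too far for the third
side to be reached from `σ u` within `δ`. -/
lemma HypSpace.cut_end (H : HypSpace d δ f) (hR : ∀ u v, 0 ≤ u → u ≤ v → d (R u) (R v) ≠ ⊤)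
    {i j E : ℝ} (hi : 0 ≤ i) (hE : Follows d R i j E) (hE1 : 1 ≤ E) (hEδ : δ < E)
    (hEF : f (δ + 1) < 2 * E) {t t' : ℝ} (hit : i ≤ t) (htt : t ≤ t') (htj : t' ≤ j)
    {σ : ℝ → X} {ℓ : ℝ} (hσ : Seg d σ ℓ (R t) (R t')) {u : ℝ} (hu : 0 ≤ u) (hul : u ≤ ℓ)
    (hno : ∀ w, t ≤ w → w ≤ t' → ¬ Wi d (E - 1) (σ u) (R w)) :
    ∃ tz, t ≤ tz ∧ tz ≤ t' ∧ ∃ η ℓ₁ v, Seg d η ℓ₁ (R t) (R tz) ∧ 0 ≤ v ∧ v ≤ ℓ₁ ∧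
      Wi d δ (η v) (σ u) ∧ ℓ₁ - v ≤ 3 * E + 3 * δ + (E + 2) * (f (δ + 1) + 1) := by
  have hδ := H.nonneg
  have hF := H.f_nonneg (R t) (δ + 1) (by linarith)
  set F := f (δ + 1) with hFd
  have hpos : 0 ≤ (E + 2) * (F + 1) := by positivity
  have hrefl : ∀ x : X, Wi d δ x x := fun x => by simp [Wi, H.met.refl]
  by_cases hc : ℓ < u + 2 * E
  · exact ⟨t', htt, le_rfl, σ, ℓ, u, hσ, hu, hul, hrefl _, by linarith⟩
  push Not at hc
  obtain ⟨tz, htz, htz', hz⟩ := hE t t' hit htt htj σ ℓ hσ (u + 2 * E) (by linarith) hc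
  refine ⟨tz, htz, htz', ?_⟩
  obtain ⟨η, ℓ₁, hη⟩ := H.geod _ _ (hR t tz (hi.trans hit) htz)
  have hpz := hσ.wi hu (show u ≤ u + 2 * E by linarith) hc
  rcases hz with hz | hz
  · obtain ⟨e, le, he⟩ := H.geod _ _ hz.ne_top
    have hle := he.length_le (by linarith) hz
    rcases H.thin _ _ _ _ _ _ _ _ _ (hσ.init (by linarith) hc) (Or.inl hη) (Or.inl he) u hu
      (by linarith) with ⟨v, h0, h1, h2⟩ | ⟨w, h0, h1, h2⟩
    · refine ⟨η, ℓ₁, v, hη, h0, h1, h2, ?_⟩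
      have := hη.le_of_wi_right h0 h1 (by linarith) ((h2.trans H.met hδ (by linarith)
        hpz).trans H.met (by linarith) (by linarith) hz)
      linarith
    -- Since `σ u` does not reach `R tz` within `E - 1`, the point `e w` is within `δ + 1` of the
    -- start of `e`. Then (B2) makes a piece of `σ` of length `2E` too short.
    · exfalso
      have h3 := h2.trans H.met hδ (by linarith) (he.wi_right h0 h1)
      have h4 : E - 1 < δ + (le - w) := by
        by_contra hcon
        push Not at hcon
        exact hno tz htz htz' (h3.mono hcon)
      have h5 := (he.wi_left h0 h1).mono (show w ≤ δ + 1 by linarith)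
      have h6 := H.b2 _ _ _ (δ + 1) (by linarith) (h2.mono (by linarith)) h5 hpz.ne_top
      have := hσ.le_of_wi hu (by linarith) hc hF h6
      linarith
  · obtain ⟨e, le, he⟩ := H.geod _ _ hz.ne_top
    have hle := he.length_le (by linarith) hz
    rcases H.thin _ _ _ _ _ _ _ _ _ (hσ.init (by linarith) hc) (Or.inl hη) (Or.inr he) u hu
      (by linarith) with ⟨v, h0, h1, h2⟩ | ⟨w, h0, h1, h2⟩
    · refine ⟨η, ℓ₁, v, hη, h0, h1, h2, ?_⟩
      have h3 := h2.trans H.met hδ (by linarith) hpz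
      have h4 := H.reverse_end (by linarith) (by linarith) (hη.wi_right h0 h1).ne_top h3 hz
      have := hη.le_of_wi_right h0 h1 (by linarith) h4
      linarith
    · exfalso
      have h3 := h2.trans H.met hδ (by linarith) (he.wi_right h0 h1)
      have := hσ.le_of_wi hu (by linarith) hc (by linarith) h3
      linarith

/-- Localisation at the start: `θ` has length linear in `E`. The auxiliary point lies `2E + 3δ + 1`
before `η v`; the distance `2E` excludes the third side, and `3δ + 1` is the room in which
`parallel_end` turns a distance towards `θ` into one from `θ`. -/
lemma HypSpace.cut_start (H : HypSpace d δ f) (hR : ∀ u v, 0 ≤ u → u ≤ v → d (R u) (R v) ≠ ⊤)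
    {i j E A : ℝ} (hi : 0 ≤ i) (hE : Follows d R i j E) (hE1 : 1 ≤ E) (hEδ : δ < E)
    (hEF : f (5 * δ + 2) < 2 * E) {t t' : ℝ} (hit : i ≤ t) (htt : t ≤ t') (htj : t' ≤ j)
    {η : ℝ → X} {ℓ : ℝ} (hη : Seg d η ℓ (R t) (R t')) {v : ℝ} (hv : 0 ≤ v) (hvl : v ≤ ℓ)
    (hA : ℓ - v ≤ A) (hno : ∀ w, t ≤ w → w ≤ t' → ¬ Wi d (E - 1 - δ) (R w) (η v)) :
    ∃ ty, t ≤ ty ∧ ty ≤ t' ∧ ∃ θ ℓ₂ v₃, Seg d θ ℓ₂ (R ty) (R t') ∧ 0 ≤ v₃ ∧ v₃ ≤ ℓ₂ ∧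
      Wi d (4 * δ + 1) (θ v₃) (η v) ∧
      ℓ₂ ≤ 3 * E + 4 * δ + 1 + A + (E + 2) * (f (δ + 1) + 1) := by
  have hδ := H.nonneg
  have hF := H.f_nonneg (R t) (δ + 1) (by linarith)
  have hF' := H.f_nonneg (R t) (5 * δ + 2) (by linarith)
  set F := f (δ + 1) with hFd
  have hpos : 0 ≤ (E + 2) * (F + 1) := by positivity
  by_cases hc : v < 2 * E + 3 * δ + 1
  · refine ⟨t, le_rfl, htt, η, ℓ, v, hη, hv, hvl, ?_, by linarith⟩
    simp [Wi, H.met.refl]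
  push Not at hc
  obtain ⟨ty, hty, hty', hy⟩ := hE t t' hit htt htj η ℓ hη (v - (2 * E + 3 * δ + 1))
    (by linarith) (by linarith)
  refine ⟨ty, hty, hty', ?_⟩
  obtain ⟨θ, ℓ₂, hθ⟩ := H.geod _ _ (hR ty t' ((hi.trans hit).trans hty) hty')
  have hyt := hη.tail (u := v - (2 * E + 3 * δ + 1)) (by linarith) (by linarith)
  set y := η (v - (2 * E + 3 * δ + 1)) with hyd
  have hyR := hη.wi_right (t := v - (2 * E + 3 * δ + 1)) (by linarith) (by linarith)
  rw [← hyd] at hyR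
  have hlen : ℓ₂ ≤ 3 * E + 4 * δ + 1 + A + (E + 2) * (F + 1) := by
    rcases hy with hy | hy
    · have := H.reverse_start (by linarith) (by linarith) hθ.ne_top hyR hy
      have := hθ.length_le (by linarith) this
      linarith
    · have := hθ.length_le (by linarith) (hy.trans H.met (by linarith) (by linarith) hyR)
      linarith
  have hh1 : η (v - (2 * E + 3 * δ + 1) + 2 * E) = η (v - (3 * δ + 1)) := by congr 1; ring
  have hend : ∀ w, 0 ≤ w → w ≤ ℓ₂ → Wi d δ (η (v - (3 * δ + 1))) (θ w) →
      ∃ θ ℓ₂ v₃, Seg d θ ℓ₂ (R ty) (R t') ∧ 0 ≤ v₃ ∧ v₃ ≤ ℓ₂ ∧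
      Wi d (4 * δ + 1) (θ v₃) (η v) ∧ ℓ₂ ≤ 3 * E + 4 * δ + 1 + A + (E + 2) * (F + 1) := by
    intro w h0 h1 h2
    obtain ⟨v₃, h3, h4, h5⟩ := H.parallel_end hη hθ (u := v) (u₁ := v - (3 * δ + 1)) hvl
      (by linarith) (by linarith) h0 h1 h2 one_pos
    exact ⟨θ, ℓ₂, v₃, hθ, h3, h4, h5, hlen⟩
  have hyh : Wi d (2 * E) y (η (v - (3 * δ + 1))) :=
    (hη.wi (s := v - (2 * E + 3 * δ + 1)) (t := v - (3 * δ + 1)) (by linarith) (by linarith)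
      (by linarith)).mono (by linarith)
  have hdist : ∀ r, 0 ≤ r → Wi d r y (η (v - (3 * δ + 1))) → 2 * E ≤ r := by
    intro r hr h
    have := hη.le_of_wi (s := v - (2 * E + 3 * δ + 1)) (t := v - (3 * δ + 1)) (by linarith)
      (by linarith) (by linarith) hr h
    linarith
  rcases hy with hy | hy
  · obtain ⟨e, le, he⟩ := H.geod _ _ hy.ne_top
    have hle := he.length_le (by linarith) hy
    rcases H.thin _ _ _ _ _ _ _ _ _ hyt (Or.inl he) (Or.inr hθ) (2 * E) (by linarith)
      (by linarith) with ⟨w, h0, h1, h2⟩ | ⟨w, h0, h1, h2⟩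
    · rw [hh1] at h2
      have := hdist _ (by linarith) ((he.wi_left h0 h1).trans H.met h0 hδ h2)
      linarith
    · rw [hh1] at h2
      exact hend w h0 h1 h2
  · obtain ⟨e, le, he⟩ := H.geod _ _ hy.ne_top
    have hle := he.length_le (by linarith) hy
    rcases H.thin _ _ _ _ _ _ _ _ _ hyt (Or.inr he) (Or.inr hθ) (2 * E) (by linarith)
      (by linarith) with ⟨w, h0, h1, h2⟩ | ⟨w, h0, h1, h2⟩
    · rw [hh1] at h2
      exfalso
      have h3 := hη.wi (s := v - (3 * δ + 1)) (t := v) (by linarith) (by linarith) hvl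
      have h4 := ((he.wi_left h0 h1).trans H.met h0 hδ h2).trans H.met (by linarith)
        (by linarith) h3
      have h5 : E - 1 - δ < w + δ + (v - (v - (3 * δ + 1))) := by
        by_contra hcon
        push Not at hcon
        exact hno ty hty hty' (h4.mono hcon)
      have h6 := H.b1 _ _ _ (5 * δ + 2) (by linarith)
        ((he.wi_right h0 h1).mono (by linarith)) (h2.mono (by linarith)) hyh.ne_top
      have := hdist _ hF' h6
      linarith
    · rw [hh1] at h2
      exact hend w h0 h1 h2

/-- For large `E` the integer part of `(E - D') / D` serves as `k`, because `2 ^ k` outgrows linear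
functions of `k`. -/
lemma linear_le_two_pow (a b D D' : ℝ) (ha : 0 ≤ a) (hD : 0 < D) :
    ∃ C : ℝ, ∀ E, C ≤ E → ∃ k : ℕ, a * E + b ≤ 2 ^ k ∧ D * k + D' ≤ E := by
  have h1 : Filter.Tendsto (fun k : ℕ => (k : ℝ) ^ 1 / 2 ^ k) Filter.atTop (𝓝 0) :=
    tendsto_pow_const_div_const_pow_of_one_lt 1 one_lt_two
  have h2 : Filter.Tendsto (fun k : ℕ => (1 / 2 : ℝ) ^ k) Filter.atTop (𝓝 0) :=
    tendsto_pow_atTop_nhds_zero_of_lt_one (by norm_num) (by norm_num)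
  have h3 : Filter.Tendsto (fun k : ℕ => a * D * ((k : ℝ) ^ 1 / 2 ^ k) +
      (a * (D + D') + b) * (1 / 2 : ℝ) ^ k) Filter.atTop (𝓝 0) := by
    simpa using (h1.const_mul (a * D)).add (h2.const_mul (a * (D + D') + b))
  obtain ⟨K, hK⟩ := Filter.eventually_atTop.1 (h3.eventually_le_const one_pos)
  refine ⟨D * (K + 1) + D', fun E hE => ?_⟩
  have hq : 0 ≤ (E - D') / D := div_nonneg (by nlinarith [(K.cast_nonneg : (0 : ℝ) ≤ K)]) hD.le
  refine ⟨⌊(E - D') / D⌋₊, ?_, ?_⟩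
  · set k := ⌊(E - D') / D⌋₊ with hk
    have hKk : K ≤ k := by
      refine Nat.le_floor ?_
      rw [le_div_iff₀ hD]
      nlinarith
    have h4 := Nat.lt_floor_add_one ((E - D') / D)
    rw [← hk, div_lt_iff₀ hD] at h4
    have h5 := hK k hKk
    have h6 : (0 : ℝ) < 2 ^ k := by positivity
    have h7 : (a * D * ((k : ℝ) ^ 1 / 2 ^ k) + (a * (D + D') + b) * (1 / 2 : ℝ) ^ k) * 2 ^ k =
        a * D * k + (a * (D + D') + b) := by
      rw [one_div, inv_pow]; field_simp
    have h8 : a * D * k + (a * (D + D') + b) ≤ 2 ^ k := by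
      rw [← h7]
      exact mul_le_of_le_one_left h6.le h5
    have h9 : a * E ≤ a * ((k + 1) * D + D') := mul_le_mul_of_nonneg_left (by linarith) ha
    linarith
  · have h4 := Nat.floor_le hq
    rw [le_div_iff₀ hD] at h4
    linarith

/-- A ray that is quasi-geodesic in terms of steps of length at most `1`. -/
structure CoarseRay (d : X → X → ℝ≥0∞) (R : ℝ → X) : Prop where
  fin : ∀ u v, 0 ≤ u → u ≤ v → d (R u) (R v) ≠ ⊤
  steps : ∃ g c : ℝ, 0 ≤ g ∧ ∀ u v L, 0 ≤ u → u ≤ v → 0 ≤ L → Wi d L (R u) (R v) →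
    ∃ n : ℕ, (n : ℝ) ≤ g * L + c ∧ Steps d R n u v
  bdd : ∀ b, 0 ≤ b → ∃ C : ℝ, 0 ≤ C ∧ ∀ t t', 0 ≤ t → t ≤ t' → t' ≤ b → Wi d C (R t) (R t')
  leaves : ∀ (x : X) (r : ℝ), ∃ p : ℝ, 0 ≤ p ∧ ∀ t, p ≤ t → ¬ Wi d r x (R t)

/-- Geodesics between points of a coarse ray stay close to it. -/
lemma HypSpace.stability (H : HypSpace d δ f) (hR : CoarseRay d R) :
    ∃ E, 0 ≤ E ∧ ∀ i j, 0 ≤ i → i ≤ j → Follows d R i j E := by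
  have hδ := H.nonneg
  obtain ⟨g, c, hg, hst⟩ := hR.steps
  have hF := H.f_nonneg (R 0) (δ + 1) (by linarith)
  set F := f (δ + 1) with hFd
  -- The linear function bounds the number of steps of `R` along a doubly cut geodesic. The constant
  -- `5δ + 3` collects `1` from `log_close`, `4δ + 1` from `cut_start`, `δ` from `cut_end`, and the
  -- `1` to be gained.
  obtain ⟨C, hC⟩ := linear_le_two_pow (g * (6 + 2 * (F + 1))) (g * (7 * δ + 1 + 4 * (F + 1)) + c)
    (4 * δ + 1) (5 * δ + 3) (by positivity) (by linarith)
  let C₁ := max C (max (2 + δ) (max (F + 1) (f (5 * δ + 2) + 1)))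
  have hC₁ : C ≤ C₁ ∧ 2 + δ ≤ C₁ ∧ F + 1 ≤ C₁ ∧ f (5 * δ + 2) + 1 ≤ C₁ := by
    simp only [C₁, le_max_iff, le_refl, true_or, or_true, and_self]
  have step : ∀ i j E, 0 ≤ i → C₁ ≤ E → Follows d R i j E → Follows d R i j (E - 1) := by
    intro i j E hi hCE hE t t' hit htt htj σ ℓ hσ u hu hul
    by_contra hno
    push Not at hno
    have hno1 : ∀ w, t ≤ w → w ≤ t' → ¬ Wi d (E - 1) (σ u) (R w) := fun w h1 h2 h =>
      hno w h1 h2 (Or.inl h)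
    have hno2 : ∀ w, t ≤ w → w ≤ t' → ¬ Wi d (E - 1) (R w) (σ u) := fun w h1 h2 h =>
      hno w h1 h2 (Or.inr h)
    obtain ⟨tz, htz, htz', η, ℓ₁, v, hη, hv, hvl, hvu, hA⟩ := H.cut_end hR.fin hi hE (by linarith)
      (by linarith) (by linarith) hit htt htj hσ hu hul hno1
    obtain ⟨ty, hty, hty', θ, ℓ₂, v₃, hθ, h0, h1, h2, h3⟩ := H.cut_start hR.fin hi hE (by linarith)
      (by linarith) (by linarith) hit htz (htz'.trans htj) hη hv hvl hA (fun w h1 h2 h =>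
        hno2 w h1 (h2.trans htz') ((h.trans H.met (by linarith) hδ hvu).mono (by linarith)))
    have hty0 : 0 ≤ ty := (hi.trans hit).trans hty
    obtain ⟨n, hn, hn'⟩ := hst ty tz ℓ₂ hty0 hty' hθ.nonneg hθ.dist_eq.le
    obtain ⟨k, hk, hk'⟩ := hC E (by linarith)
    have hnk : n ≤ 2 ^ k := by
      have : (n : ℝ) ≤ 2 ^ k := by
        have h4 : g * ℓ₂ ≤ g * (3 * E + 4 * δ + 1 + (3 * E + 3 * δ + (E + 2) * (F + 1)) +
          (E + 2) * (F + 1)) := mul_le_mul_of_nonneg_left h3 hg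
        linarith
      exact_mod_cast this
    obtain ⟨w, hw, hw', hww⟩ := H.log_close hR.fin k n ty tz hty0 hn' hnk _ _ hθ v₃ h0 h1
    have hk0 : 0 ≤ (4 * δ + 1) * k + 1 := by positivity
    exact hno2 w (hty.trans hw) (hw'.trans htz') (((hww.trans H.met hk0 (by linarith) h2).trans
      H.met (by linarith) hδ hvu).mono (by linarith))
  refine ⟨C₁, by linarith, fun i j hi hij => ?_⟩
  obtain ⟨B, hB0, hB⟩ := hR.bdd j (hi.trans hij)
  -- On a bounded stretch of `R` distances are bounded, so some bound is valid. It may depend on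
  -- `j`, but the descent by `step` ends at `C₁`, which does not.
  have hstart : ∃ n : ℕ, Follows d R i j (C₁ + n) := by
    obtain ⟨n, hn⟩ := exists_nat_ge (B - C₁)
    refine ⟨n, fun t t' hit htt htj σ ℓ hσ u hu hul => ⟨t, le_rfl, htt, Or.inr ?_⟩⟩
    have := hσ.length_le hB0 (hB t t' (hi.trans hit) htt htj)
    exact (hσ.wi_left hu hul).mono (by linarith)
  obtain ⟨n, hn⟩ := hstart
  induction n with
  | zero => simpa using hn
  | succ n ih =>
    refine ih ?_
    have := step i j (C₁ + (n + 1 : ℕ)) hi (by push_cast; linarith) hn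
    rwa [show C₁ + ((n + 1 : ℕ) : ℝ) - 1 = C₁ + n by push_cast; ring] at this

/-- The geodesics between far points of `α` are far from each given point. -/
def Far (d : X → X → ℝ≥0∞) (α : ℝ → X) : Prop :=
  ∀ (s : X) (r : ℝ), ∃ N : ℝ, 0 ≤ N ∧ ∀ i j, N ≤ i → N ≤ j → ∀ γ ℓ, Seg d γ ℓ (α i) (α j) →
    ∀ u, 0 ≤ u → u ≤ ℓ → ¬ Near d r s (γ u)

lemma Far.leave {α : ℝ → X} (hd : IsPseudoSemimetric d) (h : Far d α) (s : X) (r : ℝ) :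
    ∃ N : ℝ, 0 ≤ N ∧ ∀ i, N ≤ i → ¬ Near d r s (α i) := by
  obtain ⟨N, hN0, hN⟩ := h s r
  exact ⟨N, hN0, fun i hi => hN i i hi hi _ _ (Seg.const hd (α i)) 0 le_rfl le_rfl⟩

/-- Only out-balls are left by definition. If `R t₀` and later points `R t` kept reaching `x` within
`r`, (B2) would keep the ray in an out-ball around `R t₀`. -/
lemma CoarseRay.leave (H : HypSpace d δ f) (hR : CoarseRay d R) (x : X) (r : ℝ) :
    ∃ N : ℝ, 0 ≤ N ∧ ∀ t, N ≤ t → ¬ Near d r x (R t) := by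
  obtain ⟨p, hp0, hp⟩ := hR.leaves x r
  have : ∃ N : ℝ, 0 ≤ N ∧ ∀ t, N ≤ t → ¬ Wi d r (R t) x := by
    by_contra hcon
    push Not at hcon
    obtain ⟨t₀, ht₀, h₀⟩ := hcon 0 le_rfl
    obtain ⟨q, hq0, hq⟩ := hR.leaves (R t₀) (f (max r 0))
    obtain ⟨t, ht, h⟩ := hcon (max q t₀) (le_max_of_le_left hq0)
    exact hq t ((le_max_left _ _).trans ht) (H.b2 _ _ _ (max r 0) (le_max_right _ _)
      (h₀.mono (le_max_left _ _)) (h.mono (le_max_left _ _))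
      (hR.fin _ _ ht₀ ((le_max_right _ _).trans ht)))
  obtain ⟨N, hN0, hN⟩ := this
  exact ⟨max p N, le_max_of_le_left hp0, fun t ht h => h.elim
    (hp t ((le_max_left _ _).trans ht)) (hN t ((le_max_right _ _).trans ht))⟩

/-- A geodesic point near `s` is near a late point of `R` by stability. If the two distances do not
compose, (B1) or (B2) compares `s` with the ray, provided that the distance is finite; if it is
infinite, `s` has no finite distance to, or from, the geodesic either. -/
lemma CoarseRay.far_forward (H : HypSpace d δ f) (hR : CoarseRay d R) (s : X) (r : ℝ) :
    ∃ N : ℝ, 0 ≤ N ∧ ∀ i j, N ≤ i → i ≤ j → ∀ γ ℓ, Seg d γ ℓ (R i) (R j) →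
      ∀ u, 0 ≤ u → u ≤ ℓ → ¬ Near d r s (γ u) := by
  obtain ⟨E, hE0, hE⟩ := H.stability hR
  wlog hr : 0 ≤ r generalizing r
  · obtain ⟨N, hN0, hN⟩ := this 0 le_rfl
    exact ⟨N, hN0, fun i j hi hij γ ℓ hγ u h0 h1 h =>
      hN i j hi hij γ ℓ hγ u h0 h1 (h.mono (by linarith))⟩
  obtain ⟨N₁, hN₁0, hN₁⟩ := hR.leave H s (max (r + E) (f (max r E)))
  have hmr : 0 ≤ max r E := le_max_of_le_left hr
  have h1 : ∃ N : ℝ, 0 ≤ N ∧ ∀ i j, N ≤ i → i ≤ j → ∀ γ ℓ, Seg d γ ℓ (R i) (R j) →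
      ∀ u, 0 ≤ u → u ≤ ℓ → ¬ Wi d r s (γ u) := by
    by_cases hs : ∃ t₀, 0 ≤ t₀ ∧ d s (R t₀) ≠ ⊤
    · obtain ⟨t₀, ht₀, hs⟩ := hs
      refine ⟨max t₀ N₁, le_max_of_le_left ht₀, fun i j hi hij γ ℓ hγ u h0 h1 h => ?_⟩
      have hi0 : 0 ≤ i := (le_max_of_le_left ht₀).trans hi
      obtain ⟨w, hw, hw', hn⟩ := hE i j hi0 hij i j le_rfl hij le_rfl γ ℓ hγ u h0 h1
      have hwN : N₁ ≤ w := (le_max_right _ _).trans (hi.trans hw)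
      rcases hn with hn | hn
      · exact hN₁ w hwN (Or.inl ((h.trans H.met hr hE0 hn).mono (le_max_left _ _)))
      · exact hN₁ w hwN (Or.inl ((H.b2 _ _ _ (max r E) hmr (h.mono (le_max_left _ _))
          (hn.mono (le_max_right _ _)) (ne_top_trans H.met hs (hR.fin _ _ ht₀
            ((le_max_left _ _).trans (hi.trans hw))))).mono (le_max_right _ _)))
    · push Not at hs
      refine ⟨0, le_rfl, fun i j hi hij γ ℓ hγ u h0 h1 h => ?_⟩
      exact ne_top_trans H.met h.ne_top (hγ.wi_right h0 h1).ne_top (hs j (hi.trans hij))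
  have h2 : ∃ N : ℝ, 0 ≤ N ∧ ∀ i j, N ≤ i → i ≤ j → ∀ γ ℓ, Seg d γ ℓ (R i) (R j) →
      ∀ u, 0 ≤ u → u ≤ ℓ → ¬ Wi d r (γ u) s := by
    by_cases hs : ∀ t₀, 0 ≤ t₀ → ∃ t, t₀ ≤ t ∧ d (R t) s ≠ ⊤
    · have hs' : ∀ t, 0 ≤ t → d (R t) s ≠ ⊤ := fun t ht => by
        obtain ⟨t', h3, h4⟩ := hs t ht
        exact ne_top_trans H.met (hR.fin _ _ ht h3) h4
      refine ⟨N₁, hN₁0, fun i j hi hij γ ℓ hγ u h0 h1 h => ?_⟩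
      have hi0 : 0 ≤ i := hN₁0.trans hi
      obtain ⟨w, hw, hw', hn⟩ := hE i j hi0 hij i j le_rfl hij le_rfl γ ℓ hγ u h0 h1
      have hwN : N₁ ≤ w := hi.trans hw
      rcases hn with hn | hn
      · exact hN₁ w hwN (Or.inr ((H.b1 _ _ _ (max r E) hmr (hn.mono (le_max_right _ _))
          (h.mono (le_max_left _ _)) (hs' w (hi0.trans hw))).mono (le_max_right _ _)))
      · exact hN₁ w hwN (Or.inr ((hn.trans H.met hE0 hr h).mono
          (by rw [add_comm]; exact le_max_left _ _)))
    · push Not at hs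
      obtain ⟨t₀, ht₀, hs⟩ := hs
      refine ⟨t₀, ht₀, fun i j hi hij γ ℓ hγ u h0 h1 h => ?_⟩
      exact ne_top_trans H.met (hγ.wi_left h0 h1).ne_top h.ne_top (hs i hi)
  obtain ⟨N, hN0, hN⟩ := h1
  obtain ⟨N', hN0', hN'⟩ := h2
  refine ⟨max N N', le_max_of_le_left hN0, fun i j hi hij γ ℓ hγ u h0 h1 h => ?_⟩
  rcases h with h | h
  · exact hN i j ((le_max_left _ _).trans hi) hij γ ℓ hγ u h0 h1 h
  · exact hN' i j ((le_max_right _ _).trans hi) hij γ ℓ hγ u h0 h1 h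

/-- For `j < i`, a geodesic from `R i` to `R j` forms a triangle with a forward geodesic and a
constant side. The constant side is at `R i` if `s` reaches the geodesic, and at `R j` if `s` is
reached from it. -/
lemma CoarseRay.far (H : HypSpace d δ f) (hR : CoarseRay d R) : Far d R := by
  intro s r
  have hδ := H.nonneg
  wlog hr : 0 ≤ r generalizing r
  · obtain ⟨N, hN0, hN⟩ := this 0 le_rfl
    exact ⟨N, hN0, fun i j hi hij γ ℓ hγ u h0 h1 h =>
      hN i j hi hij γ ℓ hγ u h0 h1 (h.mono (by linarith))⟩
  obtain ⟨N₁, hN₁0, hN₁⟩ := hR.far_forward H s (r + δ)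
  obtain ⟨N₂, hN₂0, hN₂⟩ := hR.leave H s (f (max r δ))
  refine ⟨max N₁ N₂, le_max_of_le_left hN₁0, fun i j hi hj γ ℓ hγ u h0 h1 h => ?_⟩
  have hi1 := (le_max_left _ _).trans hi
  have hi2 := (le_max_right _ _).trans hi
  have hj1 := (le_max_left _ _).trans hj
  have hj2 := (le_max_right _ _).trans hj
  rcases le_total i j with hij | hij
  · exact hN₁ i j hi1 hij γ ℓ hγ u h0 h1 (h.mono (by linarith))
  obtain ⟨τ, ℓ', hτ⟩ := H.geod _ _ (hR.fin _ _ (hN₁0.trans hj1) hij)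
  have hm : 0 ≤ max r δ := le_max_of_le_left hr
  rcases h with h | h
  · rcases H.thin _ _ _ _ _ _ _ _ _ hγ (Or.inl (Seg.const H.met (R i))) (Or.inl hτ) u h0 h1 with
      ⟨v, -, -, h4⟩ | ⟨v, h2, h3, h4⟩
    · exact hN₂ i hi2 (Or.inl (H.b2 _ _ _ _ hm (h.mono (le_max_left _ _)) (h4.mono
        (le_max_right _ _)) (ne_top_trans H.met (ne_top_trans H.met h.ne_top
          (hγ.wi_right h0 h1).ne_top) hτ.ne_top)))
    · exact hN₁ j i hj1 hij τ ℓ' hτ v h2 h3 (Or.inl (h.trans H.met hr hδ h4))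
  · rcases H.thin _ _ _ _ _ _ _ _ _ hγ (Or.inr hτ) (Or.inl (Seg.const H.met (R j))) u h0 h1 with
      ⟨v, h2, h3, h4⟩ | ⟨v, -, -, h4⟩
    · exact hN₁ j i hj1 hij τ ℓ' hτ v h2 h3 (Or.inr ((h4.trans H.met hδ hr h).mono (by linarith)))
    · exact hN₂ j hj2 (Or.inr (H.b1 _ _ _ _ hm (h4.mono (le_max_right _ _)) (h.mono
        (le_max_left _ _)) (ne_top_trans H.met hτ.ne_top (ne_top_trans H.met
          (hγ.wi_left h0 h1).ne_top h.ne_top))))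

end Stability

/-! ### Quasi-geodesic rays and anti-rays as coarse rays -/

section Rays

variable {X : Type*} {d : X → X → ℝ≥0∞} {R : ℝ → X}

lemma OneSided.op_neg {I : Set ℝ} (h : OneSided d R I) :
    OneSided (op d) (fun t => R (-t)) (-I) := by
  refine ⟨fun t ht ε hε => ?_, fun t ht ε hε => ?_⟩
  · obtain ⟨η, hη, h1⟩ := h.left (-t) ht ε hε
    exact ⟨η, hη, fun t' ht' h2 h3 => h1 (-t') ht' (by linarith) (by linarith)⟩
  · obtain ⟨η, hη, h1⟩ := h.right (-t) ht ε hε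
    exact ⟨η, hη, fun t' ht' h2 h3 => h1 (-t') ht' (by linarith) (by linarith)⟩

lemma VarLe.dist_le {a b : ℝ} {L : ℝ≥0∞} (h : VarLe d R a b L) {t t' : ℝ} (ha : a ≤ t)
    (ht : t ≤ t') (hb : t' ≤ b) : d (R t) (R t') ≤ L := by
  have := h 1 (fun i => match i with | 0 => t | _ => t')
    (monotone_nat_of_le_succ fun n => by
      match n with
      | 0 => exact ht
      | n + 1 => exact le_rfl)
    (fun i => by
      match i with
      | 0 => exact ⟨ha, ht.trans hb⟩
      | n + 1 => exact ⟨ha.trans ht, hb⟩)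
  simpa using this

lemma VarLe.exists_steps (hd : IsPseudoSemimetric d) {v : ℝ} (n : ℕ) :
    ∀ u, u ≤ v → OneSided d R (Set.Icc u v) → VarLe d R u v n →
      ∃ m ≤ n + 1, Steps d R m u v := by
  induction n with
  | zero =>
    intro u huv _ h
    refine ⟨1, le_rfl, v, huv, le_rfl, ?_, rfl⟩
    have := h.dist_le le_rfl huv le_rfl
    exact this.trans (by simp)
  | succ n ih =>
    intro u huv hR h
    by_cases hc : Wi d 1 (R u) (R v)
    · exact ⟨1, by omega, v, huv, le_rfl, hc, rfl⟩
    let A : Set ℝ := {t | t ∈ Set.Icc u v ∧ Wi d 1 (R u) (R t)}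
    have huA : u ∈ A := ⟨⟨le_rfl, huv⟩, by simp [Wi, hd.refl]⟩
    have hbdd : BddAbove A := ⟨v, fun t ht => ht.1.2⟩
    set c := sSup A with hcdef
    have huc : u ≤ c := le_csSup hbdd huA
    have hcv : c ≤ v := csSup_le ⟨u, huA⟩ fun t ht => ht.1.2
    -- Left continuity puts `c` itself into `A`. By right continuity no point from `c` on is closer
    -- to `R u` than `1`, so the first step uses up `1` of the variation.
    have hc1 : Wi d 1 (R u) (R c) := by
      refine ENNReal.le_of_forall_pos_le_add fun e he _ => ?_
      obtain ⟨η, hη, h1⟩ := hR.left c ⟨huc, hcv⟩ e (by exact_mod_cast he)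
      obtain ⟨t, ht, h2⟩ := exists_lt_of_lt_csSup ⟨u, huA⟩ (show c - η < c by linarith)
      refine (hd.triangle _ _ (R t)).trans (add_le_add ht.2 ?_)
      simpa [Wi] using h1 t ht.1 h2 (le_csSup hbdd ht)
    have hlt : ∀ t, c < t → t ≤ v → 1 ≤ d (R u) (R t) := by
      intro t h1 h2
      by_contra hcon
      push Not at hcon
      exact absurd (le_csSup hbdd (show t ∈ A from ⟨⟨huc.trans h1.le, h2⟩, by
        simpa [Wi] using hcon.le⟩)) (not_le.2 h1)
    have hcv' : c < v := lt_of_le_of_ne hcv fun h => hc (h ▸ hc1)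
    have hle : ∀ t, c ≤ t → t ≤ v → 1 ≤ d (R u) (R t) := by
      intro t h1 h2
      rcases h1.lt_or_eq with h1 | rfl
      · exact hlt t h1 h2
      · refine ENNReal.le_of_forall_pos_le_add fun e he _ => ?_
        obtain ⟨η, hη, h1⟩ := hR.right c ⟨huc, hcv⟩ e (by exact_mod_cast he)
        have h3 : c < min v (c + η / 2) := lt_min hcv' (by linarith)
        refine (hlt _ h3 (min_le_left _ _)).trans ((hd.triangle _ _ (R c)).trans
          (add_le_add le_rfl ?_))
        simpa [Wi] using h1 _ ⟨huc.trans h3.le, min_le_left _ _⟩ h3.le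
          (by linarith [min_le_right v (c + η / 2)])
    obtain ⟨m, hm, hsteps⟩ := ih c hcv (hR.mono (Set.Icc_subset_Icc_left huc)) (by
      intro k t hmono ht
      have := h (k + 1) (fun i => match i with | 0 => u | i + 1 => t i)
        (monotone_nat_of_le_succ fun n => by
          match n with
          | 0 => exact huc.trans (ht 0).1
          | n + 1 => exact hmono (Nat.le_succ n))
        (fun i => by
          match i with
          | 0 => exact ⟨le_rfl, huv⟩
          | n + 1 => exact ⟨huc.trans (ht n).1, (ht n).2⟩)
      rw [Finset.sum_range_succ'] at this
      have h2 := (add_le_add le_rfl (hle (t 0) (ht 0).1 (ht 0).2)).trans this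
      push_cast at h2
      exact (ENNReal.add_le_add_iff_right ENNReal.one_ne_top).1 h2)
    exact ⟨m + 1, by omega, c, huc, hcv, hc1, hsteps⟩

lemma coarseRay_of_varLe (hd : IsPseudoSemimetric d) (hR : OneSided d R (Set.Ici 0))
    (hq : ∃ γ c : ℝ, 1 ≤ γ ∧ 0 ≤ c ∧ ∀ u v, 0 ≤ u → u < v →
      ∃ L, VarLe d R u v L ∧ L ≤ ENNReal.ofReal γ * d (R u) (R v) + ENNReal.ofReal c)
    (hl : ∀ (x : X) (r : ℝ), 0 ≤ r → ∃ p : ℝ, 0 ≤ p ∧ ∀ t, p ≤ t → ¬ Wi d r x (R t)) :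
    CoarseRay d R := by
  obtain ⟨γ, c, hγ, hc, hq⟩ := hq
  have hfin : ∀ u v, 0 ≤ u → u ≤ v → d (R u) (R v) ≠ ⊤ := fun u v hu huv =>
    (hR.mono fun t ht => hu.trans ht.1).ne_top hd huv
  refine ⟨hfin, ⟨γ, c + 2, by linarith, ?_⟩, ?_, ?_⟩
  · intro u v L hu huv hL hw
    rcases huv.lt_or_eq with hlt | rfl
    · obtain ⟨L', hL', hle⟩ := hq u v hu hlt
      have h1 : L' ≤ ENNReal.ofReal (γ * L + c) := by
        rw [ENNReal.ofReal_add (by positivity) hc, ENNReal.ofReal_mul (by linarith)]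
        exact hle.trans (by gcongr; exact hw)
      have h2 : 0 ≤ γ * L + c := by positivity
      have h3 : VarLe d R u v (⌈γ * L + c⌉₊ : ℕ) := fun n t hm ht =>
        (hL' n t hm ht).trans (h1.trans (by
          rw [← ENNReal.ofReal_natCast]
          exact ENNReal.ofReal_le_ofReal (Nat.le_ceil _)))
      obtain ⟨m, hm, hs⟩ := h3.exists_steps hd _ u huv (hR.mono fun t ht => hu.trans ht.1)
      refine ⟨m, ?_, hs⟩
      have h4 : (m : ℝ) ≤ ⌈γ * L + c⌉₊ + 1 := by exact_mod_cast hm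
      linarith [Nat.ceil_lt_add_one h2]
    · exact ⟨0, by push_cast; nlinarith, rfl⟩
  · intro b hb
    obtain ⟨L, hL, hle⟩ := hq 0 (b + 1) le_rfl (by linarith)
    have hLt : L ≠ ⊤ := (lt_of_le_of_lt hle (ENNReal.add_lt_top.2
      ⟨ENNReal.mul_lt_top ENNReal.ofReal_lt_top (hfin _ _ le_rfl (by linarith)).lt_top,
        ENNReal.ofReal_lt_top⟩)).ne
    refine ⟨L.toReal, ENNReal.toReal_nonneg, fun t t' h1 h2 h3 => ?_⟩
    unfold Wi
    rw [ENNReal.ofReal_toReal hLt]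
    exact hL.dist_le h1 h2 (by linarith)
  · intro x r
    obtain ⟨p, hp, h⟩ := hl x (max r 0) (le_max_right _ _)
    exact ⟨p, hp, fun t ht hw => h t ht (hw.mono (le_max_left _ _))⟩

lemma IsQGRay.coarseRay (hd : IsPseudoSemimetric d) (h : IsQGRay d R) : CoarseRay d R := by
  have hR := h.cont.oneSided hd
  obtain ⟨γ, c, hγ, hc, hq⟩ := h.quasi
  refine coarseRay_of_varLe hd hR ⟨γ, c, hγ, hc, fun u v hu huv => ?_⟩ h.leaves
  obtain ⟨L, hL, hle⟩ := hq u hu v (hu.trans huv.le) huv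
  exact ⟨L, hL.varLe hd huv (hR.mono fun t ht => hu.trans ht.1), hle⟩

lemma IsQGAntiRay.coarseRay (hd : IsPseudoSemimetric d) (h : IsQGAntiRay d R) :
    CoarseRay (op d) (fun t => R (-t)) := by
  have hR := h.cont.oneSided hd
  obtain ⟨γ, c, hγ, hc, hq⟩ := h.quasi
  refine coarseRay_of_varLe hd.op (by simpa using hR.op_neg)
    ⟨γ, c, hγ, hc, fun u v hu huv => ?_⟩ ?_
  · obtain ⟨L, hL, hle⟩ := hq (-v) (Set.mem_Iic.2 (by linarith)) (-u)
      (Set.mem_Iic.2 (by linarith)) (by linarith)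
    refine ⟨L, ?_, hle⟩
    have := (hL.varLe hd (by linarith) (hR.mono fun t ht => ?_)).op
    · simpa using this
    · exact Set.mem_Iic.2 (ht.2.trans (by linarith))
  · intro x r hr
    obtain ⟨p, hp, hp'⟩ := h.leaves x r hr
    exact ⟨-p, by linarith, fun t ht => hp' (-t) (by linarith)⟩

end Rays

/-! ### Lines and the equivalence of rays -/

section Ends

variable {X : Type*} {d : X → X → ℝ≥0∞} {δ : ℝ} {f : ℝ → ℝ} {α β β' γ : ℝ → X}

/-- A forward line: its points reach all later points, and it diverges from each point. -/
structure FLine (d : X → X → ℝ≥0∞) (α : ℝ → X) : Prop where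
  far : Far d α
  fin : ∀ u v, 0 ≤ u → u ≤ v → d (α u) (α v) ≠ ⊤
  bdd : ∀ b, 0 ≤ b → ∃ C : ℝ, 0 ≤ C ∧ ∀ t t', 0 ≤ t → t ≤ t' → t' ≤ b → Wi d C (α t) (α t')

lemma CoarseRay.fLine (H : HypSpace d δ f) (h : CoarseRay d α) : FLine d α :=
  ⟨h.far H, h.fin, h.bdd⟩

lemma Far.op (h : Far d α) : Far (op d) α := by
  intro s r
  obtain ⟨N, hN0, hN⟩ := h s r
  refine ⟨N, hN0, fun i j hi hj γ ℓ hγ u h0 h1 h2 => ?_⟩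
  refine hN j i hj hi _ ℓ hγ.op (ℓ - u) (by linarith) (by linarith) ?_
  rw [sub_sub_cancel]
  exact near_op.1 h2

/-- A line running forward or backward. -/
def IsLine (d : X → X → ℝ≥0∞) (α : ℝ → X) : Prop := FLine d α ∨ FLine (op d) α

lemma IsLine.far (h : IsLine d α) : Far d α := h.elim FLine.far fun h => h.far.op

lemma IsLine.op (h : IsLine d α) : IsLine (op d) α := Or.symm h

/-- A line or a constant map. -/
def IsEnd (d : X → X → ℝ≥0∞) (α : ℝ → X) : Prop := IsLine d α ∨ ∃ x, α = fun _ => x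

lemma IsEnd.op (h : IsEnd d α) : IsEnd (op d) α := h.imp IsLine.op id

lemma QGLine.isLine (H : HypSpace d δ f) (R : QGLine d) : IsLine d R.pt := by
  rcases R with ⟨R, hR⟩ | ⟨R, hR⟩
  · exact Or.inl ((hR.coarseRay H.met).fLine H)
  · exact Or.inr ((hR.coarseRay H.met).fLine H.op)

/-- There are finite distances from late points of `β` to late points of `β'`, such that the
geodesics avoid a given ball. -/
def Hop (d : X → X → ℝ≥0∞) (β β' : ℝ → X) : Prop :=
  ∀ (s : X) (r N : ℝ), 0 ≤ N → ∃ u v, N ≤ u ∧ N ≤ v ∧ d (β u) (β' v) ≠ ⊤ ∧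
    ∀ σ ℓ, Seg d σ ℓ (β u) (β' v) → ∀ t, 0 ≤ t → t ≤ ℓ → ¬ Near d r s (σ t)

lemma IsLine.hop_refl (hd : IsPseudoSemimetric d) (h : IsLine d α) : Hop d α α := by
  intro s r N hN
  obtain ⟨N', hN0', hN'⟩ := h.far s r
  exact ⟨max N N', max N N', le_max_left _ _, le_max_left _ _, by simp [hd.refl],
    hN' _ _ (le_max_right _ _) (le_max_right _ _)⟩

/-- The hops touch `β` at different times, and `β` must be passable from the first contact to the
second. So the hop chosen last is the second one if `β` runs forward and the first one if it runs
backward. The radius grows by `4δ + 1` for each of two triangles. -/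
lemma Hop.trans (H : HypSpace d δ f) (hβ : IsLine d β) (h₁ : Hop d α β) (h₂ : Hop d β γ) :
    Hop d α γ := by
  intro s r N hN
  have hδ := H.nonneg
  wlog hr : 0 ≤ r generalizing r
  · obtain ⟨u, v, hu, hv, h1, h2⟩ := this 0 le_rfl
    exact ⟨u, v, hu, hv, h1, fun σ ℓ hσ t h3 h4 h5 => h2 σ ℓ hσ t h3 h4 (h5.mono (by linarith))⟩
  obtain ⟨N₁, hN₁0, hN₁⟩ := hβ.far s (r + 4 * δ + 1 + 4 * δ + 1)
  have hM : 0 ≤ max N N₁ := le_max_of_le_left hN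
  obtain ⟨u, v, v', w, hu, hw, hv, hv', hfin, huv, hvw, far₁, far₂⟩ : ∃ u v v' w, N ≤ u ∧ N ≤ w ∧
      N₁ ≤ v ∧ N₁ ≤ v' ∧ d (β v) (β v') ≠ ⊤ ∧ d (α u) (β v) ≠ ⊤ ∧ d (β v') (γ w) ≠ ⊤ ∧
      (∀ σ ℓ, Seg d σ ℓ (α u) (β v) → ∀ t, 0 ≤ t → t ≤ ℓ →
        ¬ Near d (r + 4 * δ + 1 + 4 * δ + 1) s (σ t)) ∧
      (∀ σ ℓ, Seg d σ ℓ (β v') (γ w) → ∀ t, 0 ≤ t → t ≤ ℓ →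
        ¬ Near d (r + 4 * δ + 1 + 4 * δ + 1) s (σ t)) := by
    rcases hβ with hβ | hβ
    · obtain ⟨u, v, hu, hv, h1, h2⟩ := h₁ s (r + 4 * δ + 1 + 4 * δ + 1) (max N N₁) hM
      obtain ⟨v', w, hv', hw, h3, h4⟩ := h₂ s (r + 4 * δ + 1 + 4 * δ + 1) (max (max N N₁) v)
        (le_max_of_le_left hM)
      have hNv : max N N₁ ≤ v' := (le_max_left _ _).trans hv'
      exact ⟨u, v, v', w, (le_max_left _ _).trans hu,
        (le_max_left _ _).trans ((le_max_left _ _).trans hw), (le_max_right _ _).trans hv,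
        (le_max_right _ _).trans hNv, hβ.fin _ _ (hM.trans hv) ((le_max_right _ _).trans hv'),
        h1, h3, h2, h4⟩
    · obtain ⟨v', w, hv', hw, h3, h4⟩ := h₂ s (r + 4 * δ + 1 + 4 * δ + 1) (max N N₁) hM
      obtain ⟨u, v, hu, hv, h1, h2⟩ := h₁ s (r + 4 * δ + 1 + 4 * δ + 1) (max (max N N₁) v')
        (le_max_of_le_left hM)
      have hNv : max N N₁ ≤ v := (le_max_left _ _).trans hv
      exact ⟨u, v, v', w, (le_max_left _ _).trans ((le_max_left _ _).trans hu),
        (le_max_left _ _).trans hw, (le_max_right _ _).trans hNv,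
        (le_max_right _ _).trans hv', hβ.fin _ _ (hM.trans hv') ((le_max_right _ _).trans hv),
        h1, h3, h2, h4⟩
  have hvw' := ne_top_trans H.met hfin hvw
  refine ⟨u, w, hu, hw, ne_top_trans H.met huv hvw', fun σ ℓ hσ t h0 h1 h2 => ?_⟩
  obtain ⟨σ₁, ℓ₁, hσ₁⟩ := H.geod _ _ huv
  obtain ⟨σ₂, ℓ₂, hσ₂⟩ := H.geod _ _ hvw'
  obtain ⟨σ₃, ℓ₃, hσ₃⟩ := H.geod _ _ hfin
  obtain ⟨σ₄, ℓ₄, hσ₄⟩ := H.geod _ _ hvw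
  rcases H.triangle_near hσ hσ₁ hσ₂ h0 h1 one_pos hr h2 with ⟨q, h3, h4, h5⟩ | ⟨q, h3, h4, h5⟩
  · exact far₁ _ _ hσ₁ q h3 h4 (h5.mono (by linarith))
  · rcases H.triangle_near hσ₂ hσ₃ hσ₄ h3 h4 one_pos (by linarith) h5 with
      ⟨q', h3', h4', h5'⟩ | ⟨q', h3', h4', h5'⟩
    · exact hN₁ _ _ hv hv' _ _ hσ₃ q' h3' h4' h5'
    · exact far₂ _ _ hσ₄ q' h3' h4' h5'

lemma hop_of_crossings (H : HypSpace d δ f) (hα : IsLine d α) (hβ : IsLine d β) {M : ℝ}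
    (hM : 0 ≤ M) (h : ∀ (r : ℝ), 0 ≤ r → ∀ x : X, ∃ u v, 0 ≤ u ∧ 0 ≤ v ∧ Wi d M (α u) (β v) ∧
      ¬ Near d r x (α u)) : Hop d α β := by
  intro s r N hN
  wlog hr : 0 ≤ r generalizing r
  · obtain ⟨u, v, hu, hv, h1, h2⟩ := this 0 le_rfl
    exact ⟨u, v, hu, hv, h1, fun σ ℓ hσ t h3 h4 h5 => h2 σ ℓ hσ t h3 h4 (h5.mono (by linarith))⟩
  -- The part of `α` up to time `K` lies in a ball around `α 0`, which the crossing avoids.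
  have late : ∀ K, 0 ≤ K → ∃ u v, K ≤ u ∧ 0 ≤ v ∧ Wi d M (α u) (β v) := by
    intro K hK
    obtain ⟨C, hC0, hC⟩ : ∃ C, 0 ≤ C ∧ ∀ u, 0 ≤ u → u ≤ K → Near d C (α 0) (α u) := by
      rcases hα with hα | hα
      · obtain ⟨C, hC0, hC⟩ := hα.bdd K hK
        exact ⟨C, hC0, fun u h0 h1 => Or.inl (hC 0 u le_rfl h0 h1)⟩
      · obtain ⟨C, hC0, hC⟩ := hα.bdd K hK
        exact ⟨C, hC0, fun u h0 h1 => Or.inr (hC 0 u le_rfl h0 h1)⟩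
    obtain ⟨u, v, hu, hv, h1, h2⟩ := h C hC0 (α 0)
    exact ⟨u, v, by by_contra hcon; exact h2 (hC u hu (not_le.1 hcon).le), hv, h1⟩
  -- The points of `β` up to time `K` reach one point `w` within a bounded distance. A crossing that
  -- ends there would start near `w`, which late points of `α` do not.
  have late' : ∀ K, 0 ≤ K → ∃ u v, K ≤ u ∧ K ≤ v ∧ Wi d M (α u) (β v) := by
    intro K hK
    obtain ⟨w, C, hC0, hC⟩ : ∃ w C, 0 ≤ C ∧ ∀ v, 0 ≤ v → v ≤ K → Wi d C (β v) w := by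
      rcases hβ with hβ | hβ
      · obtain ⟨C, hC0, hC⟩ := hβ.bdd K hK
        exact ⟨β K, C, hC0, fun u h0 h1 => hC u K h0 h1 le_rfl⟩
      · obtain ⟨C, hC0, hC⟩ := hβ.bdd K hK
        exact ⟨β 0, C, hC0, fun u h0 h1 => hC 0 u le_rfl h0 h1⟩
    obtain ⟨N₁, hN₁0, hN₁⟩ := hα.far.leave H.met w (M + C)
    obtain ⟨u, v, hu, hv, h1⟩ := late (max K N₁) (le_max_of_le_left hK)
    refine ⟨u, v, (le_max_left _ _).trans hu, ?_, h1⟩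
    by_contra hcon
    exact hN₁ u ((le_max_right _ _).trans hu) (Or.inr (h1.trans H.met hM hC0
      (hC v hv (not_le.1 hcon).le)))
  obtain ⟨N₁, hN₁0, hN₁⟩ := hα.far.leave H.met s (r + M)
  obtain ⟨N₂, hN₂0, hN₂⟩ := hβ.far.leave H.met s (r + M)
  obtain ⟨u, v, hu, hv, h1⟩ := late' (max N (max N₁ N₂)) (le_max_of_le_left hN)
  refine ⟨u, v, (le_max_left _ _).trans hu, (le_max_left _ _).trans hv, h1.ne_top,
    fun σ ℓ hσ t h3 h4 h5 => ?_⟩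
  have hl := hσ.length_le hM h1
  rcases h5 with h5 | h5
  · exact hN₂ v ((le_max_right _ _).trans ((le_max_right _ _).trans hv)) (Or.inl
      (h5.trans H.met hr hM ((hσ.wi_right h3 h4).mono (by linarith))))
  · exact hN₁ u ((le_max_left _ _).trans ((le_max_right _ _).trans hu)) (Or.inr
      ((((hσ.wi_left h3 h4).mono (h4.trans hl)).trans H.met hM hr h5).mono (by linarith)))

lemma QGLine.le.hop (H : HypSpace d δ f) {R₁ R₂ : QGLine d} (h : R₁.le R₂) :
    Hop d R₁.pt R₂.pt := by
  obtain ⟨M, hM, h⟩ := h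
  refine hop_of_crossings H (R₁.isLine H) (R₂.isLine H) hM fun r hr x => ?_
  obtain ⟨P, a, b, L, hP, ⟨u, hu, hua⟩, ⟨v, hv, hvb⟩, hL, hLM, hav⟩ := h r hr x
  refine ⟨u, v, hu, hv, ?_, fun hn => hav a ⟨le_rfl, hP.1.le⟩ ?_⟩
  · rw [hua, hvb]
    exact (hL.dist_le H.met).trans hLM
  · rw [← hua]
    exact hn

/-- Equality in the quotient is the generated equivalence. `Hop` in both directions is already
reflexive, symmetric and transitive on rays and anti-rays, so nothing is needed about transitivity
of the relation `≤`. -/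
lemma QGLine.hop_of_mk_eq (H : HypSpace d δ f) {R₁ R₂ : QGLine d}
    (h : (Quot.mk _ R₁ : Boundary d) = Quot.mk _ R₂) : Hop d R₁.pt R₂.pt := by
  have h' := Quot.eqvGen_exact h
  suffices hs : Hop d R₁.pt R₂.pt ∧ Hop d R₂.pt R₁.pt from hs.1
  induction h' with
  | rel x y hxy => exact ⟨hxy.1.hop H, hxy.2.hop H⟩
  | refl x => exact ⟨(x.isLine H).hop_refl H.met, (x.isLine H).hop_refl H.met⟩
  | symm x y _ ih => exact (ih (Quot.eqvGen_sound ‹_›)).symm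
  | trans x y z h1 h2 ih1 ih2 =>
    have i1 := ih1 (Quot.eqvGen_sound h1)
    have i2 := ih2 (Quot.eqvGen_sound h2)
    exact ⟨i1.1.trans H (y.isLine H) i2.1, i2.2.trans H (y.isLine H) i1.2⟩

end Ends

/-! ### Splitting geodesics between ends -/

section Core

variable {X : Type*} {d : X → X → ℝ≥0∞} {δ : ℝ} {f : ℝ → ℝ} {α β β' γ : ℝ → X}

/-- Points close to `s` from which late points of an end can be reached have bounded distance to a
fixed point. -/
lemma IsEnd.bounded_target (H : HypSpace d δ f) (hγ : IsEnd d γ) (s : X) {m : ℝ} (hm : 0 ≤ m) :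
    ∃ (N : ℝ) (w : X) (C : ℝ), 0 ≤ N ∧ 0 ≤ C ∧
      ∀ k p, N ≤ k → Wi d m s p → d p (γ k) ≠ ⊤ → Wi d C p w := by
  have hδ := H.nonneg
  -- If later points of `γ` reach earlier ones, all these `p` reach a single point of `γ`, and (B1)
  -- with centre `s` bounds the distances.
  have easy : (∀ k k', 0 ≤ k → k ≤ k' → d (γ k') (γ k) ≠ ⊤) → ∃ (N : ℝ) (w : X) (C : ℝ),
      0 ≤ N ∧ 0 ≤ C ∧ ∀ k p, N ≤ k → Wi d m s p → d p (γ k) ≠ ⊤ → Wi d C p w := by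
    intro hback
    by_cases hex : ∃ k p, 0 ≤ k ∧ Wi d m s p ∧ d p (γ k) ≠ ⊤
    · obtain ⟨k₁, p₁, hk₁, hp₁, hf₁⟩ := hex
      have hw := wi_of_ne_top (ne_top_trans H.met hp₁.ne_top hf₁)
      have hB : 0 ≤ max m (d s (γ k₁)).toReal := le_max_of_le_left hm
      exact ⟨k₁, γ k₁, f (max m (d s (γ k₁)).toReal), hk₁, H.f_nonneg s _ hB,
        fun k p hk hp hf => H.b1 _ _ _ _ hB (hp.mono (le_max_left _ _)) (hw.mono (le_max_right _ _))
          (ne_top_trans H.met hf (hback _ _ hk₁ hk))⟩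
    · exact ⟨0, s, 0, le_rfl, le_rfl, fun k p hk hp hf => absurd ⟨k, p, hk, hp, hf⟩ hex⟩
  rcases hγ with (hγ | hγ) | ⟨x, rfl⟩
  · set F := f (m + δ) with hFd
    have hF : 0 ≤ F := H.f_nonneg s _ (by linarith)
    obtain ⟨N₀, hN₀0, hN₀⟩ := hγ.far s (m + (F + 1) + δ + 4 * δ + 10)
    by_cases hex : ∃ k p, N₀ ≤ k ∧ Wi d m s p ∧ d p (γ k) ≠ ⊤
    · obtain ⟨k₁, p₁, hk₁, hp₁, hf₁⟩ := hex
      have hk₁0 := hN₀0.trans hk₁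
      have hsw := ne_top_trans H.met hp₁.ne_top hf₁
      obtain ⟨G₁, L₁, hG₁⟩ := H.geod _ _ hsw
      have hL₁ := hG₁.nonneg
      refine ⟨k₁, γ k₁, F + 1 + δ + (4 * δ + 1) + L₁, hk₁0, by linarith, fun k p hk hp hf => ?_⟩
      obtain ⟨π, ℓ, hπ⟩ := H.geod _ _ hf
      obtain ⟨E, le, hE⟩ := H.geod _ _ hp.ne_top
      have hle := hE.length_le hm hp
      obtain ⟨G, L, hG⟩ := H.geod _ _ (ne_top_trans H.met hsw (hγ.fin _ _ hk₁0 hk))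
      obtain ⟨W, lw, hW⟩ := H.geod _ _ (hγ.fin _ _ hk₁0 hk)
      have hnot : ∀ r, 0 ≤ r → r ≤ m + (F + 1) + δ + 4 * δ + 10 → ¬ Wi d r s (γ k) := by
        intro r hr0 hr hw
        refine hN₀ k₁ k hk₁ (hk₁.trans hk) _ _ hW lw hW.nonneg le_rfl ?_
        rw [hW.finish]
        exact Or.inl (hw.mono hr)
      have hKl : F + 1 ≤ ℓ := by
        by_contra hcon
        push Not at hcon
        have h1 := hπ.wi_left hπ.nonneg le_rfl
        rw [hπ.finish] at h1
        exact hnot (m + ℓ) (by linarith [hπ.nonneg]) (by linarith) (hp.trans H.met hm hπ.nonneg h1)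
      have hpF := hπ.wi_left (show 0 ≤ F + 1 by linarith) hKl
      -- At distance `F + 1` from `p` the geodesic `π` has left the side from `s` to `p`: otherwise
      -- (B1) would give `F + 1 ≤ F`.
      rcases H.thin _ _ _ _ _ _ _ _ _ hπ (Or.inr hE) (Or.inr hG) (F + 1) (by linarith) hKl with
        ⟨v, h0, h1, h2⟩ | ⟨v, h0, h1, h2⟩
      · have h3 := (((hE.wi_left h0 h1).mono (h1.trans hle)).trans H.met hm hδ h2)
        have h4 := H.b1 _ _ _ (m + δ) (by linarith) (hp.mono (by linarith)) h3 hpF.ne_top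
        have := hπ.le_of_wi_left (by linarith) hKl hF h4
        linarith
      · have h3 := hpF.trans H.met (by linarith) hδ h2
        have hv := hG.le_of_wi_left h0 h1 (by linarith) (hp.trans H.met hm (by linarith) h3)
        have hvL : v + 3 * δ + 1 ≤ L := by
          by_contra hcon
          push Not at hcon
          have h4 := hG.wi_left hG.nonneg le_rfl
          rw [hG.finish] at h4
          exact hnot L hG.nonneg (by linarith) h4
        -- `W` is far from `s`, so `G` is still close to `G₁` here. The extra `3δ + 1` lets
        -- `parallel_start` lead from `G v` to `G₁` and on to `γ k₁`.
        rcases H.thin _ _ _ _ _ _ _ _ _ hG (Or.inl hG₁) (Or.inr hW) (v + 3 * δ + 1) (by linarith)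
          hvL with ⟨σ, h5, h6, h7⟩ | ⟨σ, h5, h6, h7⟩
        · obtain ⟨v', h8, h9, h10⟩ := H.parallel_start hG hG₁ h0 (by linarith) hvL h5 h6 h7 one_pos
          exact (((h3.trans H.met (by linarith) (by linarith) h10).trans H.met (by linarith)
            (by linarith) (hG₁.wi_right h8 h9))).mono (by linarith)
        · exfalso
          have h8 := (hG.wi_left (by linarith) hvL).trans H.met (by linarith) hδ h7
          exact hN₀ k₁ k hk₁ (hk₁.trans hk) _ _ hW σ h5 h6 (Or.inl (h8.mono (by linarith)))
    · exact ⟨N₀, s, 0, hN₀0, le_rfl, fun k p hk hp hf => absurd ⟨k, p, hk, hp, hf⟩ hex⟩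
  · exact easy fun k k' h0 h1 => hγ.fin k k' h0 h1
  · exact easy fun k k' h0 h1 => by simp [H.met.refl]

/-- A geodesic that starts at a late point of a backward line and passes close to `s` can be
replaced by one that starts even later on this line. -/
lemma FLine.shift_start (H : HypSpace d δ f) (hα : FLine (SemiMet.op d) α) (hγ : IsEnd d γ) (s : X)
    {m τ : ℝ} (hm : 0 ≤ m) (hτ : 0 < τ) : ∃ N : ℝ, 0 ≤ N ∧ ∀ i k, N ≤ i → N ≤ k → ∀ π ℓ,
      Seg d π ℓ (α i) (γ k) → ∀ u, 0 ≤ u → u ≤ ℓ → Near d m s (π u) → ∀ i', i ≤ i' →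
      ∀ ζ ℓ', Seg d ζ ℓ' (α i') (γ k) → ∃ v, 0 ≤ v ∧ v ≤ ℓ' ∧ Near d (m + 4 * δ + τ) s (ζ v) := by
  have hδ := H.nonneg
  have hfar : Far d α := hα.far.op
  obtain ⟨N₁, w, C, hN₁0, hC0, hN₁⟩ := hγ.bounded_target H s hm
  obtain ⟨N₂, hN₂0, hN₂⟩ := hfar w (δ + C)
  obtain ⟨N₃, hN₃0, hN₃⟩ := hfar s (m + 4 * δ + 1)
  refine ⟨max N₁ (max N₂ N₃), le_max_of_le_left hN₁0, ?_⟩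
  intro i k hi hk π ℓ hπ u h0 h1 hs i' hi' ζ ℓ' hζ
  have hk₁ := (le_max_left _ _).trans hk
  have hi₂ := (le_max_left _ _).trans ((le_max_right _ _).trans hi)
  have hi₃ := (le_max_right _ _).trans ((le_max_right _ _).trans hi)
  have hi0 := hN₂0.trans hi₂
  obtain ⟨Y, ly, hY⟩ := H.geod (α i') (α i) (hα.fin _ _ hi0 hi')
  rcases hs with hs | hs
  · rcases H.thin _ _ _ _ _ _ _ _ _ hπ (Or.inr hY) (Or.inr hζ) u h0 h1 with
      ⟨v, h3, h4, h5⟩ | ⟨v, h3, h4, h5⟩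
    -- A point of `Y` that reaches `π u` within `δ` is within `δ + C` of `w`, but `Y` is far from
    -- `w`.
    · exfalso
      have h6 := hN₁ k (π u) hk₁ hs (hπ.wi_right h0 h1).ne_top
      exact hN₂ i' i (hi₂.trans hi') hi₂ _ _ hY v h3 h4 (Or.inr (h5.trans H.met hδ hC0 h6))
    · exact ⟨v, h3, h4, Or.inl ((hs.trans H.met hm hδ h5).mono (by linarith))⟩
  -- Now `π u` reaches `s`, so a distance from `ζ` to `π u` is needed. There is room for
  -- `parallel_end` because `α i` is far from `s`.
  · have hu : 3 * δ + 1 ≤ u := by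
      by_contra hcon
      push Not at hcon
      refine hN₃ i' i (hi₃.trans hi') hi₃ _ _ hY ly hY.nonneg le_rfl ?_
      rw [hY.finish]
      exact Or.inr (((hπ.wi_left h0 h1).trans H.met h0 hm hs).mono (by linarith))
    rcases H.thin _ _ _ _ _ _ _ _ _ hπ (Or.inr hY) (Or.inr hζ) (u - (3 * δ + 1)) (by linarith)
      (by linarith) with ⟨v, h3, h4, h5⟩ | ⟨v, h3, h4, h5⟩
    · exfalso
      have h6 := hπ.wi (s := u - (3 * δ + 1)) (by linarith) (by linarith) h1
      exact hN₃ i' i (hi₃.trans hi') hi₃ _ _ hY v h3 h4 (Or.inr ((h5.trans H.met hδ (by linarith)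
        (h6.trans H.met (by linarith) hm hs)).mono (by linarith)))
    · obtain ⟨v', h6, h7, h8⟩ := H.parallel_end hπ hζ h1 (by linarith) (by linarith) h3 h4 h5 hτ
      exact ⟨v', h6, h7, Or.inr ((h8.trans H.met (by linarith) hm hs).mono (by linarith))⟩

/-- The line contains points far from its start, so some geodesic has a point at distance exactly
`1` from it; (B1) around the start bounds this distance. -/
lemma FLine.one_le (H : HypSpace d δ f) (hα : FLine d α) : 1 ≤ f (δ + 1) := by
  have hδ := H.nonneg
  obtain ⟨N, hN0, hN⟩ := hα.far.leave H.met (α 0) 1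
  obtain ⟨γ, ℓ, hγ⟩ := H.geod _ _ (hα.fin 0 N le_rfl hN0)
  have hl : 1 ≤ ℓ := by
    by_contra hcon
    push Not at hcon
    have := hγ.wi_left hγ.nonneg le_rfl
    rw [hγ.finish] at this
    exact hN N le_rfl (Or.inl (this.mono hcon.le))
  have h1 := hγ.wi_left zero_le_one hl
  have h2 := H.b1 (α 0) (α 0) _ (δ + 1) (by linarith) (by simp [Wi, H.met.refl])
    (h1.mono (by linarith)) h1.ne_top
  exact hγ.le_of_wi_left zero_le_one hl (H.f_nonneg (α 0) _ (by linarith)) h2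

/-- Late geodesics between two ends can be shifted to later starting points on a backward line. -/
lemma IsEnd.shift_start (H : HypSpace d δ f) (α : ℝ → X) (hγ : IsEnd d γ) (s : X)
    {m τ : ℝ} (hm : 0 ≤ m) (hτ : 0 < τ) : ∃ N : ℝ, 0 ≤ N ∧ ∀ i k, N ≤ i → N ≤ k → ∀ π ℓ,
      Seg d π ℓ (α i) (γ k) → ∀ u, 0 ≤ u → u ≤ ℓ → Near d m s (π u) → ∀ i', i ≤ i' →
      (FLine (SemiMet.op d) α ∨ i' = i) → ∃ ζ ℓ' v, Seg d ζ ℓ' (α i') (γ k) ∧ 0 ≤ v ∧ v ≤ ℓ' ∧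
        Near d (m + (2 * δ + 2 * δ * f (δ + 1)) + τ) s (ζ v) := by
  have hδ := H.nonneg
  have hF := H.f_nonneg s (δ + 1) (by linarith)
  by_cases hα : FLine (SemiMet.op d) α
  · obtain ⟨N, hN0, hN⟩ := hα.shift_start H hγ s hm hτ
    refine ⟨N, hN0, fun i k hi hk π ℓ hπ u h0 h1 hs i' hi' _ => ?_⟩
    obtain ⟨ζ, ℓ', hζ⟩ := H.geod (α i') (γ k) (ne_top_trans H.met
      (hα.fin i i' (hN0.trans hi) hi') hπ.ne_top)
    obtain ⟨v, h2, h3, h4⟩ := hN i k hi hk π ℓ hπ u h0 h1 hs i' hi' ζ ℓ' hζ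
    refine ⟨ζ, ℓ', v, hζ, h2, h3, h4.mono ?_⟩
    -- The shift costs `4δ`, which is at most `2δ + 2δf(δ+1)`.
    have := hα.one_le H.op
    nlinarith
  · refine ⟨0, le_rfl, fun i k hi hk π ℓ hπ u h0 h1 hs i' hi' h => ?_⟩
    obtain rfl := h.resolve_left hα
    have : 0 ≤ 2 * δ * f (δ + 1) := by positivity
    exact ⟨π, ℓ, u, hπ, h0, h1, hs.mono (by linarith)⟩

lemma IsEnd.shift_end (H : HypSpace d δ f) (hα : IsEnd d α) (γ : ℝ → X) (s : X)
    {m τ : ℝ} (hm : 0 ≤ m) (hτ : 0 < τ) : ∃ N : ℝ, 0 ≤ N ∧ ∀ i k, N ≤ i → N ≤ k → ∀ π ℓ,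
      Seg d π ℓ (α i) (γ k) → ∀ u, 0 ≤ u → u ≤ ℓ → Near d m s (π u) → ∀ k', k ≤ k' →
      (FLine d γ ∨ k' = k) → ∃ ζ ℓ' v, Seg d ζ ℓ' (α i) (γ k') ∧ 0 ≤ v ∧ v ≤ ℓ' ∧
        Near d (m + (2 * δ + 2 * δ * f (δ + 1)) + τ) s (ζ v) := by
  obtain ⟨N, hN0, hN⟩ := IsEnd.shift_start H.op γ hα.op s hm hτ
  refine ⟨N, hN0, fun i k hi hk π ℓ hπ u h0 h1 hs k' hk' h => ?_⟩
  obtain ⟨ζ, ℓ', v, h2, h3, h4, h5⟩ := hN k i hk hi _ _ hπ.op (ℓ - u) (by linarith) (by linarith)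
    (near_op.2 (by rwa [sub_sub_cancel])) k' hk' h
  exact ⟨_, ℓ', ℓ' - v, h2.op, by linarith, by linarith, by
    rw [sub_sub_cancel]; exact near_op.1 h5⟩

/-- There are finite distances from late points of `α` to late points of `β`. -/
def Reach (d : X → X → ℝ≥0∞) (α β : ℝ → X) : Prop :=
  ∀ N : ℝ, ∃ i j, N ≤ i ∧ N ≤ j ∧ d (α i) (β j) ≠ ⊤

/-- From `α i` a forward line reaches whatever it reaches from later points, so only a backward `α`
needs `i' ≠ i`. On the target side, a forward `β` passes finiteness on to later points, and a
backward one inherits it from them. -/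
lemma IsEnd.reach_from (hd : IsPseudoSemimetric d) (hα : IsEnd d α) (hβ : IsEnd d β)
    (h : Reach d α β) {i : ℝ} (hi : 0 ≤ i) : ∃ N : ℝ, 0 ≤ N ∧ ∀ u, N ≤ u →
      ∃ i', i ≤ i' ∧ d (α i') (β u) ≠ ⊤ ∧ (FLine (SemiMet.op d) α ∨ i' = i) := by
  have key : ∀ N : ℝ, ∃ i' j, i ≤ i' ∧ N ≤ j ∧ d (α i') (β j) ≠ ⊤ ∧
      (FLine (SemiMet.op d) α ∨ i' = i) := by
    intro N
    obtain ⟨i₁, j, hi₁, hj, hf⟩ := h (max i N)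
    have h1 := (le_max_left _ _).trans hi₁
    have h2 := (le_max_right _ _).trans hj
    rcases hα with (hα | hα) | ⟨x, rfl⟩
    · exact ⟨i, j, le_rfl, h2, ne_top_trans hd (hα.fin _ _ hi h1) hf, Or.inr rfl⟩
    · exact ⟨i₁, j, h1, h2, hf, Or.inl hα⟩
    · exact ⟨i, j, le_rfl, h2, hf, Or.inr rfl⟩
  rcases hβ with (hβ | hβ) | ⟨x, rfl⟩
  · obtain ⟨i', j, h1, h2, h3, h4⟩ := key 0
    exact ⟨j, h2, fun u hu => ⟨i', h1, ne_top_trans hd h3 (hβ.fin _ _ h2 hu), h4⟩⟩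
  · refine ⟨0, le_rfl, fun u hu => ?_⟩
    obtain ⟨i', j, h1, h2, h3, h4⟩ := key u
    exact ⟨i', h1, ne_top_trans hd h3 (hβ.fin _ _ hu h2), h4⟩
  · obtain ⟨i', j, h1, h2, h3, h4⟩ := key 0
    exact ⟨0, le_rfl, fun u hu => ⟨i', h1, h3, h4⟩⟩

lemma Reach.op (h : Reach d α β) : Reach (SemiMet.op d) β α := fun N => by
  obtain ⟨i, j, hi, hj, hf⟩ := h N
  exact ⟨j, i, hj, hi, hf⟩

lemma IsEnd.reach_to (hd : IsPseudoSemimetric d) (hβ : IsEnd d β) (hγ : IsEnd d γ)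
    (h : Reach d β γ) {k : ℝ} (hk : 0 ≤ k) : ∃ N : ℝ, 0 ≤ N ∧ ∀ v, N ≤ v →
      ∃ k', k ≤ k' ∧ d (β v) (γ k') ≠ ⊤ ∧ (FLine d γ ∨ k' = k) :=
  IsEnd.reach_from hd.op hγ.op hβ.op h.op hk

/-- The late points of `β` and of `β'` are equal or joined by geodesics that avoid a given ball. -/
def Join (d : X → X → ℝ≥0∞) (β β' : ℝ → X) : Prop :=
  ∀ (s : X) (r N : ℝ), 0 ≤ N → ∃ u v, N ≤ u ∧ N ≤ v ∧ d (β u) (β' v) ≠ ⊤ ∧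
    (β u = β' v ∨ ∀ σ ℓ, Seg d σ ℓ (β u) (β' v) → ∀ t, 0 ≤ t → t ≤ ℓ → ¬ Near d r s (σ t))

lemma Hop.join (h : Hop d β β') : Join d β β' := fun s r N hN => by
  obtain ⟨u, v, h1, h2, h3, h4⟩ := h s r N hN
  exact ⟨u, v, h1, h2, h3, Or.inr h4⟩

lemma join_const (hd : IsPseudoSemimetric d) (x : X) : Join d (fun _ => x) (fun _ => x) :=
  fun _ _ N _ => ⟨N, N, le_rfl, le_rfl, by simp [hd.refl], Or.inl rfl⟩

lemma Join.exists_chain (hd : IsPseudoSemimetric d) (hα : IsEnd d α) (hβ : IsEnd d β)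
    (hβ' : IsEnd d β') (hγ : IsEnd d γ) (hJ : Join d β β') (h₁ : Reach d α β)
    (h₂ : Reach d β' γ) (s : X) (r : ℝ) {i k N : ℝ} (hi : 0 ≤ i) (hk : 0 ≤ k) (hN : 0 ≤ N) :
    ∃ i' u v k', i ≤ i' ∧ N ≤ u ∧ N ≤ v ∧ k ≤ k' ∧ (FLine (SemiMet.op d) α ∨ i' = i) ∧
      (FLine d γ ∨ k' = k) ∧ d (α i') (β u) ≠ ⊤ ∧ d (β u) (β' v) ≠ ⊤ ∧ d (β' v) (γ k') ≠ ⊤ ∧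
      (β u = β' v ∨ ∀ σ ℓ, Seg d σ ℓ (β u) (β' v) → ∀ t, 0 ≤ t → t ≤ ℓ → ¬ Near d r s (σ t)) := by
  obtain ⟨N₁, hN₁0, hN₁⟩ := hα.reach_from hd hβ h₁ hi
  obtain ⟨N₂, hN₂0, hN₂⟩ := hβ'.reach_to hd hγ h₂ hk
  obtain ⟨u, v, hu, hv, hf, hfar⟩ := hJ s r (max N (max N₁ N₂)) (le_max_of_le_left hN)
  obtain ⟨i', h3, h4, h5⟩ := hN₁ u ((le_max_left _ _).trans ((le_max_right _ _).trans hu))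
  obtain ⟨k', h6, h7, h8⟩ := hN₂ v ((le_max_right _ _).trans ((le_max_right _ _).trans hv))
  exact ⟨i', u, v, k', h3, (le_max_left _ _).trans hu, (le_max_left _ _).trans hv, h6, h5, h8, h4,
    hf, h7, hfar⟩

lemma Join.reach (hd : IsPseudoSemimetric d) (hα : IsEnd d α) (hβ : IsEnd d β)
    (hβ' : IsEnd d β') (hγ : IsEnd d γ) (hJ : Join d β β') (h₁ : Reach d α β)
    (h₂ : Reach d β' γ) : Reach d α γ := by
  intro N
  obtain ⟨i', u, v, k', h1, -, -, h2, -, -, h3, h4, h5, -⟩ := hJ.exists_chain hd hα hβ hβ' hγ h₁ h₂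
    (α 0) 0 (le_max_right N 0) (le_max_right N 0) le_rfl
  exact ⟨i', k', (le_max_left _ _).trans h1, (le_max_left _ _).trans h2,
    ne_top_trans hd h3 (ne_top_trans hd h4 h5)⟩

/-- The diagonal from `x` to `y'` cuts the quadrilateral into two triangles. The case `y = y'` is
separate because a constant end may lie close to `s`. -/
lemma HypSpace.quad_near (H : HypSpace d δ f) {x y y' w s : X} {σ : ℝ → X} {ℓ t m τ : ℝ}
    (hσ : Seg d σ ℓ x w) (h0 : 0 ≤ t) (h1 : t ≤ ℓ) (hm : 0 ≤ m) (hτ : 0 < τ)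
    (hs : Near d m s (σ t)) (hxy : d x y ≠ ⊤) (hyy : d y y' ≠ ⊤) (hyw : d y' w ≠ ⊤)
    (hfar : y = y' ∨ ∀ σ ℓ, Seg d σ ℓ y y' → ∀ t, 0 ≤ t → t ≤ ℓ →
      ¬ Near d (m + 8 * δ + 2 * τ) s (σ t)) :
    (∃ η ℓ' v, Seg d η ℓ' x y ∧ 0 ≤ v ∧ v ≤ ℓ' ∧ Near d (m + 8 * δ + 2 * τ) s (η v)) ∨
      ∃ η ℓ' v, Seg d η ℓ' y' w ∧ 0 ≤ v ∧ v ≤ ℓ' ∧ Near d (m + 8 * δ + 2 * τ) s (η v) := by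
  have hδ := H.nonneg
  have hxy' := ne_top_trans H.met hxy hyy
  obtain ⟨σ₁, ℓ₁, hσ₁⟩ := H.geod _ _ hxy'
  obtain ⟨σ₂, ℓ₂, hσ₂⟩ := H.geod _ _ hyw
  rcases H.triangle_near hσ hσ₁ hσ₂ h0 h1 hτ hm hs with ⟨v, h2, h3, h4⟩ | ⟨v, h2, h3, h4⟩
  · rcases hfar with rfl | hfar
    · exact Or.inl ⟨σ₁, ℓ₁, v, hσ₁, h2, h3, h4.mono (by linarith)⟩
    · obtain ⟨σ₃, ℓ₃, hσ₃⟩ := H.geod _ _ hxy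
      obtain ⟨σ₄, ℓ₄, hσ₄⟩ := H.geod _ _ hyy
      rcases H.triangle_near hσ₁ hσ₃ hσ₄ h2 h3 hτ (by linarith) h4 with
        ⟨v, h5, h6, h7⟩ | ⟨v, h5, h6, h7⟩
      · exact Or.inl ⟨σ₃, ℓ₃, v, hσ₃, h5, h6, h7.mono (by linarith)⟩
      · exact absurd (h7.mono (by linarith)) (hfar _ _ hσ₄ v h5 h6)
  · exact Or.inr ⟨σ₂, ℓ₂, v, hσ₂, h2, h3, h4.mono (by linarith)⟩

/-- Arbitrarily late geodesics from `α` to `β` come `m`-near to `s`. -/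
def Freq (d : X → X → ℝ≥0∞) (s : X) (m : ℝ) (α β : ℝ → X) : Prop :=
  ∀ N : ℝ, ∃ i j, N ≤ i ∧ N ≤ j ∧ ∃ σ ℓ, Seg d σ ℓ (α i) (β j) ∧
    ∃ u, 0 ≤ u ∧ u ≤ ℓ ∧ Near d m s (σ u)

/-- The constant is twice `2δ + 2δf(δ+1)` for shifting start and end, plus `8δ` for the
quadrilateral; `τ` is spent in four quarters. -/
theorem Freq.split (H : HypSpace d δ f) (hα : IsEnd d α) (hβ : IsEnd d β)
    (hβ' : IsEnd d β') (hγ : IsEnd d γ) (hJ : Join d β β') (h₁ : Reach d α β)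
    (h₂ : Reach d β' γ) {s : X} {m τ : ℝ} (hm : 0 ≤ m) (hτ : 0 < τ) (h : Freq d s m α γ) :
    Freq d s (m + 2 * (6 * δ + 2 * δ * f (δ + 1)) + τ) α β ∨
      Freq d s (m + 2 * (6 * δ + 2 * δ * f (δ + 1)) + τ) β' γ := by
  have hδ := H.nonneg
  have hF := H.f_nonneg s (δ + 1) (by linarith)
  have hδF : 0 ≤ 2 * δ * f (δ + 1) := by positivity
  by_contra hcon
  simp only [Freq, not_or, not_forall] at hcon
  obtain ⟨⟨N₁, hN₁⟩, N₂, hN₂⟩ := hcon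
  obtain ⟨N₃, hN₃0, hN₃⟩ := IsEnd.shift_start H α hγ s hm (show 0 < τ / 4 by linarith)
  obtain ⟨N₄, hN₄0, hN₄⟩ := IsEnd.shift_end H hα γ s
    (show 0 ≤ m + (2 * δ + 2 * δ * f (δ + 1)) + τ / 4 by linarith) (show 0 < τ / 4 by linarith)
  set N := max (max N₁ N₂) (max N₃ N₄) with hN
  have g1 : N₁ ≤ N := (le_max_left _ _).trans (le_max_left _ _)
  have g2 : N₂ ≤ N := (le_max_right _ _).trans (le_max_left _ _)
  have g3 : N₃ ≤ N := (le_max_left _ _).trans (le_max_right _ _)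
  have g4 : N₄ ≤ N := (le_max_right _ _).trans (le_max_right _ _)
  obtain ⟨i, k, hi, hk, π, ℓ, hπ, t, ht0, htl, hs⟩ := h N
  have hN0 : 0 ≤ N := hN₃0.trans g3
  obtain ⟨i', u, v, k', hi', hu, hv, hk', hαi, hγk, hf1, hf2, hf3, hfar⟩ := hJ.exists_chain H.met hα
    hβ hβ' hγ h₁ h₂ s (m + (2 * δ + 2 * δ * f (δ + 1)) + τ / 4 + (2 * δ + 2 * δ * f (δ + 1)) +
      τ / 4 + 8 * δ + 2 * (τ / 4)) (hN0.trans hi) (hN0.trans hk) hN0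
  obtain ⟨ζ, l₁, t₁, hζ, a0, a1, a2⟩ := hN₃ i k (g3.trans hi) (g3.trans hk) π ℓ hπ t ht0 htl hs i'
    hi' hαi
  obtain ⟨ξ, l₂, t₂, hξ, b0, b1, b2⟩ := hN₄ i' k (g4.trans (hi.trans hi')) (g4.trans hk) ζ l₁ hζ t₁
    a0 a1 a2 k' hk' hγk
  rcases H.quad_near hξ b0 b1 (by linarith) (show 0 < τ / 4 by linarith) b2 hf1 hf2 hf3 hfar with
    ⟨η, l, w, c1, c2, c3, c4⟩ | ⟨η, l, w, c1, c2, c3, c4⟩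
  · exact hN₁ ⟨i', u, g1.trans (hi.trans hi'), g1.trans hu, η, l, c1, w, c2, c3,
      c4.mono (by linarith)⟩
  · exact hN₂ ⟨v, k', g2.trans hv, g2.trans (hk.trans hk'), η, l, c1, w, c2, c3,
      c4.mono (by linarith)⟩

end Core

/-! ### The limit inferior in terms of late geodesics -/

section Limits

variable {X : Type*} {d : X → X → ℝ≥0∞} {δ : ℝ} {f : ℝ → ℝ} {α β : ℝ → X} {s : X}

lemma geodVals_nonempty_iff (H : HypSpace d δ f) (hd : IsSemimetric d) :
    (∀ n : ℕ, (geodVals d s α β n).Nonempty) ↔ Reach d α β := by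
  constructor
  · intro h N
    obtain ⟨n, hn⟩ := exists_nat_ge N
    obtain ⟨v, i, j, hi, hj, P, a, b, hP, -⟩ := h n
    obtain ⟨γ, ℓ, hγ, -⟩ := hP.exists_seg hd
    exact ⟨i, j, hn.trans hi, hn.trans hj, hγ.ne_top⟩
  · intro h n
    obtain ⟨i, j, hi, hj, hf⟩ := h n
    obtain ⟨γ, ℓ, hγ⟩ := H.geod _ _ hf
    exact ⟨_, i, j, hi, hj, _, _, _, (hγ.isGeodesic H.met).1, rfl⟩

/-- The supremum in the definition of `geodLiminf`. -/
noncomputable def geodSup (d : X → X → ℝ≥0∞) (s : X) (α β : ℝ → X) : ℝ≥0∞ := ⨆ n : ℕ, sInf (geodVals d s α β n)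

lemma geodLiminf_of_reach (H : HypSpace d δ f) (hd : IsSemimetric d) (h : Reach d α β) :
    geodLiminf d s α β = (geodSup d s α β : EReal) :=
  if_pos ((geodVals_nonempty_iff H hd).2 h)

lemma geodLiminf_of_not_reach (H : HypSpace d δ f) (hd : IsSemimetric d) (h : ¬ Reach d α β) :
    geodLiminf d s α β = ⊥ :=
  if_neg fun h' => h ((geodVals_nonempty_iff H hd).1 h')

lemma freq_of_geodSup_lt (hd : IsSemimetric d) {m : ℝ}
    (h : geodSup d s α β < ENNReal.ofReal m) : Freq d s m α β := by
  intro N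
  obtain ⟨n, hn⟩ := exists_nat_ge N
  have h1 : sInf (geodVals d s α β n) < ENNReal.ofReal m :=
    lt_of_le_of_lt (le_iSup (fun n : ℕ => sInf (geodVals d s α β n)) n) h
  obtain ⟨v, ⟨i, j, hi, hj, P, a, b, hP, rfl⟩, hlt⟩ := sInf_lt_iff.1 h1
  obtain ⟨γ, ℓ, hγ, him⟩ := hP.exists_seg hd
  rw [← him] at hlt
  simp only [dSymSet, iInf_lt_iff] at hlt
  obtain ⟨p, ⟨u, hu, rfl⟩, hlt⟩ := hlt
  refine ⟨i, j, hn.trans hi, hn.trans hj, γ, ℓ, hγ, u, hu.1, hu.2, ?_⟩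
  exact (min_lt_iff.1 hlt).imp le_of_lt le_of_lt

lemma Freq.geodSup_le (hd : IsPseudoSemimetric d) {m : ℝ} (h : Freq d s m α β) :
    geodSup d s α β ≤ ENNReal.ofReal m := by
  refine iSup_le fun n => ?_
  obtain ⟨i, j, hi, hj, γ, ℓ, hγ, u, h0, h1, hs⟩ := h n
  refine (sInf_le (show _ ∈ geodVals d s α β n from
    ⟨i, j, hi, hj, _, _, _, (hγ.isGeodesic hd).1, rfl⟩)).trans ?_
  rw [(hγ.isGeodesic hd).2]
  exact (iInf₂_le (γ u) ⟨u, ⟨h0, h1⟩, rfl⟩).trans (min_le_iff.2 hs)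

lemma reach_self (hd : IsPseudoSemimetric d) : Reach d α α := fun N =>
  ⟨N, N, le_rfl, le_rfl, by simp [hd.refl]⟩

lemma Far.geodSup_eq_top (hd : IsSemimetric d) (h : Far d α) : geodSup d s α α = ⊤ := by
  refine ENNReal.eq_top_of_forall_nnreal_le fun r => ?_
  by_contra hcon
  push Not at hcon
  obtain ⟨N, -, hN⟩ := h s r
  obtain ⟨i, j, hi, hj, γ, ℓ, hγ, u, h0, h1, hs⟩ := freq_of_geodSup_lt hd (m := r)
    (by simpa using hcon) N
  exact hN i j hi hj γ ℓ hγ u h0 h1 hs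

end Limits

/-! ### Exponentials of suprema and infima -/

section Exp

lemma exp_neg_mul_eq (ε : ℝ) (x : EReal) :
    EReal.exp (-((ε : EReal) * x)) = EReal.exp (-x) ^ ε := by
  rw [← EReal.exp_mul, EReal.neg_mul, mul_comm]

lemma continuous_exp_neg_mul {ε : ℝ} :
    Continuous fun x : EReal => EReal.exp (-((ε : EReal) * x)) := by
  simp only [exp_neg_mul_eq]
  exact (ENNReal.continuous_rpow_const).comp (EReal.expHomeomorph.continuous.comp continuous_neg)

lemma antitone_exp_neg_mul {ε : ℝ} (hε : 0 < ε) :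
    Antitone fun x : EReal => EReal.exp (-((ε : EReal) * x)) := fun x y h => by
  simp only [exp_neg_mul_eq]
  exact ENNReal.rpow_le_rpow (EReal.exp_monotone (EReal.neg_le_neg_iff.2 h)) hε.le

lemma exp_neg_mul_bot {ε : ℝ} (hε : 0 < ε) : EReal.exp (-((ε : EReal) * ⊥)) = ⊤ := by
  simp [exp_neg_mul_eq, hε]

lemma exp_neg_mul_top {ε : ℝ} (hε : 0 < ε) : EReal.exp (-((ε : EReal) * ⊤)) = 0 := by
  simp [exp_neg_mul_eq, hε]

variable {X : Type*} {d : X → X → ℝ≥0∞}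

/-- The map is antitone and continuous on the extended reals; its value `∞` at `-∞` takes care of
the empty family. -/
lemma exp_neg_mul_iSup {ε : ℝ} (hε : 0 < ε) {ι : Sort*} (g : ι → EReal) :
    EReal.exp (-((ε : EReal) * ⨆ i, g i)) = ⨅ i, EReal.exp (-((ε : EReal) * g i)) :=
  Antitone.map_iSup_of_continuousAt (f := fun x : EReal => EReal.exp (-((ε : EReal) * x)))
    continuous_exp_neg_mul.continuousAt (antitone_exp_neg_mul hε) (exp_neg_mul_bot hε)

lemma exp_neg_mul_iInf {ε : ℝ} (hε : 0 < ε) {ι : Sort*} (g : ι → EReal) :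
    EReal.exp (-((ε : EReal) * ⨅ i, g i)) = ⨆ i, EReal.exp (-((ε : EReal) * g i)) :=
  Antitone.map_iInf_of_continuousAt (f := fun x : EReal => EReal.exp (-((ε : EReal) * x)))
    continuous_exp_neg_mul.continuousAt (antitone_exp_neg_mul hε) (exp_neg_mul_top hε)

lemma rhoExpAt_eq {ε : ℝ} (hε : 0 < ε) (s : X) (η μ : Completion d) :
    rhoExpAt ε s η μ = EReal.exp (-((ε : EReal) * rhoAt s η μ)) := by
  simp only [rhoExpAt, rhoAt, exp_neg_mul_iSup hε]

lemma rhoExp_eq {ε : ℝ} (hε : 0 < ε) (S : Finset X) (η μ : Completion d) :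
    rhoExp S ε η μ = EReal.exp (-((ε : EReal) * rho S η μ)) := by
  simp only [rhoExp, rho, rhoExpAt_eq hε, exp_neg_mul_iInf hε]

lemma exp_le_of_le_ofReal {ε m : ℝ} (hε : 0 < ε) (hm : 0 ≤ m) {V : ℝ≥0∞}
    (h : V ≤ ENNReal.ofReal m) :
    ENNReal.ofReal (Real.exp (-(ε * m))) ≤ EReal.exp (-((ε : EReal) * (V : EReal))) := by
  have h1 : (V : EReal) ≤ (m : EReal) := by
    refine (EReal.coe_ennreal_le_coe_ennreal_iff.2 h).trans ?_
    rw [EReal.coe_ennreal_ofReal, max_eq_left hm]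
  refine le_trans (le_of_eq ?_) (antitone_exp_neg_mul hε h1)
  simp only
  rw [← EReal.coe_mul, ← EReal.coe_neg, EReal.exp_coe]

end Exp

/-! ### The quasi-ultrametric inequality -/

section Ultrametric

variable {X : Type*} {d : X → X → ℝ≥0∞} {δ : ℝ} {f : ℝ → ℝ}

lemma isEnd_of_mem_reps (H : HypSpace d δ f) {η : Completion d} {α : ℝ → X} (h : α ∈ reps η) :
    IsEnd d α := by
  rcases η with x | η
  · exact Or.inr ⟨x, h⟩
  · obtain ⟨R, -, rfl⟩ := h
    exact Or.inl (R.isLine H)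

lemma join_of_mem_reps (H : HypSpace d δ f) {η : Completion d} {α β : ℝ → X} (hα : α ∈ reps η)
    (hβ : β ∈ reps η) : Join d α β := by
  rcases η with x | η
  · have h1 : α = fun _ => x := hα
    have h2 : β = fun _ => x := hβ
    rw [h1, h2]
    exact join_const H.met x
  · obtain ⟨R, hR, rfl⟩ := hα
    obtain ⟨Q, hQ, rfl⟩ := hβ
    exact (QGLine.hop_of_mk_eq H (hR.trans hQ.symm)).join

/-- On the exponential scale, the additive loss `K = 2(6δ + 2δf(δ+1))` of `Freq.split` becomes the
factor `e^{εK}`. -/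
lemma rhoExpAt_le_mul_max (H : HypSpace d δ f) (hd : IsSemimetric d) {ε : ℝ} (hε : 0 < ε) (s : X)
    (η μ ν : Completion d) : rhoExpAt ε s η ν ≤
      ENNReal.ofReal (Real.exp (2 * ε * (6 * δ + 2 * δ * f (δ + 1)))) *
        max (rhoExpAt ε s η μ) (rhoExpAt ε s μ ν) := by
  have hδ := H.nonneg
  have hF := H.f_nonneg s (δ + 1) (by linarith)
  have hK : 0 ≤ 2 * (6 * δ + 2 * δ * f (δ + 1)) := by positivity
  set K := 2 * (6 * δ + 2 * δ * f (δ + 1)) with hKd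
  have hexp : 2 * ε * (6 * δ + 2 * δ * f (δ + 1)) = ε * K := by rw [hKd]; ring
  rw [hexp]
  have hpos : 0 < Real.exp (ε * K) := Real.exp_pos _
  have hne0 : ENNReal.ofReal (Real.exp (ε * K)) ≠ 0 := by simpa using hpos
  rw [← ENNReal.div_le_iff' hne0 ENNReal.ofReal_ne_top]
  -- A bound `c` above the maximum is attained by actual representatives. Those of `μ`, namely `β`
  -- and `β'`, may differ.
  refine le_of_forall_gt_imp_ge_of_dense fun c hc => ?_
  rw [ENNReal.div_le_iff' hne0 ENNReal.ofReal_ne_top]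
  obtain ⟨hc1, hc2⟩ := max_lt_iff.1 hc
  simp only [rhoExpAt, iInf_lt_iff] at hc1 hc2
  obtain ⟨α, hα, β, hβ, hc1⟩ := hc1
  obtain ⟨β', hβ', γ, hγ, hc2⟩ := hc2
  have hr1 : Reach d α β := by
    by_contra hcon
    rw [geodLiminf_of_not_reach H hd hcon, exp_neg_mul_bot hε] at hc1
    exact not_top_lt hc1
  have hr2 : Reach d β' γ := by
    by_contra hcon
    rw [geodLiminf_of_not_reach H hd hcon, exp_neg_mul_bot hε] at hc2
    exact not_top_lt hc2
  have e1 := isEnd_of_mem_reps H hα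
  have e2 := isEnd_of_mem_reps H hβ
  have e3 := isEnd_of_mem_reps H hβ'
  have e4 := isEnd_of_mem_reps H hγ
  have hJ := join_of_mem_reps H hβ hβ'
  have hr3 := hJ.reach H.met e1 e2 e3 e4 hr1 hr2
  rw [geodLiminf_of_reach H hd hr1] at hc1
  rw [geodLiminf_of_reach H hd hr2] at hc2
  refine (iInf₂_le α hα).trans ((iInf₂_le γ hγ).trans ?_)
  rw [geodLiminf_of_reach H hd hr3]
  rcases eq_or_ne (geodSup d s α γ) ⊤ with htop | htop
  · rw [htop, EReal.coe_ennreal_top, exp_neg_mul_top hε]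
    exact zero_le
  set l := (geodSup d s α γ).toReal with hl
  have hl0 : 0 ≤ l := ENNReal.toReal_nonneg
  have hsup : geodSup d s α γ = ENNReal.ofReal l := (ENNReal.ofReal_toReal htop).symm
  -- Geodesics come within `l + τ` of `s` arbitrarily late; `Freq.split` adds `K + τ`, and `τ` tends
  -- to `0` afterwards.
  have hτ : ∀ τ : ℝ, 0 < τ → ENNReal.ofReal (Real.exp (-(ε * (l + τ + K + τ)))) ≤ c := by
    intro τ hτ
    have hfreq : Freq d s (l + τ) α γ := freq_of_geodSup_lt hd (by
      rw [hsup]; exact (ENNReal.ofReal_lt_ofReal_iff (by linarith)).2 (by linarith))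
    rcases hfreq.split H e1 e2 e3 e4 hJ hr1 hr2 (by linarith) hτ with h | h
    · exact (exp_le_of_le_ofReal hε (by linarith) (h.geodSup_le H.met)).trans hc1.le
    · exact (exp_le_of_le_ofReal hε (by linarith) (h.geodSup_le H.met)).trans hc2.le
  have hlim : ENNReal.ofReal (Real.exp (-(ε * (l + K)))) ≤ c := by
    have hcont : Continuous fun τ : ℝ => ENNReal.ofReal (Real.exp (-(ε * (l + τ + K + τ)))) :=
      ENNReal.continuous_ofReal.comp (by fun_prop)
    have ht : Filter.Tendsto (fun τ : ℝ => ENNReal.ofReal (Real.exp (-(ε * (l + τ + K + τ)))))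
        (𝓝[>] 0) (𝓝 (ENNReal.ofReal (Real.exp (-(ε * (l + K)))))) := by
      have := hcont.tendsto 0
      simp only [add_zero] at this
      exact this.mono_left nhdsWithin_le_nhds
    refine le_of_tendsto ht ?_
    filter_upwards [self_mem_nhdsWithin] with τ h
    exact hτ τ h
  rw [hsup, EReal.coe_ennreal_ofReal, max_eq_left hl0, ← EReal.coe_mul, ← EReal.coe_neg,
    EReal.exp_coe]
  calc ENNReal.ofReal (Real.exp (-(ε * l)))
      = ENNReal.ofReal (Real.exp (ε * K)) * ENNReal.ofReal (Real.exp (-(ε * (l + K)))) := by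
        rw [← ENNReal.ofReal_mul hpos.le, ← Real.exp_add]
        congr 2; ring
    _ ≤ _ := by gcongr

lemma rhoExp_le_mul_max (H : HypSpace d δ f) (hd : IsSemimetric d) {ε : ℝ} (hε : 0 < ε)
    (S : Finset X) (η μ ν : Completion d) : rhoExp S ε η ν ≤
      ENNReal.ofReal (Real.exp (2 * ε * (6 * δ + 2 * δ * f (δ + 1)))) *
        max (rhoExp S ε η μ) (rhoExp S ε μ ν) := by
  refine iSup₂_le fun s hs => (rhoExpAt_le_mul_max H hd hε s η μ ν).trans ?_
  gcongr
  · exact le_iSup₂ (f := fun s (_ : s ∈ S) => rhoExpAt ε s η μ) s hs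
  · exact le_iSup₂ (f := fun s (_ : s ∈ S) => rhoExpAt ε s μ ν) s hs

lemma rhoExp_self (H : HypSpace d δ f) (hd : IsSemimetric d) {ε : ℝ} (hε : 0 < ε)
    (S : Finset X) (η : Boundary d) :
    rhoExp S ε (Sum.inr η : Completion d) (Sum.inr η) = 0 := by
  obtain ⟨R, hR⟩ := Quot.exists_rep η
  have hmem : R.pt ∈ reps (Sum.inr η : Completion d) := ⟨R, hR, rfl⟩
  refine le_antisymm (iSup₂_le fun s hs => ?_) zero_le
  refine (iInf₂_le R.pt hmem).trans ((iInf₂_le R.pt hmem).trans (le_of_eq ?_))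
  rw [geodLiminf_of_reach H hd (reach_self H.met), (R.isLine H).far.geodSup_eq_top hd,
    EReal.coe_ennreal_top, exp_neg_mul_top hε]

end Ultrametric

/-! ### The chain lemma and the chain distance -/

section Chains

/-- Frink's chain lemma for an asymmetric function with `D(x,z) ≤ e max {D(x,y), D(y,z)}`. -/
lemma mul_le_chain_sum {Y : Type*} {D : Y → Y → ℝ≥0∞} {e k : ℝ≥0∞} (h1 : 1 ≤ e) (h2 : e * e ≤ 2)
    (hk : k * (e * e) ≤ 1) (hD : ∀ x y z, D x z ≤ e * max (D x y) (D y z)) (n : ℕ) :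
    ∀ c : ℕ → Y, 1 ≤ n → k * D (c 0) (c n) ≤ ∑ i ∈ Finset.range n, D (c i) (c (i + 1)) := by
  induction n using Nat.strong_induction_on with
  | _ n ih =>
  intro c hn
  set T : ℕ → ℝ≥0∞ := fun m => ∑ i ∈ Finset.range m, D (c i) (c (i + 1)) with hT
  change _ ≤ T n
  rcases eq_or_ne (T n) ⊤ with htop | htop
  · rw [htop]; exact le_top
  have he2 : e ≤ 2 := (le_mul_of_one_le_left' h1).trans h2
  have hke : k * e ≤ 1 := (by gcongr; exact le_mul_of_one_le_left' h1 : k * e ≤ k * (e * e)).trans hk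
  have hex : ∃ p, T n ≤ 2 * T (p + 1) := ⟨n - 1, by
    rw [Nat.sub_add_cancel hn]; exact le_mul_of_one_le_left' one_le_two⟩
  classical
  -- The first link whose inclusion brings the partial sum to at least half of the total: the links
  -- before it, and those after it, sum to at most half each.
  let p := Nat.find hex
  have hp : T n ≤ 2 * T (p + 1) := Nat.find_spec hex
  have hpn : p + 1 ≤ n := by
    have : p ≤ n - 1 := Nat.find_min' hex (by
      rw [Nat.sub_add_cancel hn]; exact le_mul_of_one_le_left' one_le_two)
    omega
  have hTmono : Monotone T := fun i j hij =>
    Finset.sum_le_sum_of_subset (Finset.range_mono hij)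
  have hstep : D (c p) (c (p + 1)) ≤ T n := by
    refine le_trans ?_ (hTmono hpn)
    rw [hT]
    simp only [Finset.sum_range_succ]
    exact le_add_self
  have hleft : k * e * D (c 0) (c (p + 1)) ≤ T n := by
    rcases Nat.eq_zero_or_pos p with h0 | h0
    · rw [h0] at hstep ⊢
      exact (mul_le_of_le_one_left' hke).trans hstep
    · have hTp : 2 * T p ≤ T n := by
        have := Nat.find_min hex (show p - 1 < Nat.find hex by change p - 1 < p; omega)
        rw [Nat.sub_add_cancel h0] at this
        exact (not_le.1 this).le
      have ihp := ih p (by omega) c h0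
      -- Two uses of the quasi-ultrametric inequality cost `e * e`: at most `2` for the half sum
      -- before the link, and absorbed by `k` for the link itself.
      calc k * e * D (c 0) (c (p + 1))
          ≤ k * e * (e * max (D (c 0) (c p)) (D (c p) (c (p + 1)))) := by gcongr; exact hD _ _ _
        _ = max (e * e * (k * D (c 0) (c p))) (k * (e * e) * D (c p) (c (p + 1))) := by
            rw [mul_max, mul_max]; congr 1 <;> ring
        _ ≤ T n := max_le ((mul_le_mul' h2 ihp).trans hTp)
            ((mul_le_of_le_one_left' hk).trans hstep)
  obtain ⟨m, hm⟩ := Nat.exists_eq_add_of_le hpn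
  rcases Nat.eq_zero_or_pos m with h0 | h0
  · have hn' : n = p + 1 := by omega
    rw [← hn'] at hleft
    refine le_trans ?_ hleft
    rw [mul_assoc]
    gcongr
    exact le_mul_of_one_le_left' h1
  · have hsplit : T n = T (p + 1) + ∑ i ∈ Finset.range m, D (c (p + 1 + i)) (c (p + 1 + i + 1)) := by
      rw [hT, hm]
      exact Finset.sum_range_add _ _ _
    set B := ∑ i ∈ Finset.range m, D (c (p + 1 + i)) (c (p + 1 + i + 1)) with hB
    have hBle : 2 * B ≤ T n := by
      have hA : T (p + 1) ≠ ⊤ := (lt_of_le_of_lt (hTmono hpn) htop.lt_top).ne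
      have : B ≤ T (p + 1) := by
        rw [hsplit, two_mul] at hp
        exact (ENNReal.add_le_add_iff_left hA).1 hp
      rw [hsplit, two_mul]
      exact add_le_add this le_rfl
    have ihm := ih m (by omega) (fun i => c (p + 1 + i)) h0
    simp only [add_zero, ← add_assoc] at ihm
    rw [← hm] at ihm
    calc k * D (c 0) (c n)
        ≤ k * (e * max (D (c 0) (c (p + 1))) (D (c (p + 1)) (c n))) := by gcongr; exact hD _ _ _
      _ = max (k * e * D (c 0) (c (p + 1))) (e * (k * D (c (p + 1)) (c n))) := by
          rw [mul_max, mul_max]; congr 1 <;> ring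
      _ ≤ T n := max_le hleft ((mul_le_mul' he2 ihm).trans hBle)

variable {X : Type*} {d : X → X → ℝ≥0∞}

lemma chainDist_le_rhoExp (S : Finset X) (ε : ℝ) (η μ : Completion d) :
    chainDist S ε η μ ≤ rhoExp S ε η μ := by
  refine iInf_le_of_le 1 (iInf_le_of_le (fun i => if i = 0 then η else μ)
    (iInf_le_of_le (by simp) (iInf_le_of_le (by simp) (by simp))))

lemma isPseudoSemimetric_chainDist (S : Finset X) (ε : ℝ) :
    IsPseudoSemimetric (chainDist S ε : Completion d → Completion d → ℝ≥0∞) := by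
  refine ⟨fun η => le_antisymm ?_ zero_le, fun x y z => ?_⟩
  · exact iInf_le_of_le 0 (iInf_le_of_le (fun _ => η) (iInf_le_of_le rfl (iInf_le_of_le rfl
      (by simp))))
  · simp only [chainDist, ENNReal.iInf_add, ENNReal.add_iInf]
    refine le_iInf fun m => le_iInf fun c' => le_iInf fun h3 => le_iInf fun h4 => le_iInf fun n =>
      le_iInf fun c => le_iInf fun h1 => le_iInf fun h2 => ?_
    -- The concatenated chains share the index `n`, where `c n = z = c' 0`.
    have hc : ∀ i, (fun j => if j ≤ n then c j else c' (j - n)) (n + i) = c' i := by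
      intro i
      rcases Nat.eq_zero_or_pos i with rfl | hi
      · simp [h2, h3]
      · simp [show ¬ n + i ≤ n by omega]
    refine iInf_le_of_le (n + m) (iInf_le_of_le (fun j => if j ≤ n then c j else c' (j - n))
      (iInf_le_of_le (by simpa using h1) (iInf_le_of_le ((hc m).trans h4) (le_of_eq ?_))))
    rw [Finset.sum_range_add]
    congr 1
    · refine Finset.sum_congr rfl fun i hi => ?_
      have := Finset.mem_range.1 hi
      simp [show i ≤ n by omega, show i + 1 ≤ n by omega]
    · refine Finset.sum_congr rfl fun i _ => ?_
      rw [hc i, add_assoc, hc (i + 1)]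

end Chains

/-- The lower bound of the chain distance. -/
lemma mul_rhoExp_le_chainDist {X : Type*} {d : X → X → ℝ≥0∞} {δ : ℝ} {f : ℝ → ℝ}
    (H : HypSpace d δ f) (hd : IsSemimetric d) {ε ε' : ℝ} (hε : 0 < ε)
    (hε'_def : ε' = Real.exp (2 * ε * (6 * δ + 2 * δ * f (δ + 1)))) (h1 : 1 ≤ ε')
    (hε' : ε' < Real.sqrt 2) (S : Finset X) {η μ : Completion d} (h : ¬ SamePoint η μ) :
    ENNReal.ofReal (3 - 2 * ε') * rhoExp S ε η μ ≤ chainDist S ε η μ := by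
  have hsq : ε' * ε' ≤ 2 := by
    have := Real.mul_self_sqrt (show (0 : ℝ) ≤ 2 by norm_num)
    nlinarith [Real.sqrt_nonneg 2]
  refine le_iInf fun n => le_iInf fun c => le_iInf fun h0 => le_iInf fun hn => ?_
  -- The empty chain forces `η = μ`. Points of `X` are excluded, and at a boundary point `ρ_S^ε`
  -- vanishes because the geodesics between late points of a ray leave every ball.
  rcases Nat.eq_zero_or_pos n with rfl | hpos
  · obtain rfl : η = μ := h0.symm.trans hn
    rcases η with x | η
    · exact absurd ⟨x, rfl, rfl⟩ h
    · rw [rhoExp_self H hd hε, mul_zero]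
      exact zero_le
  · rw [← h0, ← hn]
    refine mul_le_chain_sum (e := ENNReal.ofReal ε') ?_ ?_ ?_ ?_ n c hpos
    · simpa using h1
    · rw [← ENNReal.ofReal_mul (by linarith)]
      exact (ENNReal.ofReal_le_ofReal hsq).trans (by simp)
    · have h3 : 0 ≤ 3 - 2 * ε' := by nlinarith
      rw [← ENNReal.ofReal_mul (by linarith), ← ENNReal.ofReal_mul h3]
      refine ENNReal.ofReal_le_one.2 ?_
      -- `1 - (3 - 2ε')ε'^2 = (ε' - 1)^2 (2ε' + 1)`.
      nlinarith [mul_nonneg (sq_nonneg (ε' - 1)) (show 0 ≤ 2 * ε' + 1 by linarith)]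
    · rw [hε'_def]
      exact fun x y z => rhoExp_le_mul_max H hd hε S x y z

end SemiMet

/-! ### The visual bounds -/

theorem mainTheorem7 {X : Type*} (d : X → X → ℝ≥0∞) (hd : SemiMet.IsSemimetric d)
    (hgeod : SemiMet.IsGeodesicSpace d) (δ : ℝ) (hδ : 0 ≤ δ) (hhyp : SemiMet.IsHyperbolic d δ)
    (S : Finset X) (hS : SemiMet.IsBase d (S : Set X))
    (f : ℝ → ℝ) (hB1 : SemiMet.BoundedOut d f) (hB2 : SemiMet.BoundedIn d f)
    (ε ε' : ℝ) (hε : 0 < ε)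
    (hε'_def : ε' = Real.exp (2 * ε * (6 * δ + 2 * δ * f (δ + 1))))
    (hε' : ε' < Real.sqrt 2) :
    SemiMet.IsVisualPseudoSemimetric S (Real.exp ε)
        (SemiMet.chainDist S ε : SemiMet.Completion d → SemiMet.Completion d → ℝ≥0∞) ∧
      ∀ η μ : SemiMet.Completion d,
        (¬ SemiMet.SamePoint η μ →
          ENNReal.ofReal (3 - 2 * ε') * SemiMet.rhoExp S ε η μ ≤ SemiMet.chainDist S ε η μ) ∧
        SemiMet.chainDist S ε η μ ≤ SemiMet.rhoExp S ε η μ := by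
  have H := SemiMet.HypSpace.of_isHyperbolic hd hgeod hδ hhyp hB1 hB2
  -- `f(δ+1) ≥ 0` is available only when `X` has a point, which any `η` provides.
  have h1 : ∀ η : SemiMet.Completion d, 1 ≤ ε' := by
    intro η
    obtain ⟨x⟩ : Nonempty X := by
      rcases η with x | η
      · exact ⟨x⟩
      · obtain ⟨R, -⟩ := Quot.exists_rep η
        exact ⟨R.pt 0⟩
    have hF := H.f_nonneg x (δ + 1) (by linarith)
    rw [hε'_def]
    exact Real.one_le_exp (by positivity)
  have hlower : ∀ η μ : SemiMet.Completion d, ¬ SemiMet.SamePoint η μ →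
      ENNReal.ofReal (3 - 2 * ε') * SemiMet.rhoExp S ε η μ ≤ SemiMet.chainDist S ε η μ :=
    fun η μ h => SemiMet.mul_rhoExp_le_chainDist H hd hε hε'_def (h1 η) hε' S h
  refine ⟨⟨SemiMet.isPseudoSemimetric_chainDist S ε, Real.one_lt_exp_iff.2 hε,
    max 1 (1 / (3 - 2 * ε')), lt_max_of_lt_left one_pos, fun η μ => ⟨fun h => ?_, ?_⟩⟩,
    fun η μ => ⟨hlower η μ, SemiMet.chainDist_le_rhoExp S ε η μ⟩⟩
  · rw [Real.log_exp, ← SemiMet.rhoExp_eq hε]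
    refine le_trans ?_ (hlower η μ h)
    -- `ε' < √2 < 3/2`.
    have h3 : 0 < 3 - 2 * ε' := by
      have := Real.sqrt_lt_sqrt (by norm_num : (0 : ℝ) ≤ 2) (by norm_num : (2 : ℝ) < (3 / 2) ^ 2)
      rw [Real.sqrt_sq (by norm_num)] at this
      linarith
    gcongr
    rw [one_div_le (lt_max_of_lt_left one_pos) h3]
    exact le_max_right _ _
  · rw [Real.log_exp, ← SemiMet.rhoExp_eq hε]
    refine (SemiMet.chainDist_le_rhoExp S ε η μ).trans (le_mul_of_one_le_left' ?_)
    rw [ENNReal.one_le_ofReal]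
    exact le_max_left _ _
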